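/- Let $(M,g)$ be a compact smooth Riemannian manifold without boundary of dimension $n\ge 2$, with Laplace–Beltrami operator $\Delta_g$. There is a constant $D>0$, depending only on $(M,g)$, such that the following holds. Let $(\varphi_k)_{k\in\mathbb N}$ be any orthonormal basis of $L^2(M)$ consisting of smooth eigenfunctions, $-\Delta_g\varphi_k=\lambda_k^2\varphi_k$, where $0\le\lambda_k\to\infty$. Let $S\subset M$ be a compact embedded smooth submanifold without boundary, of any dimension $d$, with induced Riemannian measure $\sigma$, and let $p>0$ be real. For $h>0$ and $a<b$ let $I_h=\{k: h\lambda_k\in(a,b]\}$, let $E_h$ be the span of $\{\varphi_k\}_{k\in I_h}$, $N_h=\dim_{\mathbb C}E_h$, and $$E(\Lambda,S)=\sum_{\lambda_k\le\Lambda}\Big|\int_S\varphi_k\,d\sigma\Big|^2,\qquad N(S)_h=E(h^{-1}b,S)-E(h^{-1}a,S),\qquad b_{S,h}=\Big(\int_S\varphi_k\,d\sigma\Big)_{k\in I_h}.$$ When $N_h\ge 1$ let $\mathbf E_h$ be the expectation for the uniform probability measure on the $L^2$ unit sphere $\{\sum_{k\in I_h}z_k\varphi_k : z_k\in\mathbb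 C,\ \sum|z_k|^2=1\}$ of $E_h$, and $A_{p,h}=\mathbf E_h\big[\,|\int_S u\,d\sigma|^p\,\big]$. (1) For all $h>0$ and $a<b$ one has $N(S)_h=|b_{S,h}|^2$ and, if $N_h\ge1$, $$A_{p,h}=\frac p2\,N(S)_h^{p/2}\,\beta\Big(\frac p2,N_h\Big),\qquad \beta(x,y)=\frac{\Gamma(x)\Gamma(y)}{\Gamma(x+y)}.$$ (2) Let $a=a_h$ and $b=b_h$ depend on $h\in(0,1]$, with $a_h<b_h$ for all $h\in(0,1]$ and with finite limits $a_0=\lim_{h\to0}a_h$, $b_0=\lim_{h\to0}b_h$ such that $0\le a_0\le b_0$; if $a_0=b_0$, assume moreover that $a_0>0$ and that $Dh\le b_h-a_h$ for all $h\in(0,1]$. Then, as $h\to0^+$, $N_h\to\infty$ and $$A_{p,h}=C_p\,\Big(\frac{N(S)_h}{N_h}\Big)^{p/2}(1+o(1)),\qquad C_p=\Gamma\Big(\frac p2+1\Big)>0.$$ -/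

import Mathlib

open MeasureTheory Set Filter Topology
open scoped Manifold ContDiff Bundle

noncomputable section

namespace EigenPeriod

/-- A smooth Riemannian metric on an `n`-dimensional smooth manifold. -/
abbrev Metric (n : ℕ) (M : Type*) [TopologicalSpace M] [ChartedSpace (EuclideanSpace ℝ (Fin n)) M]
    [IsManifold (𝓡 n) ∞ M] :=
  Bundle.ContMDiffRiemannianMetric (𝓡 n) ∞ (EuclideanSpace ℝ (Fin n))
    (fun x : M => TangentSpace (𝓡 n) x)

section Geometry

variable {n d : ℕ} {M : Type*} [TopologicalSpace M] [ChartedSpace (EuclideanSpace ℝ (Fin n)) M]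
  [IsManifold (𝓡 n) ∞ M]

/-- The Gram matrix `g(∂ᵢF, ∂ⱼF)` at `y` of a parametrization `F` of a piece of `M`.  When `F` is
the inverse of a chart of `M`, these are the components `gᵢⱼ` of the metric in that chart. -/
def gram (g : Metric n M) (F : EuclideanSpace ℝ (Fin d) → M) (y : EuclideanSpace ℝ (Fin d)) :
    Matrix (Fin d) (Fin d) ℝ :=
  Matrix.of fun i j =>
    g.inner (F y) (mfderiv (𝓡 d) (𝓡 n) F y (EuclideanSpace.single i (1 : ℝ)))
      (mfderiv (𝓡 d) (𝓡 n) F y (EuclideanSpace.single j (1 : ℝ)))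

/-- The density `√(det gᵢⱼ)`. -/
def gramDensity (g : Metric n M) (F : EuclideanSpace ℝ (Fin d) → M)
    (y : EuclideanSpace ℝ (Fin d)) : ℝ :=
  √(gram g F y).det

section Measure

variable {X : Type*} [TopologicalSpace X] [ChartedSpace (EuclideanSpace ℝ (Fin d)) X]
  [MeasurableSpace X]

/-- The measure `√(det gᵢⱼ) dy` on the domain of a chart `e` of `X`, where `gᵢⱼ` are the components
in this chart of the pull-back to `X` of the metric of `M` by `ι : X → M`. -/
def chartMeasure (g : Metric n M) (ι : X → M)
    (e : OpenPartialHomeomorph X (EuclideanSpace ℝ (Fin d))) : Measure X :=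
  ((volume.restrict e.target).withDensity
    fun y => ENNReal.ofReal (gramDensity g (ι ∘ e.symm) y)).map e.symm

/-- The Riemannian measure of the pull-back of the metric of `M` by an immersion `ι : X → M`: the
least measure that dominates `√(det gᵢⱼ) dy` in every smooth chart.  Because these local measures
agree on overlaps, it is the measure that equals `√(det gᵢⱼ) dy` in every smooth chart. -/
def surfaceMeasure (g : Metric n M) (ι : X → M) : Measure X :=
  ⨆ e ∈ IsManifold.maximalAtlas (𝓡 d) ∞ X, chartMeasure g ι e

end Measure

/-- The Riemannian volume measure of `(M, g)`. -/
def vol [MeasurableSpace M] (g : Metric n M) : Measure M := surfaceMeasure (d := n) g (id : M → M)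

/-- The Laplace-Beltrami operator in the chart `e`:
`Δu = |g|^(-1/2) ∑ᵢ ∂ᵢ (|g|^(1/2) ∑ⱼ gⁱʲ ∂ⱼ u)`, as a function of the coordinate `y`. -/
def laplaceInChart (g : Metric n M) (e : OpenPartialHomeomorph M (EuclideanSpace ℝ (Fin n)))
    (u : M → ℂ) (y : EuclideanSpace ℝ (Fin n)) : ℂ :=
  (gramDensity g e.symm y)⁻¹ •
    ∑ i, fderiv ℝ (fun w => gramDensity g e.symm w •
        ∑ j, (gram g e.symm w)⁻¹ i j • fderiv ℝ (u ∘ e.symm) w (EuclideanSpace.single j (1 : ℝ)))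
      y (EuclideanSpace.single i (1 : ℝ))

/-- `u` is smooth and `-Δ_g u = lam² u` on `M` (the equation being read in each smooth chart).
In semiclassical form, `-h²Δ_g u = u` with `h⁻¹ = lam`. -/
def IsEigenfunction (g : Metric n M) (lam : ℝ) (u : M → ℂ) : Prop :=
  ContMDiff (𝓡 n) 𝓘(ℝ, ℂ) ∞ u ∧
    ∀ e ∈ IsManifold.maximalAtlas (𝓡 n) ∞ M, ∀ y ∈ e.target,
      -laplaceInChart g e u y = (lam : ℂ) ^ 2 * u (e.symm y)

/-- An orthonormal basis `(φ_k)` of `L²(M, vol_g)` made of smooth eigenfunctions,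
`-Δ_g φ_k = λ_k² φ_k` with `0 ≤ λ_k → ∞`. -/
structure LaplaceEigenbasis [MeasurableSpace M] (g : Metric n M) where
  /-- the frequencies `λ_k = h_k⁻¹` -/
  freq : ℕ → ℝ
  freq_nonneg : ∀ k, 0 ≤ freq k
  tendsto_freq : Tendsto freq atTop atTop
  /-- the eigenfunctions `φ_k` -/
  fn : ℕ → M → ℂ
  isEigenfunction : ∀ k, IsEigenfunction g (freq k) (fn k)
  basis : HilbertBasis ℕ ℂ (Lp ℂ 2 (vol g))
  basis_ae_eq : ∀ k, basis k =ᵐ[vol g] fn k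

end Geometry

/-- The uniform probability measure on the unit sphere of `ℂ^κ`. -/
def uniformSphere (κ : Type*) [Fintype κ] :
    Measure (Metric.sphere (0 : EuclideanSpace ℂ κ) 1) :=
  ((volume : Measure (EuclideanSpace ℂ κ)).toSphere univ)⁻¹ •
    (volume : Measure (EuclideanSpace ℂ κ)).toSphere

namespace LaplaceEigenbasis

variable {n d : ℕ} {M : Type*} [TopologicalSpace M] [ChartedSpace (EuclideanSpace ℝ (Fin n)) M]
  [IsManifold (𝓡 n) ∞ M] [MeasurableSpace M] {g : Metric n M} (Φ : LaplaceEigenbasis g)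

theorem finite_freq_le (L : ℝ) : {k | Φ.freq k ≤ L}.Finite := by
  have h := Φ.tendsto_freq.eventually_gt_atTop L
  rw [← Nat.cofinite_eq_atTop] at h
  refine (Filter.eventually_cofinite.1 h).subset fun k hk => ?_
  simpa using hk

/-- The index set `I_h = {k : h λ_k ∈ (a, b]}` of the spectral cluster. -/
def index (a b h : ℝ) : Finset ℕ :=
  ((Φ.finite_freq_le (b / h)).subset
    (fun _ hk => hk.2 : {k | Φ.freq k ∈ Ioc (a / h) (b / h)} ⊆ _)).toFinset

/-- The spectral cluster `E_h`, the span of the `φ_k` with `k ∈ I_h`. -/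
def cluster (a b h : ℝ) : Submodule ℂ (M → ℂ) :=
  Submodule.span ℂ (Φ.fn '' (Φ.index a b h : Set ℕ))

/-- `N_h = dim_ℂ E_h`. -/
def clusterDim (a b h : ℝ) : ℕ := Module.finrank ℂ (Φ.cluster a b h)

/-- The element `u = ∑_{k ∈ I_h} z_k φ_k` of `E_h`. -/
def combination (a b h : ℝ) (z : EuclideanSpace ℂ (Φ.index a b h)) : M → ℂ :=
  fun x => ∑ k, z k * Φ.fn k x

/-- The expectation `E_h[F(u)]` with respect to the uniform probability measure on the `L²` unit
sphere of `E_h`: since the `φ_k` are orthonormal, `u = ∑ z_k φ_k` runs over this sphere when `z`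
runs over the unit sphere of `ℂ^{I_h}`. -/
def expectation (a b h : ℝ) (F : (M → ℂ) → ℝ) : ℝ :=
  ∫ z, F (Φ.combination a b h z.1) ∂(uniformSphere (Φ.index a b h))

section Submanifold

variable {X : Type*} [TopologicalSpace X] [ChartedSpace (EuclideanSpace ℝ (Fin d)) X]
  [MeasurableSpace X]

/-- The period `∫_S u dσ` of `u` over the submanifold `S = ι(X)`, with the induced measure. -/
def _root_.EigenPeriod.period (g : Metric n M) (ι : X → M) (u : M → ℂ) : ℂ :=
  ∫ s, u (ι s) ∂(surfaceMeasure (d := d) g ι)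

/-- `E(L, S) = ∑_{λ_k ≤ L} |∫_S φ_k dσ|²`. -/
def periodSum (ι : X → M) (L : ℝ) : ℝ :=
  ∑ k ∈ (Φ.finite_freq_le L).toFinset, ‖period (d := d) g ι (Φ.fn k)‖ ^ 2

/-- `N(S)_h = E(h⁻¹ b, S) - E(h⁻¹ a, S)`. -/
def clusterPeriodSum (ι : X → M) (a b h : ℝ) : ℝ :=
  Φ.periodSum (d := d) ι (b / h) - Φ.periodSum (d := d) ι (a / h)

/-- The vector `b_{S,h} = (∫_S φ_k dσ)_{k ∈ I_h}`. -/
def periodVector (ι : X → M) (a b h : ℝ) : EuclideanSpace ℂ (Φ.index a b h) :=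
  WithLp.toLp 2 fun k => period (d := d) g ι (Φ.fn k)

/-- `A_{p,h} = E_h[|∫_S u dσ|^p]`. -/
def periodMoment (ι : X → M) (p a b h : ℝ) : ℝ :=
  Φ.expectation a b h fun u => ‖period (d := d) g ι u‖ ^ p

end Submanifold

end LaplaceEigenbasis

/-- Admissible spectral windows `(a_h, b_h]`, `h ∈ (0, 1]`, with constant `D`: `a_h < b_h`, the
limits `a₀` of `a_h` and `b₀` of `b_h` as `h → 0` exist, `0 ≤ a₀ ≤ b₀`, and if `a₀ = b₀` then
`a₀ > 0` and `D h ≤ b_h - a_h`. -/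
def IsWindow (D : ℝ) (a b : ℝ → ℝ) : Prop :=
  (∀ h ∈ Ioc (0 : ℝ) 1, a h < b h) ∧
    ∃ a₀ b₀ : ℝ, Tendsto a (𝓝[>] 0) (𝓝 a₀) ∧ Tendsto b (𝓝[>] 0) (𝓝 b₀) ∧ 0 ≤ a₀ ∧ a₀ ≤ b₀ ∧
      (a₀ = b₀ → 0 < a₀ ∧ ∀ h ∈ Ioc (0 : ℝ) 1, D * h ≤ b h - a h)

end EigenPeriod

end

/-!
# Random waves and their integrals over submanifolds

The formula for the moments is a computation on the unit sphere of `ℂ^N`. The integral over `S` of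
`∑ z_k φ_k` is the linear form `z ↦ ∑ z_k b_k`. Multiplying its `p`-th absolute moment by a
Gaussian weight and passing to polar coordinates turns the spherical mean into a Gaussian
integral; by unitary invariance the form may be replaced by `|b| z_k`, and what is left is a
product of Gamma functions (`integral_uniformSphere_linearForm_rpow`). Since
`s β(s, N) N^s → Γ(s + 1)` (`tendsto_mul_beta_mul_rpow`), the asymptotics follow as soon as `N_h → ∞`.

That `N_h → ∞` is the only geometric point: for some `D` depending on `(M, g)` alone, the number
of frequencies in `(L, L + D]` tends to infinity with `L` (`exists_eventually_le_ncard_Ioc`). This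
is weaker than Weyl's law with its remainder, and has a direct proof by approximate
eigenfunctions. Suppose that at the frequency `λ` there are `N` nonzero functions `u_j`, supported
in disjoint sets, with `‖(Δ + λ²) u_j‖ ≤ κ λ ‖u_j‖`. The `u_j` are orthogonal, and so are the
errors `(Δ + λ²) u_j`, because `Δ` is local. Hence every combination `u` of the `u_j` satisfies
the same estimate with the same `κ`, and by a dimension count at least `N` frequencies obey
`|λ_k² - λ²| ≤ κ' λ` for any `κ' > κ` (`card_le_ncard_of_approximate_kernel`); they lie within `κ'` of
`λ`. The point is that `κ` does not depend on `N`.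

The functions `u_j` are built in one chart, where `Δ` is an operator in divergence form
(`exists_isQuasimode_disjoint`). Each is a wave `cos (K ψ + θ)` cut off to a tube of radius
`λ^(-1/2)` around a short trajectory of the Hamiltonian field of the symbol of `Δ`, parametrized
by a linear coordinate `τ`. Such a tube loses only `O(λ)` (`abs_divForm_mul_cos_add_le`):

* the phase `ψ` is affine on the level sets of `τ`, and its differential on the trajectory is the
  covector of the trajectory; Hamilton's equations make the defect in the eikonal equation vanish
  to second order on the trajectory, so it is `O(λ⁻¹)` in the tube (`exists_localBounds`);
* the cutoff varies at the scale `λ^(-1/2)`, but along the characteristics of `ψ` only at the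
  scale `1`.

The norm of `u_j` is not small compared with that of its amplitude for one of two choices of `θ`,
since `cos² + sin² = 1` and since the tube and the tube of half the size have comparable volumes
(`volume_rayTube_le`). As `n ≥ 2`, the initial points may vary on a segment transversal to the
trajectories. Any number of trajectories issued from it stay apart for a common time
(`exists_trajectories`), and so do the tubes around them once `λ` is large.
-/

set_option linter.unusedSectionVars false

namespace EigenPeriod

/-! ### Moments of a linear form on the unit sphere -/

section Sphere

variable {κ : Type*} [Fintype κ]

/-- Polar coordinates for a positively homogeneous function against the Gaussian weight. -/
theorem integral_homogeneous_mul_exp_neg_norm_sq {E : Type*} [NormedAddCommGroup E]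
    [NormedSpace ℝ E] [FiniteDimensional ℝ E] [Nontrivial E] [MeasurableSpace E] [BorelSpace E]
    (μ : Measure E) [μ.IsAddHaarMeasure] {f : E → ℝ} {p : ℝ} (hp : 0 ≤ p)
    (hf : ∀ r : ℝ, 0 < r → ∀ x, f (r • x) = r ^ p * f x) :
    ∫ x, f x * Real.exp (-‖x‖ ^ 2) ∂μ =
      (∫ θ, f θ.1 ∂μ.toSphere) * (Real.Gamma ((Module.finrank ℝ E + p) / 2) / 2) := by
  have hpos : 0 < Module.finrank ℝ E := Module.finrank_pos
  set d := Module.finrank ℝ E with hd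
  have h1 : ∫ x, f x * Real.exp (-‖x‖ ^ 2) ∂μ =
      ∫ x : ({(0 : E)}ᶜ : Set E), f x.1 * Real.exp (-‖x.1‖ ^ 2) ∂(μ.comap (↑)) := by
    rw [integral_subtype_comap (measurableSet_singleton _).compl
      (fun x => f x * Real.exp (-‖x‖ ^ 2)), restrict_compl_singleton]
  have h2 : ∫ x : ({(0 : E)}ᶜ : Set E), f x.1 * Real.exp (-‖x.1‖ ^ 2) ∂(μ.comap (↑)) =
      ∫ x : Metric.sphere (0 : E) 1 × Ioi (0 : ℝ),
        f x.1.1 * (x.2.1 ^ p * Real.exp (-x.2.1 ^ 2))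
          ∂μ.toSphere.prod (.volumeIoiPow (d - 1)) := by
    rw [← μ.measurePreserving_homeomorphUnitSphereProd.integral_comp
        (Homeomorph.measurableEmbedding _)]
    refine integral_congr_ae (Eventually.of_forall fun x => ?_)
    have hx : 0 < ‖x.1‖ := norm_pos_iff.2 x.2
    have h3 : x.1 = ‖x.1‖ • (‖x.1‖⁻¹ • x.1) := by
      rw [smul_smul, mul_inv_cancel₀ hx.ne', one_smul]
    simp only [homeomorphUnitSphereProd_apply_fst_coe, homeomorphUnitSphereProd_apply_snd_coe]
    conv_lhs => rw [h3, hf _ hx]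
    rw [← h3]; ring
  have h4 : ∫ r : Ioi (0 : ℝ), r.1 ^ p * Real.exp (-r.1 ^ 2) ∂(.volumeIoiPow (d - 1)) =
      Real.Gamma ((d + p) / 2) / 2 := by
    simp only [Measure.volumeIoiPow, ENNReal.ofReal]
    rw [integral_withDensity_eq_integral_smul (by fun_prop),
      integral_subtype_comap measurableSet_Ioi
        fun a ↦ Real.toNNReal (a ^ (d - 1)) • (a ^ p * Real.exp (-a ^ 2))]
    have h5 := integral_rpow_mul_exp_neg_rpow (p := 2) (q := (d - 1 : ℕ) + p) two_pos
      (by have : (0 : ℝ) ≤ (d - 1 : ℕ) := by positivity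
          linarith)
    rw [show ((d - 1 : ℕ) + p + 1) / 2 = (d + p) / 2 by
      rw [Nat.cast_pred hpos]; ring] at h5
    rw [← mul_one_div, mul_comm, ← h5]
    refine setIntegral_congr_fun measurableSet_Ioi fun x (hx : 0 < x) => ?_
    simp only [NNReal.smul_def, smul_eq_mul]
    rw [Real.coe_toNNReal _ (by positivity), Real.rpow_add hx, Real.rpow_natCast,
      Real.rpow_two, mul_assoc]
  rw [h1, h2, ← h4]
  exact integral_prod_mul (fun θ : Metric.sphere (0 : E) 1 => f θ.1)
    (fun r : Ioi (0 : ℝ) => r.1 ^ p * Real.exp (-r.1 ^ 2))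

/-- The volume of `EuclideanSpace ℂ κ` is a multiple of the product Lebesgue measure. The constant
cancels in spherical means and need not be known. -/
theorem exists_integral_euclidean_eq (κ : Type*) [Fintype κ] :
    ∃ c : ℝ, 0 < c ∧ ∀ f : EuclideanSpace ℂ κ → ℝ,
      ∫ x, f x = c * ∫ z : κ → ℂ, f (WithLp.toLp 2 z) := by
  let e : EuclideanSpace ℂ κ ≃L[ℝ] (κ → ℂ) := PiLp.continuousLinearEquiv 2 ℝ fun _ : κ => ℂ
  let ν : Measure (EuclideanSpace ℂ κ) := (volume : Measure (κ → ℂ)).map e.symm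
  have : ν.IsAddHaarMeasure := e.symm.isAddHaarMeasure_map volume
  obtain ⟨c, hc, h⟩ : ∃ c : NNReal, 0 < c ∧ (volume : Measure (EuclideanSpace ℂ κ)) = c • ν :=
    ⟨_, Measure.addHaarScalarFactor_pos_of_isAddHaarMeasure _ _,
      Measure.isAddLeftInvariant_eq_smul _ _⟩
  refine ⟨c, hc, fun f => ?_⟩
  rw [h, integral_smul_nnreal_measure]
  have : ∫ x, f x ∂ν = ∫ z : κ → ℂ, f (WithLp.toLp 2 z) :=
    e.symm.toHomeomorph.measurableEmbedding.integral_map f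
  rw [this, NNReal.smul_def, smul_eq_mul]

/-- The Gaussian moment of one coordinate, by Fubini and polar coordinates in `ℂ`. -/
theorem integral_norm_coord_rpow_mul_exp [DecidableEq κ] (k₀ : κ) {p : ℝ} (hp : 0 ≤ p) :
    ∫ z : κ → ℂ, ‖z k₀‖ ^ p * Real.exp (-‖(WithLp.toLp 2 z : EuclideanSpace ℂ κ)‖ ^ 2) =
      Real.pi ^ Fintype.card κ * Real.Gamma (p / 2 + 1) := by
  have h1 : ∀ z : κ → ℂ, ‖z k₀‖ ^ p * Real.exp (-‖(WithLp.toLp 2 z : EuclideanSpace ℂ κ)‖ ^ 2) =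
      ∏ k, (‖z k‖ ^ (if k = k₀ then p else 0) * Real.exp (-‖z k‖ ^ (2 : ℝ))) := by
    intro z
    rw [Finset.prod_mul_distrib, ← Real.exp_sum, EuclideanSpace.norm_sq_eq]
    congr 1
    · rw [Finset.prod_eq_single k₀ (by intro b _ hb; simp [hb]) (by simp)]
      simp
    · simp [Finset.sum_neg_distrib]
  simp_rw [h1]
  rw [volume_pi, integral_fintype_prod_eq_prod (𝕜 := ℝ) (μ := fun _ : κ => (volume : Measure ℂ))
    (fun k (w : ℂ) => ‖w‖ ^ (if k = k₀ then p else 0) * Real.exp (-‖w‖ ^ (2 : ℝ)))]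
  have h2 : ∀ q : ℝ, 0 ≤ q → ∫ w : ℂ, ‖w‖ ^ q * Real.exp (-‖w‖ ^ (2 : ℝ)) =
      Real.pi * Real.Gamma (q / 2 + 1) := by
    intro q hq
    rw [Complex.integral_rpow_mul_exp_neg_rpow one_le_two (by linarith)]
    rw [mul_div_cancel_left₀ _ (two_ne_zero), add_div, div_self two_ne_zero]
  rw [Finset.prod_congr rfl fun k _ => h2 _ (by split_ifs <;> linarith), Finset.prod_mul_distrib]
  congr 1
  · simp
  · rw [Finset.prod_eq_single k₀ (by intro b _ hb; simp [hb]) (by simp)]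
    simp

/-- By unitary invariance, a linear form `∑ b_k z_k` may be replaced by `|b| z_{k₀}`. -/
theorem integral_linearForm_rpow_mul_exp [DecidableEq κ] (k₀ : κ) (b : EuclideanSpace ℂ κ) (p : ℝ) :
    ∫ z : EuclideanSpace ℂ κ, ‖∑ k, z k * b k‖ ^ p * Real.exp (-‖z‖ ^ 2) =
      ‖b‖ ^ p * ∫ z : EuclideanSpace ℂ κ, ‖z k₀‖ ^ p * Real.exp (-‖z‖ ^ 2) := by
  obtain ⟨c, hc, hcb⟩ : ∃ c : EuclideanSpace ℂ κ, ‖c‖ = 1 ∧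
      ∀ z : EuclideanSpace ℂ κ, ∑ k, z k * b k = ‖b‖ * inner ℂ c z := by
    let b' : EuclideanSpace ℂ κ := WithLp.toLp 2 fun k => starRingEnd ℂ (b k)
    have hb' : ‖b'‖ = ‖b‖ := by simp [EuclideanSpace.norm_eq, b']
    have hin : ∀ z : EuclideanSpace ℂ κ, ∑ k, z k * b k = inner ℂ b' z := by
      intro z; simp [PiLp.inner_apply, b']
    by_cases hb : b = 0
    · refine ⟨EuclideanSpace.single k₀ 1, by simp, fun z => by simp [hb]⟩
    · have hn : ‖b‖ ≠ 0 := norm_ne_zero_iff.2 hb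
      refine ⟨((‖b‖ : ℂ)⁻¹) • b', ?_, fun z => ?_⟩
      · rw [norm_smul, hb']; simp [hn]
      · rw [hin, inner_smul_left]
        simp only [map_inv₀, Complex.conj_ofReal]
        rw [← mul_assoc, mul_inv_cancel₀ (by exact_mod_cast hn), one_mul]
  obtain ⟨B, hB⟩ := Orthonormal.exists_orthonormalBasis_extension_of_card_eq (𝕜 := ℂ)
    (E := EuclideanSpace ℂ κ) (ι := κ) (by simp) (v := fun _ => c) (s := {k₀})
    ⟨fun i => hc, fun i j hij => absurd (Subsingleton.elim i j) hij⟩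
  have hBk : B k₀ = c := hB k₀ rfl
  let U : EuclideanSpace ℂ κ ≃ₗᵢ[ℝ] EuclideanSpace ℂ κ :=
    { B.repr with map_smul' := fun r x => B.repr.map_smul (r : ℂ) x }
  have hU : ∀ z, U z k₀ = inner ℂ c z := by
    intro z
    rw [← hBk]; exact B.repr_apply_apply z k₀
  have hUn : ∀ z, ‖U z‖ = ‖z‖ := U.norm_map
  have h1 := U.measurePreserving.integral_comp U.toHomeomorph.measurableEmbedding
    (fun z : EuclideanSpace ℂ κ => ‖z k₀‖ ^ p * Real.exp (-‖z‖ ^ 2))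
  rw [← h1, ← integral_const_mul]
  refine integral_congr_ae (Eventually.of_forall fun z => ?_)
  simp only [hcb z, hU, hUn]
  rw [norm_mul, Complex.norm_real, norm_norm, Real.mul_rpow (norm_nonneg _) (norm_nonneg _),
    mul_assoc]

/-- The `p`-th absolute moment of a linear form on the unit sphere of `ℂ^κ`. -/
theorem integral_uniformSphere_linearForm_rpow [Nonempty κ] (b : EuclideanSpace ℂ κ) {p : ℝ}
    (hp : 0 < p) :
    ∫ z, ‖∑ k, z.1 k * b k‖ ^ p ∂(uniformSphere κ) =
      p / 2 * (‖b‖ ^ 2) ^ (p / 2) * ProbabilityTheory.beta (p / 2) (Fintype.card κ) := by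
  classical
  obtain ⟨k₀⟩ := ‹Nonempty κ›
  let V := EuclideanSpace ℂ κ
  change ∫ z : Metric.sphere (0 : V) 1, _ ∂_ = _
  set N : ℝ := ((Fintype.card κ : ℕ) : ℝ) with hN
  have hNpos : 0 < N := by
    rw [hN]; exact_mod_cast Fintype.card_pos_iff.2 ⟨k₀⟩
  have hdim : (Module.finrank ℝ V : ℝ) = 2 * N := by
    rw [finrank_real_of_complex]; simp [V, hN]
  have : Nontrivial V := ⟨⟨EuclideanSpace.single k₀ 1, 0, by
    intro h; simpa using congrArg (fun v : V => v k₀) h⟩⟩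
  obtain ⟨C, hC, hCf⟩ := exists_integral_euclidean_eq κ
  have hp1 := integral_homogeneous_mul_exp_neg_norm_sq (volume : Measure V)
    (f := fun z => ‖∑ k, z k * b k‖ ^ p) hp.le (by
      intro r hr x
      have : ∑ k, (r • x : V) k * b k = (r : ℂ) * ∑ k, x k * b k := by
        rw [Finset.mul_sum]; refine Finset.sum_congr rfl fun k _ => ?_
        rw [← mul_assoc]; rfl
      simp only [this, norm_mul, Complex.norm_real, Real.norm_of_nonneg hr.le]
      rw [Real.mul_rpow hr.le (norm_nonneg _)])
  have hp0 := integral_homogeneous_mul_exp_neg_norm_sq (volume : Measure V)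
    (f := fun _ => 1) (p := 0) le_rfl (by simp)
  rw [integral_linearForm_rpow_mul_exp k₀ b p, hCf,
    integral_norm_coord_rpow_mul_exp k₀ hp.le, hdim] at hp1
  have hq := integral_norm_coord_rpow_mul_exp (κ := κ) k₀ (p := 0) le_rfl
  simp only [Real.rpow_zero, one_mul, zero_div, zero_add, Real.Gamma_one, mul_one] at hq
  simp only [one_mul] at hp0
  rw [hCf, hq, hdim] at hp0
  simp only [integral_const, smul_eq_mul, mul_one, add_zero] at hp0
  rw [mul_div_cancel_left₀ _ two_ne_zero] at hp0
  rw [uniformSphere, integral_smul_measure, ENNReal.toReal_inv, smul_eq_mul]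
  change ((volume : Measure V).toSphere.real univ)⁻¹ * _ = _
  have hG : 0 < Real.Gamma N := Real.Gamma_pos_of_pos hNpos
  have hG2 : 0 < Real.Gamma (N + p / 2) := Real.Gamma_pos_of_pos (by positivity)
  rw [show (2 * N + p) / 2 = N + p / 2 by ring] at hp1
  set σ := (volume : Measure V).toSphere.real univ
  set I : ℝ := ∫ z : Metric.sphere (0 : V) 1, ‖∑ k, z.1 k * b k‖ ^ p ∂(volume : Measure V).toSphere
  set A := C * Real.pi ^ Fintype.card κ with hA
  have hApos : 0 < A := by positivity
  have hσ : σ = 2 * A / Real.Gamma N := by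
    field_simp; linarith
  have hI : I = 2 * (‖b‖ ^ p * A * Real.Gamma (p / 2 + 1)) / Real.Gamma (N + p / 2) := by
    rw [eq_div_iff hG2.ne']
    have : I * Real.Gamma (N + p / 2) = 2 * (I * (Real.Gamma (N + p / 2) / 2)) := by ring
    rw [this, ← hp1]; ring
  rw [hσ, hI, ProbabilityTheory.beta, Real.Gamma_add_one (by positivity),
    ← Real.rpow_natCast_mul (norm_nonneg b), add_comm (p / 2) N]
  rw [show ((2 : ℕ) : ℝ) * (p / 2) = p by push_cast; ring]
  field_simp

end Sphere

/-- `s β(s, N) ~ Γ(s + 1) N^(-s)`: up to a factor tending to `1`, the left-hand side is the sequence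
in the product formula of Gauss for `Γ`. -/
theorem tendsto_mul_beta_mul_rpow {s : ℝ} (hs : 0 < s) :
    Tendsto (fun N : ℕ => s * ProbabilityTheory.beta s N * (N : ℝ) ^ s) atTop
      (𝓝 (Real.Gamma (s + 1))) := by
  have hprod : ∀ n : ℕ, Real.Gamma (s + (n + 1 : ℕ)) =
      (∏ j ∈ Finset.range (n + 1), (s + j)) * Real.Gamma s := by
    intro n
    induction n with
    | zero => simp [Real.Gamma_add_one hs.ne']
    | succ n ih =>
      rw [Finset.prod_range_succ, mul_right_comm, ← ih]
      have : s + ((n + 1 + 1 : ℕ) : ℝ) = (s + (n + 1 : ℕ)) + 1 := by push_cast; ring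
      rw [this, Real.Gamma_add_one (by positivity)]; ring
  have h1 : Tendsto (fun N : ℕ => s * Real.GammaSeq s N * ((s + N) / N)) atTop
      (𝓝 (Real.Gamma (s + 1))) := by
    rw [Real.Gamma_add_one hs.ne']
    have h2 : Tendsto (fun N : ℕ => (s + N) / (N : ℝ)) atTop (𝓝 1) := by
      have h3 : Tendsto (fun N : ℕ => s / (N : ℝ) + 1) atTop (𝓝 (0 + 1)) :=
        (tendsto_const_div_atTop_nhds_zero_nat s).add_const 1
      rw [zero_add] at h3
      refine h3.congr' ?_
      filter_upwards [eventually_gt_atTop 0] with N hN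
      have : (N : ℝ) ≠ 0 := by exact_mod_cast hN.ne'
      field_simp
    simpa using ((Real.GammaSeq_tendsto_Gamma s).const_mul s).mul h2
  refine h1.congr' ?_
  filter_upwards [eventually_gt_atTop 0] with N hN
  have hN' : (0 : ℝ) < N := by exact_mod_cast hN
  have h3 : Real.Gamma (s + (N + 1 : ℕ)) = (s + N) * Real.Gamma (s + N) := by
    rw [show s + ((N + 1 : ℕ) : ℝ) = (s + N) + 1 by push_cast; ring,
      Real.Gamma_add_one (by positivity)]
  have h4 : (N.factorial : ℝ) = N * Real.Gamma N := by
    rw [← Real.Gamma_nat_eq_factorial, Real.Gamma_add_one hN'.ne']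
  have hG : 0 < Real.Gamma (s + N) := Real.Gamma_pos_of_pos (by positivity)
  have hP : 0 < ∏ j ∈ Finset.range (N + 1), (s + (j : ℝ)) :=
    Finset.prod_pos fun j _ => by positivity
  have h5 := (hprod N).symm.trans h3
  rw [Real.GammaSeq, ProbabilityTheory.beta, h4]
  have hsN : (0 : ℝ) < s + N := by positivity
  rw [show Real.Gamma s = (s + N) * Real.Gamma (s + N) / ∏ j ∈ Finset.range (N + 1), (s + (j : ℝ)) by
    rw [eq_div_iff hP.ne', mul_comm, h5]]
  field_simp

/-! ### The Riemannian measure in a chart -/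

section Gram

variable {n d : ℕ} {M : Type*} [TopologicalSpace M] [ChartedSpace (EuclideanSpace ℝ (Fin n)) M]
  [IsManifold (𝓡 n) ∞ M] (g : Metric n M)

theorem gram_apply (F : EuclideanSpace ℝ (Fin d) → M) (y : EuclideanSpace ℝ (Fin d))
    (i j : Fin d) :
    gram g F y i j = g.inner (F y) (mfderiv (𝓡 d) (𝓡 n) F y (EuclideanSpace.single i (1 : ℝ)))
      (mfderiv (𝓡 d) (𝓡 n) F y (EuclideanSpace.single j (1 : ℝ))) := rfl

theorem gram_congr {F F' : EuclideanSpace ℝ (Fin d) → M} {y : EuclideanSpace ℝ (Fin d)}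
    (h : F =ᶠ[𝓝 y] F') : gram g F y = gram g F' y := by
  have key : ∀ (p q : M), p = q → ∀ v w : EuclideanSpace ℝ (Fin n),
      g.inner p v w = g.inner q v w := by
    rintro p q rfl v w; rfl
  ext i j
  rw [gram_apply, gram_apply]
  have h2 := h.mfderiv_eq (I := 𝓡 d) (I' := 𝓡 n)
  rw [h2]
  exact key _ _ h.eq_of_nhds _ _

/-- The matrix of a linear endomorphism in the standard basis. -/
noncomputable def stdMatrix (A : EuclideanSpace ℝ (Fin d) →L[ℝ] EuclideanSpace ℝ (Fin d)) :
    Matrix (Fin d) (Fin d) ℝ :=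
  Matrix.of fun k i => A (EuclideanSpace.single i 1) k

theorem det_stdMatrix (A : EuclideanSpace ℝ (Fin d) →L[ℝ] EuclideanSpace ℝ (Fin d)) :
    (stdMatrix A).det = A.det := by
  have : stdMatrix A = LinearMap.toMatrix (EuclideanSpace.basisFun (Fin d) ℝ).toBasis
      (EuclideanSpace.basisFun (Fin d) ℝ).toBasis A.toLinearMap := by
    ext i j
    simp [stdMatrix, LinearMap.toMatrix_apply]
  rw [this, LinearMap.det_toMatrix]

/-- The first fundamental form in new parameters is `Jᵀ G J`, with `J` the Jacobian matrix. -/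
theorem gram_comp {F : EuclideanSpace ℝ (Fin d) → M}
    {φ : EuclideanSpace ℝ (Fin d) → EuclideanSpace ℝ (Fin d)} {y : EuclideanSpace ℝ (Fin d)}
    (hF : MDifferentiableAt (𝓡 d) (𝓡 n) F (φ y)) (hφ : DifferentiableAt ℝ φ y) :
    gram g (F ∘ φ) y =
      (stdMatrix (fderiv ℝ φ y)).transpose * gram g F (φ y) * stdMatrix (fderiv ℝ φ y) := by
  have hexp : ∀ v : EuclideanSpace ℝ (Fin d), v = ∑ k, v k • EuclideanSpace.single k (1 : ℝ) := by
    intro v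
    conv_lhs => rw [← (EuclideanSpace.basisFun (Fin d) ℝ).sum_repr v]
    simp
  have hd : ∀ i, mfderiv (𝓡 d) (𝓡 n) (F ∘ φ) y (EuclideanSpace.single i (1 : ℝ)) =
      ∑ k, stdMatrix (fderiv ℝ φ y) k i •
        (mfderiv (𝓡 d) (𝓡 n) F (φ y) (EuclideanSpace.single k (1 : ℝ)) :
          TangentSpace (𝓡 n) (F (φ y))) := by
    intro i
    rw [mfderiv_comp y hF hφ.mdifferentiableAt, mfderiv_eq_fderiv]
    change mfderiv (𝓡 d) (𝓡 n) F (φ y) (fderiv ℝ φ y (EuclideanSpace.single i (1 : ℝ))) = _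
    conv_lhs => rw [hexp (fderiv ℝ φ y (EuclideanSpace.single i (1 : ℝ)))]
    exact (map_sum _ _ _).trans (Finset.sum_congr rfl fun k _ => map_smul _ _ _)
  ext i j
  rw [gram_apply, hd, hd]
  simp only [Matrix.mul_apply, Matrix.transpose_apply, Finset.sum_mul]
  rw [Finset.sum_comm]
  change g.inner (F (φ y)) _ _ = _
  simp only [map_sum, map_smul, sum_apply, smul_apply,
    smul_eq_mul, gram_apply, Finset.mul_sum]
  rw [Finset.sum_comm]
  refine Finset.sum_congr rfl fun k _ => Finset.sum_congr rfl fun l _ => ?_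
  ring

theorem gramDensity_comp {F : EuclideanSpace ℝ (Fin d) → M}
    {φ : EuclideanSpace ℝ (Fin d) → EuclideanSpace ℝ (Fin d)} {y : EuclideanSpace ℝ (Fin d)}
    (hF : MDifferentiableAt (𝓡 d) (𝓡 n) F (φ y)) (hφ : DifferentiableAt ℝ φ y) :
    gramDensity g (F ∘ φ) y = |(fderiv ℝ φ y).det| * gramDensity g F (φ y) := by
  rw [gramDensity, gram_comp g hF hφ, Matrix.det_mul, Matrix.det_mul, Matrix.det_transpose,
    det_stdMatrix, gramDensity, ← Real.sqrt_sq_eq_abs, ← Real.sqrt_mul (sq_nonneg _)]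
  congr 1; ring

theorem contDiffOn_gram {F : EuclideanSpace ℝ (Fin d) → M} {U : Set (EuclideanSpace ℝ (Fin d))}
    (hU : IsOpen U) (hF : ContMDiffOn (𝓡 d) (𝓡 n) ∞ F U) (i j : Fin d) :
    ContDiffOn ℝ ∞ (fun y => gram g F y i j) U := by
  intro y hy
  have hFy : ContMDiffAt (𝓡 d) (𝓡 n) ∞ F y := hF.contMDiffAt (hU.mem_nhds hy)
  have hv : ∀ v : EuclideanSpace ℝ (Fin d), ContMDiffAt (𝓡 d)
      ((𝓡 n).prod 𝓘(ℝ, EuclideanSpace ℝ (Fin n)))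
      ∞ (fun y => Bundle.TotalSpace.mk' (EuclideanSpace ℝ (Fin n))
      (E := fun x : M => TangentSpace (𝓡 n) x) (F y)
        (mfderiv (𝓡 d) (𝓡 n) F y v)) y := by
    intro v
    have h1 : ContMDiffAt (𝓡 d) ((𝓡 d).prod 𝓘(ℝ, EuclideanSpace ℝ (Fin d))) ∞
        (fun y => (⟨y, v⟩ : TangentBundle (𝓡 d) (EuclideanSpace ℝ (Fin d)))) y :=
      contMDiffAt_vectorSpace_iff_contDiffAt.2 contDiffAt_const
    have h2 := hF.contMDiffOn_tangentMapWithin (m := ∞) (by simp) hU.uniqueMDiffOn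
    have h3 := (h2.contMDiffAt (x := ⟨y, v⟩)
      ((hU.preimage (FiberBundle.continuous_proj _ _)).mem_nhds hy)).comp y h1
    refine h3.congr_of_eventuallyEq ?_
    filter_upwards [hU.mem_nhds hy] with z hz
    simp only [Function.comp_apply, tangentMapWithin, mfderivWithin_of_isOpen hU hz]
  have hg : ContMDiffAt (𝓡 d) ((𝓡 n).prod 𝓘(ℝ, EuclideanSpace ℝ (Fin n) →L[ℝ] EuclideanSpace ℝ
      (Fin n) →L[ℝ] ℝ)) ∞
      (fun y => Bundle.TotalSpace.mk' (EuclideanSpace ℝ (Fin n) →L[ℝ] EuclideanSpace ℝ (Fin n) →L[ℝ]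
      ℝ)
        (E := fun x : M => (TangentSpace (𝓡 n) x →L[ℝ] TangentSpace (𝓡 n) x →L[ℝ] ℝ)) (F y)
        (g.inner (F y))) y :=
    (g.contMDiff (F y)).comp y hFy
  have h := ContMDiffAt.clm_bundle_apply₂ (F₁ := EuclideanSpace ℝ (Fin n))
    (F₂ := EuclideanSpace ℝ (Fin n)) (F₃ := ℝ) (E₃ := Bundle.Trivial M ℝ) hg
    (hv (EuclideanSpace.single i (1 : ℝ)))
    (hv (EuclideanSpace.single j (1 : ℝ)))
  rw [Bundle.contMDiffAt_totalSpace] at h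
  exact (contMDiffAt_iff_contDiffAt.1 h.2).contDiffWithinAt

theorem contDiffOn_det_gram {F : EuclideanSpace ℝ (Fin d) → M} {U : Set (EuclideanSpace ℝ (Fin d))}
    (hU : IsOpen U) (hF : ContMDiffOn (𝓡 d) (𝓡 n) ∞ F U) :
    ContDiffOn ℝ ∞ (fun y => (gram g F y).det) U := by
  simp only [Matrix.det_apply]
  refine ContDiffOn.sum fun σ _ => ContDiffOn.const_smul _ ?_
  exact contDiffOn_prod fun i _ => contDiffOn_gram g hU hF _ _

theorem continuousOn_gramDensity {F : EuclideanSpace ℝ (Fin d) → M}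
    {U : Set (EuclideanSpace ℝ (Fin d))} (hU : IsOpen U) (hF : ContMDiffOn (𝓡 d) (𝓡 n) ∞ F U) :
    ContinuousOn (gramDensity g F) U :=
  (contDiffOn_det_gram g hU hF).continuousOn.sqrt

end Gram

section ChartMeasure

variable {n d : ℕ} {M : Type*} [TopologicalSpace M] [ChartedSpace (EuclideanSpace ℝ (Fin n)) M]
  [IsManifold (𝓡 n) ∞ M] (g : Metric n M)
  {X : Type*} [TopologicalSpace X] [ChartedSpace (EuclideanSpace ℝ (Fin d)) X]
  [MeasurableSpace X] [BorelSpace X] {ι : X → M}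

theorem aemeasurable_chart_symm (e : OpenPartialHomeomorph X (EuclideanSpace ℝ (Fin d))) :
    AEMeasurable e.symm (volume.restrict e.target) :=
  e.continuousOn_symm.aemeasurable e.open_target.measurableSet

theorem aemeasurable_chart_symm_density
    (e : OpenPartialHomeomorph X (EuclideanSpace ℝ (Fin d))) :
    AEMeasurable e.symm ((volume.restrict e.target).withDensity
      fun y => ENNReal.ofReal (gramDensity g (ι ∘ e.symm) y)) :=
  (aemeasurable_chart_symm e).mono_ac (withDensity_absolutelyContinuous _ _)

theorem chartMeasure_apply (e : OpenPartialHomeomorph X (EuclideanSpace ℝ (Fin d))) {A : Set X}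
    (hA : MeasurableSet A) :
    chartMeasure g ι e A =
      ∫⁻ y in e.symm ⁻¹' A ∩ e.target, ENNReal.ofReal (gramDensity g (ι ∘ e.symm) y) := by
  rw [chartMeasure, Measure.map_apply_of_aemeasurable (aemeasurable_chart_symm_density g e) hA,
    withDensity_apply', Measure.restrict_restrict' e.open_target.measurableSet]

theorem chartMeasure_inter_source (e : OpenPartialHomeomorph X (EuclideanSpace ℝ (Fin d)))
    {A : Set X} (hA : MeasurableSet A) :
    chartMeasure g ι e (A ∩ e.source) = chartMeasure g ι e A := by
  rw [chartMeasure_apply g e (hA.inter e.open_source.measurableSet), chartMeasure_apply g e hA]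
  congr 2
  ext y
  simp only [mem_inter_iff, mem_preimage]
  exact ⟨fun h => ⟨h.1.1, h.2⟩, fun h => ⟨⟨h.1, e.map_target h.2⟩, h.2⟩⟩

variable [IsManifold (𝓡 d) ∞ X]

theorem contMDiffOn_comp_chart_symm (hι : ContMDiff (𝓡 d) (𝓡 n) ∞ ι)
    {e : OpenPartialHomeomorph X (EuclideanSpace ℝ (Fin d))}
    (he : e ∈ IsManifold.maximalAtlas (𝓡 d) ∞ X) :
    ContMDiffOn (𝓡 d) (𝓡 n) ∞ (ι ∘ e.symm) e.target :=
  hι.comp_contMDiffOn (contMDiffOn_symm_of_mem_maximalAtlas he)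

/-- Two chart measures agree where both charts are defined: the densities differ by the Jacobian
of the transition map. -/
theorem chartMeasure_eq_of_subset (hι : ContMDiff (𝓡 d) (𝓡 n) ∞ ι)
    {e e' : OpenPartialHomeomorph X (EuclideanSpace ℝ (Fin d))}
    (he : e ∈ IsManifold.maximalAtlas (𝓡 d) ∞ X) (he' : e' ∈ IsManifold.maximalAtlas (𝓡 d) ∞ X)
    {A : Set X} (hA : MeasurableSet A) (hAe : A ⊆ e.source) (hAe' : A ⊆ e'.source) :
    chartMeasure g ι e A = chartMeasure g ι e' A := by
  rw [chartMeasure_apply g e hA, chartMeasure_apply g e' hA]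
  set S := e.symm ⁻¹' A ∩ e.target with hS
  set S' := e'.symm ⁻¹' A ∩ e'.target with hS'
  have hmeas : MeasurableSet S' := by
    have h1 : S' = Subtype.val '' ((fun y : e'.target => e'.symm y) ⁻¹' A) := by
      rw [hS']; ext y; simp [and_comm]
    rw [h1]
    refine (MeasurableEmbedding.subtype_coe e'.open_target.measurableSet).measurableSet_image.2 ?_
    exact (continuousOn_iff_continuous_domRestrict.1 e'.continuousOn_symm).measurable hA
  let φ : EuclideanSpace ℝ (Fin d) → EuclideanSpace ℝ (Fin d) := e ∘ e'.symm
  have hT : IsOpen (e'.target ∩ e'.symm ⁻¹' e.source) :=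
    e'.isOpen_inter_preimage_symm e.open_source
  have hST : S' ⊆ e'.target ∩ e'.symm ⁻¹' e.source := fun y hy => ⟨hy.2, hAe hy.1⟩
  have hφ : ContDiffOn ℝ ∞ φ (e'.target ∩ e'.symm ⁻¹' e.source) := by
    have h1 : ContMDiffOn (𝓡 d) (𝓡 d) ∞ φ (e'.target ∩ e'.symm ⁻¹' e.source) :=
      (contMDiffOn_of_mem_maximalAtlas he).comp
        ((contMDiffOn_symm_of_mem_maximalAtlas he').mono inter_subset_left)
        inter_subset_right
    exact contMDiffOn_iff_contDiffOn.1 h1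
  have hdiff : ∀ y ∈ S', DifferentiableAt ℝ φ y := fun y hy =>
    (hφ.contDiffAt (hT.mem_nhds (hST hy))).differentiableAt (by simp)
  have himg : S = φ '' S' := by
    ext y
    constructor
    · rintro ⟨h1, h2⟩
      refine ⟨e' (e.symm y), ⟨?_, e'.map_source (hAe' h1)⟩, ?_⟩
      · simpa [e'.left_inv (hAe' h1)] using h1
      · simp only [φ, Function.comp_apply, e'.left_inv (hAe' h1), e.right_inv h2]
    · rintro ⟨z, ⟨h1, h2⟩, rfl⟩
      refine ⟨?_, e.map_source (hAe h1)⟩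
      simpa [φ, e.left_inv (hAe h1)] using h1
  have hinj : InjOn φ S' := by
    intro y hy z hz h
    have h1 := e.injOn (hAe hy.1) (hAe hz.1) h
    exact e'.symm.injOn hy.2 hz.2 h1
  rw [himg, lintegral_image_eq_lintegral_abs_det_fderiv_mul volume hmeas
    (fun y hy => (hdiff y hy).hasFDerivAt.hasFDerivWithinAt) hinj]
  refine setLIntegral_congr_fun hmeas fun y hy => ?_
  have hyT : φ y ∈ e.target := e.map_source (hAe hy.1)
  have hFd : MDifferentiableAt (𝓡 d) (𝓡 n) (ι ∘ e.symm) (φ y) :=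
    ((contMDiffOn_comp_chart_symm hι he).contMDiffAt
      (e.open_target.mem_nhds hyT)).mdifferentiableAt (by simp)
  have h2 := gramDensity_comp g hFd (hdiff y hy)
  have h3 : gramDensity g (ι ∘ e'.symm) y = gramDensity g ((ι ∘ e.symm) ∘ φ) y := by
    rw [gramDensity, gramDensity, gram_congr g]
    filter_upwards [hT.mem_nhds (hST hy)] with z hz
    simp only [φ, Function.comp_apply, e.left_inv hz.2]
  rw [h3, h2, ENNReal.ofReal_mul (abs_nonneg _)]

/-- On the domain of a chart, the supremum defining `surfaceMeasure` is the measure of that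
chart. -/
theorem surfaceMeasure_restrict_source (hι : ContMDiff (𝓡 d) (𝓡 n) ∞ ι)
    {e : OpenPartialHomeomorph X (EuclideanSpace ℝ (Fin d))}
    (he : e ∈ IsManifold.maximalAtlas (𝓡 d) ∞ X) :
    (surfaceMeasure (d := d) g ι).restrict e.source = chartMeasure g ι e := by
  have hself : (chartMeasure g ι e).restrict e.source = chartMeasure g ι e := by
    ext A hA
    rw [Measure.restrict_apply hA, chartMeasure_inter_source g e hA]
  refine le_antisymm ?_ ?_
  · -- the sum below dominates every chart measure, being infinite off the domain of `e`
    let ν : Measure X := chartMeasure g ι e + ((⊤ : ENNReal) • Measure.count).restrict e.sourceᶜ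
    have hν : surfaceMeasure (d := d) g ι ≤ ν := by
      refine iSup₂_le fun e' he' => Measure.le_iff.2 fun A hA => ?_
      simp only [ν, Measure.add_apply, Measure.restrict_apply hA, Measure.smul_apply, smul_eq_mul]
      rcases (A ∩ e.sourceᶜ).eq_empty_or_nonempty with h | h
      · have hAe : A ⊆ e.source := by
          rwa [← sdiff_eq, sdiff_eq_empty] at h
        rw [← chartMeasure_inter_source g e' hA,
          ← chartMeasure_eq_of_subset g hι he he' (hA.inter e'.open_source.measurableSet)
            (inter_subset_left.trans hAe) inter_subset_right]
        exact (measure_mono inter_subset_left).trans le_self_add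
      · rw [ENNReal.top_mul (Measure.count_ne_zero h)]
        simp
    refine (Measure.restrict_mono_measure hν _).trans (le_of_eq ?_)
    rw [Measure.restrict_add, hself, Measure.restrict_restrict e.open_source.measurableSet,
      inter_compl_self]
    simp
  · rw [← hself]
    exact Measure.restrict_mono_measure (le_iSup₂_of_le e he le_rfl) _

/-- Locally the surface measure has a continuous density, and finitely many charts suffice. -/
theorem isFiniteMeasure_surfaceMeasure [CompactSpace X] (hι : ContMDiff (𝓡 d) (𝓡 n) ∞ ι) :
    IsFiniteMeasure (surfaceMeasure (d := d) g ι) := by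
  refine ⟨isCompact_univ.measure_lt_top_of_nhdsWithin fun x _ => ?_⟩
  rw [nhdsWithin_univ]
  set e := chartAt (EuclideanSpace ℝ (Fin d)) x
  have he : e ∈ IsManifold.maximalAtlas (𝓡 d) ∞ X := IsManifold.chart_mem_maximalAtlas x
  have hx : x ∈ e.source := mem_chart_source _ x
  obtain ⟨r, hr, hball⟩ := Metric.nhds_basis_closedBall.mem_iff.1
    (e.open_target.mem_nhds (e.map_source hx))
  let U := e.source ∩ e ⁻¹' Metric.ball (e x) r
  have hUo : IsOpen U := e.isOpen_inter_preimage Metric.isOpen_ball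
  refine ⟨U, hUo.mem_nhds ⟨hx, Metric.mem_ball_self hr⟩, ?_⟩
  have h1 : surfaceMeasure (d := d) g ι U = chartMeasure g ι e U := by
    rw [← surfaceMeasure_restrict_source g hι he, Measure.restrict_apply hUo.measurableSet,
      inter_eq_left.2 inter_subset_left]
  rw [h1, chartMeasure_apply g e hUo.measurableSet]
  have hcont : ContinuousOn (gramDensity g (ι ∘ e.symm)) (Metric.closedBall (e x) r) :=
    (continuousOn_gramDensity g e.open_target (contMDiffOn_comp_chart_symm hι he)).mono hball
  have hint : IntegrableOn (gramDensity g (ι ∘ e.symm)) (Metric.closedBall (e x) r) :=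
    hcont.integrableOn_compact (isCompact_closedBall _ _)
  refine lt_of_le_of_lt (lintegral_mono_set ?_) (hint.lintegral_lt_top)
  rintro y ⟨hy1, hy2⟩
  have := hy1.2
  rw [mem_preimage, e.right_inv hy2] at this
  exact Metric.ball_subset_closedBall this

end ChartMeasure
/-! ### Periods of a random element of a spectral cluster -/
namespace LaplaceEigenbasis

variable {n d : ℕ} {M : Type*} [TopologicalSpace M] [ChartedSpace (EuclideanSpace ℝ (Fin n)) M]
  [IsManifold (𝓡 n) ∞ M] [MeasurableSpace M] {g : Metric n M} (Φ : LaplaceEigenbasis g)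

theorem mem_index {a b h : ℝ} {k : ℕ} :
    k ∈ Φ.index a b h ↔ a / h < Φ.freq k ∧ Φ.freq k ≤ b / h := by
  simp [index]

theorem linearIndependent_fn : LinearIndependent ℂ Φ.fn := by
  have hb := Φ.basis.orthonormal.linearIndependent
  rw [linearIndependent_iff'] at hb ⊢
  intro s c hc
  refine hb s c ?_
  apply Lp.ext
  have h1 : ∀ t : Finset ℕ, ⇑(∑ k ∈ t, c k • Φ.basis k) =ᵐ[vol g] ∑ k ∈ t, c k • Φ.fn k := by
    intro t
    induction t using Finset.induction_on with
    | empty => simpa using Lp.coeFn_zero ℂ 2 (vol g)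
    | insert k t hk ih =>
      rw [Finset.sum_insert hk, Finset.sum_insert hk]
      filter_upwards [Lp.coeFn_add (c k • Φ.basis k) (∑ k ∈ t, c k • Φ.basis k),
        Lp.coeFn_smul (c k) (Φ.basis k), ih, Φ.basis_ae_eq k] with x hx1 hx2 hx3 hx4
      rw [hx1, Pi.add_apply, hx2, hx3, Pi.smul_apply, hx4, Pi.add_apply, Pi.smul_apply]
  have h2 := h1 s
  rw [hc] at h2
  exact h2.trans (Lp.coeFn_zero ℂ 2 (vol g)).symm

theorem clusterDim_eq_card (a b h : ℝ) : Φ.clusterDim a b h = (Φ.index a b h).card := by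
  have h1 := finrank_span_eq_card (R := ℂ)
    (Φ.linearIndependent_fn.comp (Subtype.val : Φ.index a b h → ℕ) Subtype.val_injective)
  rw [Fintype.card_coe] at h1
  have h2 : range (Φ.fn ∘ (Subtype.val : Φ.index a b h → ℕ)) = Φ.fn '' (Φ.index a b h : Set ℕ) := by
    rw [range_comp, Subtype.range_coe]
  rw [← h1, clusterDim, cluster, h2]

variable {X : Type*} [TopologicalSpace X] [ChartedSpace (EuclideanSpace ℝ (Fin d)) X]
  [MeasurableSpace X]

theorem clusterPeriodSum_eq (ι : X → M) {a b h : ℝ} (hh : 0 < h) (hab : a < b) :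
    Φ.clusterPeriodSum (d := d) ι a b h = ‖Φ.periodVector (d := d) ι a b h‖ ^ 2 := by
  have hsub : (Φ.finite_freq_le (a / h)).toFinset ⊆ (Φ.finite_freq_le (b / h)).toFinset := by
    intro k hk
    simp only [Finite.mem_toFinset, mem_ofPred_eq] at hk ⊢
    exact hk.trans (by gcongr)
  have hidx : (Φ.finite_freq_le (b / h)).toFinset \ (Φ.finite_freq_le (a / h)).toFinset =
      Φ.index a b h := by
    ext k
    simp only [Finset.mem_sdiff, Finite.mem_toFinset, mem_ofPred_eq, mem_index, not_le]
    exact and_comm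
  rw [clusterPeriodSum, periodSum, periodSum, ← Finset.sum_sdiff hsub, hidx, add_sub_cancel_right,
    EuclideanSpace.norm_sq_eq, ← Finset.sum_coe_sort]
  rfl

variable [CompactSpace X] [IsManifold (𝓡 d) ∞ X] [BorelSpace X]

theorem period_combination {ι : X → M} (hι : ContMDiff (𝓡 d) (𝓡 n) ∞ ι) (a b h : ℝ)
    (z : EuclideanSpace ℂ (Φ.index a b h)) :
    period (d := d) g ι (Φ.combination a b h z) =
      ∑ k, z k * Φ.periodVector (d := d) ι a b h k := by
  have := isFiniteMeasure_surfaceMeasure g hι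
  simp only [period, combination, periodVector]
  rw [integral_finsetSum]
  · simp_rw [integral_const_mul]
  · intro k _
    refine Integrable.const_mul ?_ _
    have hc : Continuous fun s => Φ.fn k (ι s) :=
      (Φ.isEigenfunction k).1.continuous.comp hι.continuous
    exact hc.integrable_of_hasCompactSupport (HasCompactSupport.of_compactSpace _)

theorem periodMoment_eq {ι : X → M} (hι : ContMDiff (𝓡 d) (𝓡 n) ∞ ι) {p a b h : ℝ} (hp : 0 < p)
    (hh : 0 < h) (hab : a < b) (hdim : 0 < Φ.clusterDim a b h) :
    Φ.periodMoment (d := d) ι p a b h =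
      p / 2 * Φ.clusterPeriodSum (d := d) ι a b h ^ (p / 2) *
        ProbabilityTheory.beta (p / 2) (Φ.clusterDim a b h) := by
  rw [clusterDim_eq_card] at hdim ⊢
  have : Nonempty (Φ.index a b h) := (Finset.card_pos.1 hdim).coe_sort
  rw [periodMoment, expectation, Φ.clusterPeriodSum_eq ι hh hab]
  simp_rw [Φ.period_combination hι]
  rw [integral_uniformSphere_linearForm_rpow _ hp, Fintype.card_coe]

/-- The asymptotic form of the moment, once the dimension of the cluster tends to infinity. -/
theorem exists_periodMoment_asymptotic {ι : X → M} (hι : ContMDiff (𝓡 d) (𝓡 n) ∞ ι) {p : ℝ}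
    (hp : 0 < p) {a b : ℝ → ℝ} (hab : ∀ h ∈ Ioc (0 : ℝ) 1, a h < b h)
    (hN : Tendsto (fun h => Φ.clusterDim (a h) (b h) h) (𝓝[>] 0) atTop) :
    ∃ ε : ℝ → ℝ, Tendsto ε (𝓝[>] 0) (𝓝 0) ∧
      ∀ᶠ h in 𝓝[>] 0,
        Φ.periodMoment (d := d) ι p (a h) (b h) h =
          Real.Gamma (p / 2 + 1) *
            (Φ.clusterPeriodSum (d := d) ι (a h) (b h) h / Φ.clusterDim (a h) (b h) h) ^ (p / 2) *
            (1 + ε h) := by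
  have hG : 0 < Real.Gamma (p / 2 + 1) := Real.Gamma_pos_of_pos (by positivity)
  let r : ℕ → ℝ := fun N =>
    (p / 2 * ProbabilityTheory.beta (p / 2) N * (N : ℝ) ^ (p / 2)) / Real.Gamma (p / 2 + 1) - 1
  have hr : Tendsto r atTop (𝓝 0) := by
    have := ((tendsto_mul_beta_mul_rpow (half_pos hp)).div_const
      (Real.Gamma (p / 2 + 1))).sub_const 1
    rwa [div_self hG.ne', sub_self] at this
  refine ⟨fun h => r (Φ.clusterDim (a h) (b h) h), hr.comp hN, ?_⟩
  filter_upwards [hN.eventually_gt_atTop 0, Ioc_mem_nhdsGT (zero_lt_one (α := ℝ))] with h h1 h2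
  rw [Φ.periodMoment_eq hι hp h2.1 (hab h h2) h1, Real.div_rpow _ (Nat.cast_nonneg _)]
  · have hNp : (0 : ℝ) < Φ.clusterDim (a h) (b h) h := by exact_mod_cast h1
    simp only [r]
    field_simp
    ring
  · rw [Φ.clusterPeriodSum_eq ι h2.1 (hab h h2)]; positivity

end LaplaceEigenbasis

/-! ### Counting eigenvalues with approximate eigenvectors -/

/-- Let a diagonal operator have eigenvalues `m k` in a Hilbert basis.  If `u j` are nonzero,
pairwise orthogonal vectors whose images `f j` are pairwise orthogonal too and `‖f j‖ ≤ C ‖u j‖`,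
then at least as many eigenvalues as there are vectors have modulus at most `C' > C`. -/
theorem card_le_ncard_of_approximate_kernel {H : Type*} [NormedAddCommGroup H]
    [InnerProductSpace ℂ H] (b : HilbertBasis ℕ ℂ H) (m : ℕ → ℝ) {K : ℕ} (u f : Fin K → H)
    (hu : ∀ j, u j ≠ 0) (huu : Pairwise fun i j => inner ℂ (u i) (u j) = 0)
    (hff : Pairwise fun i j => inner ℂ (f i) (f j) = 0) {C C' : ℝ} (hC : 0 ≤ C) (hCC : C < C')
    (hfu : ∀ j, ‖f j‖ ≤ C * ‖u j‖)
    (hm : ∀ k j, inner ℂ (b k) (f j) = (m k : ℂ) * inner ℂ (b k) (u j))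
    (hfin : {k | |m k| ≤ C'}.Finite) :
    K ≤ {k | |m k| ≤ C'}.ncard := by
  by_contra! hlt
  rw [ncard_eq_toFinset_card _ hfin] at hlt
  set W := hfin.toFinset
  -- a combination of the `u j` orthogonal to all eigenvectors of the window
  obtain ⟨c, hc0, hc⟩ : ∃ c : Fin K → ℂ, c ≠ 0 ∧ ∀ k ∈ W, ∑ j, c j * inner ℂ (b k) (u j) = 0 := by
    let T : (Fin K → ℂ) →ₗ[ℂ] (W → ℂ) := LinearMap.pi fun k =>
      ∑ j, (inner ℂ (b k) (u j)) • LinearMap.proj j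
    have hT : ¬ Function.Injective T := by
      intro hinj
      have := LinearMap.finrank_le_finrank_of_injective hinj
      simp at this
      omega
    rw [← LinearMap.ker_eq_bot, Submodule.eq_bot_iff] at hT
    push Not at hT
    obtain ⟨c, hcT, hc0⟩ := hT
    refine ⟨c, hc0, fun k hk => ?_⟩
    have := congrFun (LinearMap.mem_ker.1 hcT) ⟨k, hk⟩
    simp only [T, LinearMap.pi_apply, LinearMap.sum_apply, LinearMap.smul_apply,
      LinearMap.proj_apply, smul_eq_mul, Pi.zero_apply] at this
    rw [← this]
    exact Finset.sum_congr rfl fun j _ => mul_comm _ _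
  set U := ∑ j, c j • u j with hU
  set F := ∑ j, c j • f j with hF
  have hbU : ∀ k, inner ℂ (b k) U = ∑ j, c j * inner ℂ (b k) (u j) := fun k => by
    rw [hU, inner_sum]; simp_rw [inner_smul_right]
  have hbF : ∀ k, inner ℂ (b k) F = (m k : ℂ) * inner ℂ (b k) U := fun k => by
    rw [hbU, hF, inner_sum, Finset.mul_sum]
    refine Finset.sum_congr rfl fun j _ => ?_
    rw [inner_smul_right, hm]; ring
  have hself : ∀ w : H, (inner ℂ w w : ℂ) = ((‖w‖ ^ 2 : ℝ) : ℂ) := fun w => by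
    rw [inner_self_eq_norm_sq_to_K]; push_cast; rfl
  have pyth : ∀ v : Fin K → H, (Pairwise fun i j => inner ℂ (v i) (v j) = 0) →
      ‖∑ j, c j • v j‖ ^ 2 = ∑ j, ‖c j‖ ^ 2 * ‖v j‖ ^ 2 := by
    intro v hv
    have h1 : (inner ℂ (∑ j, c j • v j) (∑ j, c j • v j) : ℂ) =
        ((∑ j, ‖c j‖ ^ 2 * ‖v j‖ ^ 2 : ℝ) : ℂ) := by
      rw [sum_inner]
      push_cast
      refine Finset.sum_congr rfl fun i _ => ?_
      rw [inner_sum, Finset.sum_eq_single i]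
      · rw [hself, norm_smul]; push_cast; ring
      · intro j _ hj
        rw [inner_smul_left, inner_smul_right, hv hj.symm]; simp
      · simp
    rw [hself] at h1
    exact_mod_cast h1
  have hUn := pyth u huu
  have hFn := pyth f hff
  -- `C' ‖U‖ ≤ ‖F‖ ≤ C ‖U‖`: the left inequality because `U` has no component in the window, the
  -- right one by orthogonality
  have hUpos : 0 < ‖U‖ ^ 2 := by
    rw [hUn]
    obtain ⟨j, hj⟩ := Function.ne_iff.1 hc0
    refine Finset.sum_pos' (fun i _ => by positivity) ⟨j, Finset.mem_univ _, ?_⟩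
    have := norm_pos_iff.2 (hu j)
    have := norm_pos_iff.2 hj
    positivity
  have hFU : ‖F‖ ^ 2 ≤ C ^ 2 * ‖U‖ ^ 2 := by
    rw [hUn, hFn, Finset.mul_sum]
    refine Finset.sum_le_sum fun j _ => ?_
    have := pow_le_pow_left₀ (norm_nonneg _) (hfu j) 2
    nlinarith [sq_nonneg ‖c j‖]
  have pars : ∀ v : H, HasSum (fun k => ‖(inner ℂ (b k) v : ℂ)‖ ^ 2) (‖v‖ ^ 2) := by
    intro v
    have h := b.hasSum_inner_mul_inner v v
    rw [hself] at h
    have h2 : ∀ k, (inner ℂ v (b k) * inner ℂ (b k) v : ℂ) =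
        ((‖(inner ℂ (b k) v : ℂ)‖ ^ 2 : ℝ) : ℂ) := by
      intro k
      rw [← inner_conj_symm v (b k), RCLike.conj_mul]; push_cast; rfl
    simp_rw [h2] at h
    exact_mod_cast h
  have hge : C' ^ 2 * ‖U‖ ^ 2 ≤ ‖F‖ ^ 2 := by
    refine hasSum_le (fun k => ?_) ((pars U).mul_left (C' ^ 2)) (pars F)
    rw [hbF, norm_mul, mul_pow]
    by_cases hk : k ∈ W
    · rw [hbU, hc k hk]; simp
    · have : C' < |m k| := by simpa [W] using hk
      rw [Complex.norm_real, Real.norm_eq_abs]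
      gcongr
      linarith
  have : C ^ 2 < C' ^ 2 := by gcongr
  nlinarith

/-! ### Divergence-form operators in Euclidean space -/

section Divergence

theorem contDiff_of_contDiffAt_tsupport {E F : Type*} [NormedAddCommGroup E] [NormedSpace ℝ E]
    [NormedAddCommGroup F] [NormedSpace ℝ F] {k : WithTop ℕ∞} {f : E → F}
    (h : ∀ x ∈ tsupport f, ContDiffAt ℝ k f x) : ContDiff ℝ k f := by
  refine contDiff_iff_contDiffAt.2 fun x => ?_
  by_cases hx : x ∈ tsupport f
  · exact h x hx
  · exact (contDiffAt_const (c := (0 : F))).congr_of_eventuallyEq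
      (notMem_tsupport_iff_eventuallyEq.1 hx)

theorem integral_fderiv_apply_eq_zero {E F : Type*} [NormedAddCommGroup E] [NormedSpace ℝ E]
    [FiniteDimensional ℝ E] [MeasurableSpace E] [BorelSpace E] (μ : Measure E) [μ.IsAddHaarMeasure]
    [NormedAddCommGroup F] [NormedSpace ℝ F] {w : E → F} (hw : ContDiff ℝ 1 w)
    (hc : HasCompactSupport w) (v : E) : ∫ y, fderiv ℝ w y v ∂μ = 0 := by
  have hi : Integrable (fun y => fderiv ℝ w y v) μ :=
    ((hw.continuous_fderiv one_ne_zero).clm_apply continuous_const).integrable_of_hasCompactSupport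
      (hc.fderiv_apply ℝ v)
  have h := integral_smul_fderiv_eq_neg_fderiv_smul_of_integrable (μ := μ) (𝕜 := ℝ)
    (f := fun _ => (1 : ℝ)) (g := w) (v := v) (by simp) (by simpa using hi)
    (by simpa using hw.continuous.integrable_of_hasCompactSupport hc)
    (by intro x _; fun_prop) (fun x _ => hw.differentiable one_ne_zero x)
  simpa using h

variable {n : ℕ}

/-- The operator `v ↦ ρ⁻¹ ∑ᵢ ∂ᵢ (ρ ∑ⱼ Aᵢⱼ ∂ⱼ v)`. -/
noncomputable def divForm {F : Type*} [NormedAddCommGroup F] [NormedSpace ℝ F]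
    (ρ : EuclideanSpace ℝ (Fin n) → ℝ) (A : EuclideanSpace ℝ (Fin n) → Matrix (Fin n) (Fin n) ℝ)
    (v : EuclideanSpace ℝ (Fin n) → F) (y : EuclideanSpace ℝ (Fin n)) : F :=
  (ρ y)⁻¹ • ∑ i, fderiv ℝ (fun w => ρ w •
      ∑ j, A w i j • fderiv ℝ v w (EuclideanSpace.single j (1 : ℝ)))
    y (EuclideanSpace.single i (1 : ℝ))

theorem laplaceInChart_eq_divForm {M : Type*} [TopologicalSpace M]
    [ChartedSpace (EuclideanSpace ℝ (Fin n)) M] [IsManifold (𝓡 n) ∞ M] (g : Metric n M)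
    (e : OpenPartialHomeomorph M (EuclideanSpace ℝ (Fin n))) (u : M → ℂ) :
    laplaceInChart g e u =
      divForm (gramDensity g e.symm) (fun w => (gram g e.symm w)⁻¹) (u ∘ e.symm) := rfl

variable {ρ : EuclideanSpace ℝ (Fin n) → ℝ}
  {A : EuclideanSpace ℝ (Fin n) → Matrix (Fin n) (Fin n) ℝ} {Ω : Set (EuclideanSpace ℝ (Fin n))}
  {F : Type*} [NormedAddCommGroup F] [NormedSpace ℝ F]

theorem contDiffOn_flux (hΩ : IsOpen Ω) (hρ : ContDiffOn ℝ 1 ρ Ω)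
    (hA : ∀ i j, ContDiffOn ℝ 1 (fun y => A y i j) Ω) {v : EuclideanSpace ℝ (Fin n) → F}
    (hv : ContDiffOn ℝ 2 v Ω) (i : Fin n) :
    ContDiffOn ℝ 1 (fun w => ρ w • ∑ j, A w i j •
      fderiv ℝ v w (EuclideanSpace.single j (1 : ℝ))) Ω := by
  refine hρ.smul (ContDiffOn.sum fun j _ => (hA i j).smul ?_)
  exact (hv.fderiv_of_isOpen hΩ (m := 1) (by norm_num)).clm_apply contDiffOn_const

theorem divForm_eq_zero_of_notMem_tsupport {v : EuclideanSpace ℝ (Fin n) → F}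
    {y : EuclideanSpace ℝ (Fin n)} (hy : y ∉ tsupport v) : divForm ρ A v y = 0 := by
  have h1 : ∀ i, (fun w => ρ w • ∑ j, A w i j •
      fderiv ℝ v w (EuclideanSpace.single j (1 : ℝ))) =ᶠ[𝓝 y] fun _ => 0 := by
    intro i
    filter_upwards [(isClosed_tsupport v).isOpen_compl.mem_nhds hy] with w hw
    have : fderiv ℝ v w = 0 := by
      by_contra h
      exact hw (support_fderiv_subset ℝ h)
    simp [this]
  simp only [divForm]
  rw [Finset.sum_eq_zero, smul_zero]
  intro i _
  rw [(h1 i).fderiv_eq]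
  simp

theorem continuousOn_divForm (hΩ : IsOpen Ω) (hρ : ContDiffOn ℝ 1 ρ Ω) (hρ0 : ∀ y ∈ Ω, ρ y ≠ 0)
    (hA : ∀ i j, ContDiffOn ℝ 1 (fun y => A y i j) Ω) {v : EuclideanSpace ℝ (Fin n) → F}
    (hv : ContDiffOn ℝ 2 v Ω) : ContinuousOn (divForm ρ A v) Ω := by
  refine (hρ.continuousOn.inv₀ hρ0).smul (continuousOn_finsetSum _ fun i _ => ?_)
  exact ((contDiffOn_flux hΩ hρ hA hv i).continuousOn_fderiv_of_isOpen hΩ le_rfl).clm_apply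
    continuousOn_const

theorem continuous_divForm (hΩ : IsOpen Ω) (hρ : ContDiffOn ℝ 1 ρ Ω) (hρ0 : ∀ y ∈ Ω, ρ y ≠ 0)
    (hA : ∀ i j, ContDiffOn ℝ 1 (fun y => A y i j) Ω) {v : EuclideanSpace ℝ (Fin n) → F}
    (hv : ContDiff ℝ 2 v) (hsupp : tsupport v ⊆ Ω) : Continuous (divForm ρ A v) := by
  refine continuous_iff_continuousAt.2 fun y => ?_
  by_cases hy : y ∈ Ω
  · exact (continuousOn_divForm hΩ hρ hρ0 hA hv.contDiffOn).continuousAt (hΩ.mem_nhds hy)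
  · refine (continuousAt_const (y := (0 : F))).congr ?_
    filter_upwards [(isClosed_tsupport v).isOpen_compl.mem_nhds fun h => hy (hsupp h)] with w hw
    exact (divForm_eq_zero_of_notMem_tsupport hw).symm

/-- A divergence-form operator with symmetric coefficients is formally self-adjoint for the
measure `ρ dy`. -/
theorem integral_divForm_smul (hΩ : IsOpen Ω) (hρ : ContDiffOn ℝ 1 ρ Ω) (hρ0 : ∀ y ∈ Ω, ρ y ≠ 0)
    (hA : ∀ i j, ContDiffOn ℝ 1 (fun y => A y i j) Ω) (hsymm : ∀ y ∈ Ω, ∀ i j, A y i j = A y j i)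
    {u : EuclideanSpace ℝ (Fin n) → ℝ} (hu : ContDiff ℝ 2 u) (huc : HasCompactSupport u)
    (husupp : tsupport u ⊆ Ω) {v : EuclideanSpace ℝ (Fin n) → F} (hv : ContDiffOn ℝ 2 v Ω) :
    ∫ y, (ρ y * divForm ρ A u y) • v y = ∫ y, (ρ y * u y) • divForm ρ A v y := by
  let P : Fin n → EuclideanSpace ℝ (Fin n) → ℝ := fun i w => ρ w • ∑ j, A w i j •
    fderiv ℝ u w (EuclideanSpace.single j (1 : ℝ))
  let Q : Fin n → EuclideanSpace ℝ (Fin n) → F := fun i w => ρ w • ∑ j, A w i j •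
    fderiv ℝ v w (EuclideanSpace.single j (1 : ℝ))
  have hP : ∀ i, ContDiffOn ℝ 1 (P i) Ω := contDiffOn_flux hΩ hρ hA hu.contDiffOn
  have hQ : ∀ i, ContDiffOn ℝ 1 (Q i) Ω := contDiffOn_flux hΩ hρ hA hv
  let w : Fin n → EuclideanSpace ℝ (Fin n) → F := fun i y => P i y • v y - u y • Q i y
  have hu0 : ∀ y, y ∉ tsupport u → u y = 0 ∧ ∀ i, P i y = 0 := by
    intro y hy
    refine ⟨image_eq_zero_of_notMem_tsupport hy, fun i => ?_⟩
    have : fderiv ℝ u y = 0 := by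
      by_contra h
      exact hy (support_fderiv_subset ℝ h)
    simp [P, this]
  have hwsupp : ∀ i, tsupport (w i) ⊆ tsupport u := fun i =>
    closure_minimal (fun y hy => by
      by_contra h
      obtain ⟨h1, h2⟩ := hu0 y h
      exact hy (by simp [w, h1, h2])) (isClosed_tsupport u)
  have hw : ∀ i, ContDiff ℝ 1 (w i) := fun i =>
    contDiff_of_contDiffAt_tsupport fun y hy => by
      have hyΩ := hΩ.mem_nhds (husupp (hwsupp i hy))
      exact (((hP i).smul (hv.of_le (by norm_num))).sub
        ((hu.contDiffOn.of_le (by norm_num)).smul (hQ i))).contDiffAt hyΩ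
  have hwc : ∀ i, HasCompactSupport (w i) := fun i =>
    huc.of_isClosed_subset (isClosed_tsupport _) (hwsupp i)
  have hzero : ∫ y, ∑ i, fderiv ℝ (w i) y (EuclideanSpace.single i (1 : ℝ)) = 0 := by
    rw [integral_finsetSum]
    · exact Finset.sum_eq_zero fun i _ => integral_fderiv_apply_eq_zero volume (hw i) (hwc i) _
    · intro i _
      exact (((hw i).continuous_fderiv one_ne_zero).clm_apply
        continuous_const).integrable_of_hasCompactSupport ((hwc i).fderiv_apply ℝ _)
  -- pointwise, the divergence of `w` is the difference of the two integrands
  have hpt : ∀ y, ∑ i, fderiv ℝ (w i) y (EuclideanSpace.single i (1 : ℝ)) =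
      (ρ y * divForm ρ A u y) • v y - (ρ y * u y) • divForm ρ A v y := by
    intro y
    by_cases hy : y ∈ tsupport u
    · have hyΩ := husupp hy
      have hn := hΩ.mem_nhds hyΩ
      have hdP : ∀ i, DifferentiableAt ℝ (P i) y := fun i =>
        ((hP i).contDiffAt hn).differentiableAt one_ne_zero
      have hdQ : ∀ i, DifferentiableAt ℝ (Q i) y := fun i =>
        ((hQ i).contDiffAt hn).differentiableAt one_ne_zero
      have hdv : DifferentiableAt ℝ v y := (hv.contDiffAt hn).differentiableAt two_ne_zero
      have hdu : DifferentiableAt ℝ u y := hu.differentiable two_ne_zero y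
      have h1 : ∀ i, fderiv ℝ (w i) y (EuclideanSpace.single i (1 : ℝ)) =
          (P i y • fderiv ℝ v y (EuclideanSpace.single i (1 : ℝ)) +
            fderiv ℝ (P i) y (EuclideanSpace.single i (1 : ℝ)) • v y) -
          (u y • fderiv ℝ (Q i) y (EuclideanSpace.single i (1 : ℝ)) +
            fderiv ℝ u y (EuclideanSpace.single i (1 : ℝ)) • Q i y) := by
        intro i
        have hw' : w i = P i • v - u • Q i := rfl
        rw [hw', fderiv_sub ((hdP i).smul hdv) (hdu.smul (hdQ i)), fderiv_smul (hdP i) hdv,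
          fderiv_smul hdu (hdQ i)]
        simp
      have h2 : ρ y * divForm ρ A u y =
          ∑ i, fderiv ℝ (P i) y (EuclideanSpace.single i (1 : ℝ)) := by
        rw [divForm, smul_eq_mul, mul_inv_cancel_left₀ (hρ0 y hyΩ)]
      have h3 : (ρ y * u y) • divForm ρ A v y =
          u y • ∑ i, fderiv ℝ (Q i) y (EuclideanSpace.single i (1 : ℝ)) := by
        rw [divForm, smul_smul, mul_right_comm, mul_inv_cancel₀ (hρ0 y hyΩ), one_mul]
      have h4 : ∑ i, P i y • fderiv ℝ v y (EuclideanSpace.single i (1 : ℝ)) =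
          ∑ i, fderiv ℝ u y (EuclideanSpace.single i (1 : ℝ)) • Q i y := by
        simp only [P, Q, Finset.smul_sum, smul_eq_mul, Finset.mul_sum, Finset.sum_smul, smul_smul]
        rw [Finset.sum_comm]
        refine Finset.sum_congr rfl fun i _ => Finset.sum_congr rfl fun j _ => ?_
        rw [hsymm y hyΩ j i]
        congr 1; ring
      rw [h2, h3, Finset.sum_congr rfl fun i _ => h1 i, Finset.sum_sub_distrib,
        Finset.sum_add_distrib, Finset.sum_add_distrib, h4, Finset.sum_smul, Finset.smul_sum]
      abel
    · obtain ⟨h1, -⟩ := hu0 y hy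
      rw [divForm_eq_zero_of_notMem_tsupport hy, h1, mul_zero, zero_smul, zero_smul, sub_zero]
      refine Finset.sum_eq_zero fun i _ => ?_
      have : fderiv ℝ (w i) y = 0 := by
        by_contra h
        exact hy (hwsupp i (support_fderiv_subset ℝ h))
      rw [this]; rfl
  have hi1 : Integrable fun y => (ρ y * divForm ρ A u y) • v y := by
    have hc : Continuous fun y => (ρ y * divForm ρ A u y) • v y := by
      refine continuous_iff_continuousAt.2 fun y => ?_
      by_cases hy : y ∈ Ω
      · have hn := hΩ.mem_nhds hy
        exact ((hρ.continuousOn.continuousAt hn).mul (continuousOn_divForm hΩ hρ hρ0 hA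
          hu.contDiffOn |>.continuousAt hn)).smul (hv.continuousOn.continuousAt hn)
      · refine (continuousAt_const (y := (0 : F))).congr ?_
        filter_upwards [(isClosed_tsupport u).isOpen_compl.mem_nhds fun h => hy (husupp h)]
          with z hz
        rw [divForm_eq_zero_of_notMem_tsupport hz, mul_zero, zero_smul]
    refine hc.integrable_of_hasCompactSupport (huc.of_isClosed_subset (isClosed_tsupport _)
      (closure_minimal (fun y hy => ?_) (isClosed_tsupport u)))
    by_contra h
    exact hy (by simp only [divForm_eq_zero_of_notMem_tsupport h, mul_zero, zero_smul])
  have hi2 : Integrable fun y => (ρ y * u y) • divForm ρ A v y := by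
    have hc : Continuous fun y => (ρ y * u y) • divForm ρ A v y := by
      refine continuous_iff_continuousAt.2 fun y => ?_
      by_cases hy : y ∈ Ω
      · have hn := hΩ.mem_nhds hy
        exact ((hρ.continuousOn.continuousAt hn).mul hu.continuous.continuousAt).smul
          ((continuousOn_divForm hΩ hρ hρ0 hA hv).continuousAt hn)
      · refine (continuousAt_const (y := (0 : F))).congr ?_
        filter_upwards [(isClosed_tsupport u).isOpen_compl.mem_nhds fun h => hy (husupp h)]
          with z hz
        rw [(hu0 z hz).1, mul_zero, zero_smul]
    refine hc.integrable_of_hasCompactSupport (huc.of_isClosed_subset (isClosed_tsupport _)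
      (closure_minimal (fun y hy => ?_) (isClosed_tsupport u)))
    by_contra h
    exact hy (by simp only [(hu0 y h).1, mul_zero, zero_smul])
  simp_rw [hpt] at hzero
  rw [integral_sub hi1 hi2] at hzero
  exact sub_eq_zero.1 hzero

end Divergence

/-! ### From functions in a chart to `L²(M)` -/

theorem contDiffOn_det {E : Type*} [NormedAddCommGroup E] [NormedSpace ℝ E] {n : ℕ}
    {G : E → Matrix (Fin n) (Fin n) ℝ} {Ω : Set E} {k : WithTop ℕ∞}
    (hG : ∀ i j, ContDiffOn ℝ k (fun y => G y i j) Ω) : ContDiffOn ℝ k (fun y => (G y).det) Ω := by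
  simp only [Matrix.det_apply]
  exact ContDiffOn.sum fun σ _ => ContDiffOn.const_smul _ (contDiffOn_prod fun i _ => hG _ _)

/-- By the formula for the inverse through the adjugate, its entries are polynomials in the
entries of the matrix divided by the determinant. -/
theorem contDiffOn_matrix_inv {E : Type*} [NormedAddCommGroup E] [NormedSpace ℝ E] {n : ℕ}
    {G : E → Matrix (Fin n) (Fin n) ℝ} {Ω : Set E} {k : WithTop ℕ∞}
    (hG : ∀ i j, ContDiffOn ℝ k (fun y => G y i j) Ω) (hdet : ∀ y ∈ Ω, (G y).det ≠ 0)
    (i j : Fin n) : ContDiffOn ℝ k (fun y => (G y)⁻¹ i j) Ω := by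
  have h1 : ∀ y, (G y)⁻¹ i j = ((G y).det)⁻¹ * ((G y).updateRow j (Pi.single i 1)).det := by
    intro y
    rw [Matrix.inv_def, Matrix.smul_apply, Matrix.adjugate_apply, Ring.inverse_eq_inv', smul_eq_mul]
  simp_rw [h1]
  refine ((contDiffOn_det hG).inv hdet).mul (contDiffOn_det fun a b => ?_)
  by_cases ha : a = j
  · subst ha; simp only [Matrix.updateRow_self]; exact contDiffOn_const
  · simp only [Matrix.updateRow_ne ha]; exact hG a b

section Chart

variable {n : ℕ} {M : Type*} [TopologicalSpace M] [ChartedSpace (EuclideanSpace ℝ (Fin n)) M]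
  [IsManifold (𝓡 n) ∞ M] (g : Metric n M) {e : OpenPartialHomeomorph M (EuclideanSpace ℝ (Fin n))}

/-- The differential of the inverse of a chart is injective, so that the metric pulls back to a
positive definite matrix. -/
theorem posDef_gram (he : e ∈ IsManifold.maximalAtlas (𝓡 n) ∞ M) {y : EuclideanSpace ℝ (Fin n)}
    (hy : y ∈ e.target) : (gram g e.symm y).PosDef := by
  have hF : MDifferentiableAt (𝓡 n) (𝓡 n) e.symm y :=
    ((contMDiffOn_symm_of_mem_maximalAtlas he).contMDiffAt
      (e.open_target.mem_nhds hy)).mdifferentiableAt (by simp)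
  have hE : MDifferentiableAt (𝓡 n) (𝓡 n) e (e.symm y) :=
    ((contMDiffOn_of_mem_maximalAtlas he).contMDiffAt
      (e.open_source.mem_nhds (e.map_target hy))).mdifferentiableAt (by simp)
  have hinj : ∀ x : EuclideanSpace ℝ (Fin n), mfderiv (𝓡 n) (𝓡 n) e.symm y x = 0 → x = 0 := by
    intro x hx
    have h1 : mfderiv (𝓡 n) (𝓡 n) (e ∘ e.symm) y = mfderiv (𝓡 n) (𝓡 n) id y := by
      refine Filter.EventuallyEq.mfderiv_eq ?_
      filter_upwards [e.open_target.mem_nhds hy] with z hz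
      simp [e.right_inv hz]
    rw [mfderiv_comp y hE hF, mfderiv_id] at h1
    have h2 := congrArg (fun L : EuclideanSpace ℝ (Fin n) →L[ℝ] EuclideanSpace ℝ (Fin n) => L x) h1
    have h3 : mfderiv (𝓡 n) (𝓡 n) e (e.symm y) (mfderiv (𝓡 n) (𝓡 n) e.symm y x) = x := h2
    rw [hx, map_zero] at h3
    exact h3.symm
  refine Matrix.PosDef.of_dotProduct_mulVec_pos ?_ ?_
  · ext i j
    rw [Matrix.conjTranspose_apply, star_trivial, gram_apply, gram_apply]
    exact g.symm _ _ _
  · intro x hx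
    let x' : EuclideanSpace ℝ (Fin n) := WithLp.toLp 2 x
    have hx' : x' ≠ 0 := fun h => hx (congrArg WithLp.ofLp h)
    have hexp : x' = ∑ k, x k • EuclideanSpace.single k (1 : ℝ) := by
      conv_lhs => rw [← (EuclideanSpace.basisFun (Fin n) ℝ).sum_repr x']
      simp [x']
    have h1 := g.pos _ _ fun h => hx' (hinj x' h)
    have h2 : mfderiv (𝓡 n) (𝓡 n) e.symm y x' = ∑ k, x k •
        (mfderiv (𝓡 n) (𝓡 n) e.symm y (EuclideanSpace.single k (1 : ℝ)) :
          TangentSpace (𝓡 n) (e.symm y)) := by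
      rw [hexp]
      exact (map_sum _ _ _).trans (Finset.sum_congr rfl fun k _ => map_smul _ _ _)
    rw [h2] at h1
    refine lt_of_lt_of_eq h1 ?_
    simp only [map_sum, map_smul, sum_apply, smul_apply, smul_eq_mul, dotProduct, Matrix.mulVec,
      star_trivial, gram_apply, Finset.mul_sum]
    rw [Finset.sum_comm]
    refine Finset.sum_congr rfl fun k _ => Finset.sum_congr rfl fun l _ => ?_
    ring

theorem contDiffOn_gramDensity (he : e ∈ IsManifold.maximalAtlas (𝓡 n) ∞ M) :
    ContDiffOn ℝ ∞ (gramDensity g e.symm) e.target :=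
  (contDiffOn_det_gram g e.open_target (contMDiffOn_symm_of_mem_maximalAtlas he)).sqrt
    fun _ hy => (posDef_gram g he hy).det_pos.ne'

theorem gramDensity_pos (he : e ∈ IsManifold.maximalAtlas (𝓡 n) ∞ M)
    {y : EuclideanSpace ℝ (Fin n)} (hy : y ∈ e.target) : 0 < gramDensity g e.symm y :=
  Real.sqrt_pos.2 (posDef_gram g he hy).det_pos

theorem contDiffOn_gram_inv (he : e ∈ IsManifold.maximalAtlas (𝓡 n) ∞ M) (i j : Fin n) :
    ContDiffOn ℝ ∞ (fun y => (gram g e.symm y)⁻¹ i j) e.target :=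
  contDiffOn_matrix_inv (contDiffOn_gram g e.open_target (contMDiffOn_symm_of_mem_maximalAtlas he))
    (fun _ hy => (posDef_gram g he hy).det_pos.ne') i j

variable [T2Space M] [CompactSpace M] [MeasurableSpace M] [BorelSpace M]

theorem isFiniteMeasure_vol : IsFiniteMeasure (vol g) :=
  isFiniteMeasure_surfaceMeasure g contMDiff_id

theorem vol_restrict_source (he : e ∈ IsManifold.maximalAtlas (𝓡 n) ∞ M) :
    (vol g).restrict e.source = ((volume.restrict e.target).withDensity
      fun y => ENNReal.ofReal (gramDensity g e.symm y)).map e.symm :=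
  surfaceMeasure_restrict_source g contMDiff_id he

theorem setIntegral_source_vol (he : e ∈ IsManifold.maximalAtlas (𝓡 n) ∞ M) {F : M → ℂ}
    (hF : ContinuousOn F e.source) :
    ∫ x in e.source, F x ∂(vol g) =
      ∫ y in e.target, gramDensity g e.symm y • F (e.symm y) := by
  have hm : AEMeasurable e.symm ((volume.restrict e.target).withDensity
      fun y => ENNReal.ofReal (gramDensity g e.symm y)) :=
    aemeasurable_chart_symm_density (ι := (id : M → M)) g e
  have hF' : AEStronglyMeasurable F (((volume.restrict e.target).withDensity
      fun y => ENNReal.ofReal (gramDensity g e.symm y)).map e.symm) := by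
    rw [← vol_restrict_source g he]
    exact hF.aestronglyMeasurable e.open_source.measurableSet
  rw [vol_restrict_source g he, integral_map hm hF']
  have hρ : AEMeasurable (fun y => (gramDensity g e.symm y).toNNReal)
      (volume.restrict e.target) :=
    ((contDiffOn_gramDensity g he).continuousOn.aemeasurable
      e.open_target.measurableSet).real_toNNReal
  refine (integral_withDensity_eq_integral_smul₀ hρ _).trans ?_
  refine setIntegral_congr_fun e.open_target.measurableSet fun y hy => ?_
  simp only [NNReal.smul_def]
  rw [Real.coe_toNNReal _ (gramDensity_pos g he hy).le]

open Classical in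
/-- The function on `M` that is `f` read in the chart `e`, extended by zero. -/
noncomputable def chartLift (e : OpenPartialHomeomorph M (EuclideanSpace ℝ (Fin n)))
    (f : EuclideanSpace ℝ (Fin n) → ℝ) : M → ℂ :=
  e.source.indicator fun x => (f (e x) : ℂ)

theorem memLp_chartLift {f : EuclideanSpace ℝ (Fin n) → ℝ} (hf : Continuous f)
    (hfc : HasCompactSupport f) : MemLp (chartLift e f) 2 (vol g) := by
  have := isFiniteMeasure_vol g
  obtain ⟨C, hC⟩ := hf.bounded_above_of_compact_support hfc
  refine MemLp.of_bound ?_ C (Eventually.of_forall fun x => ?_)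
  · refine (aestronglyMeasurable_indicator_iff e.open_source.measurableSet).2 ?_
    have : ContinuousOn (fun x => (f (e x) : ℂ)) e.source :=
      Complex.continuous_ofReal.comp_continuousOn (hf.comp_continuousOn e.continuousOn)
    exact this.aestronglyMeasurable e.open_source.measurableSet
  · by_cases hx : x ∈ e.source
    · rw [chartLift, indicator_of_mem hx, Complex.norm_real]; exact hC _
    · rw [chartLift, indicator_of_notMem hx, norm_zero]; exact (norm_nonneg _).trans (hC 0)

theorem integral_chartLift_mul (he : e ∈ IsManifold.maximalAtlas (𝓡 n) ∞ M)
    {f : EuclideanSpace ℝ (Fin n) → ℝ} (hf : Continuous f) (hfs : tsupport f ⊆ e.target)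
    {F : M → ℂ} (hF : ContinuousOn F e.source) :
    ∫ x, chartLift e f x * F x ∂(vol g) =
      ∫ y, (gramDensity g e.symm y * f y) • F (e.symm y) := by
  have h1 : (fun x => chartLift e f x * F x) =
      e.source.indicator fun x => (f (e x) : ℂ) * F x := by
    ext x
    by_cases hx : x ∈ e.source <;> simp [chartLift, hx]
  have h2 : ContinuousOn (fun x => (f (e x) : ℂ) * F x) e.source :=
    (Complex.continuous_ofReal.comp_continuousOn (hf.comp_continuousOn e.continuousOn)).mul hF
  rw [h1, integral_indicator e.open_source.measurableSet, setIntegral_source_vol g he h2,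
    ← integral_indicator e.open_target.measurableSet]
  congr 1
  ext y
  by_cases hy : y ∈ e.target
  · rw [indicator_of_mem hy, e.right_inv hy, mul_smul, Complex.real_smul (x := f y)]
  · rw [indicator_of_notMem hy, image_eq_zero_of_notMem_tsupport fun h => hy (hfs h), mul_zero,
      zero_smul]

/-- `chartLift` as an element of `L²(M)`. -/
noncomputable def chartLp (e : OpenPartialHomeomorph M (EuclideanSpace ℝ (Fin n)))
    {f : EuclideanSpace ℝ (Fin n) → ℝ} (hf : Continuous f) (hfc : HasCompactSupport f) :
    Lp ℂ 2 (vol g) :=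
  (memLp_chartLift (e := e) g hf hfc).toLp

theorem inner_chartLp (he : e ∈ IsManifold.maximalAtlas (𝓡 n) ∞ M)
    {f : EuclideanSpace ℝ (Fin n) → ℝ} (hf : Continuous f) (hfc : HasCompactSupport f)
    (hfs : tsupport f ⊆ e.target) {v : Lp ℂ 2 (vol g)} {F : M → ℂ} (hv : v =ᵐ[vol g] F)
    (hF : ContinuousOn F e.source) :
    inner ℂ (chartLp g e hf hfc) v = ∫ y, (gramDensity g e.symm y * f y) • F (e.symm y) := by
  rw [← integral_chartLift_mul g he hf hfs hF, L2.inner_def]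
  refine integral_congr_ae ?_
  filter_upwards [hv, (memLp_chartLift (e := e) g hf hfc).coeFn_toLp] with x hx1 hx2
  rw [chartLp, hx1, hx2, RCLike.inner_apply]
  have : starRingEnd ℂ (chartLift e f x) = chartLift e f x := by
    by_cases hx : x ∈ e.source <;> simp [chartLift, hx]
  rw [this, mul_comm]

theorem inner_chartLp_chartLp (he : e ∈ IsManifold.maximalAtlas (𝓡 n) ∞ M)
    {f f' : EuclideanSpace ℝ (Fin n) → ℝ} (hf : Continuous f) (hfc : HasCompactSupport f)
    (hfs : tsupport f ⊆ e.target) (hf' : Continuous f') (hfc' : HasCompactSupport f') :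
    inner ℂ (chartLp g e hf hfc) (chartLp g e hf' hfc') =
      ((∫ y, gramDensity g e.symm y * (f y * f' y) : ℝ) : ℂ) := by
  have hF : ContinuousOn (chartLift e f') e.source := by
    have : ContinuousOn (fun x => (f' (e x) : ℂ)) e.source :=
      Complex.continuous_ofReal.comp_continuousOn (hf'.comp_continuousOn e.continuousOn)
    exact this.congr fun x hx => indicator_of_mem hx _
  refine (inner_chartLp g he hf hfc hfs (v := chartLp g e hf' hfc')
    (memLp_chartLift (e := e) g hf' hfc').coeFn_toLp hF).trans ?_
  rw [← integral_complex_ofReal]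
  congr 1
  ext y
  by_cases hy : y ∈ e.target
  · rw [chartLift, indicator_of_mem (e.map_target hy), e.right_inv hy, Complex.real_smul]
    push_cast; ring
  · rw [image_eq_zero_of_notMem_tsupport fun h => hy (hfs h)]; simp

theorem norm_sq_chartLp (he : e ∈ IsManifold.maximalAtlas (𝓡 n) ∞ M)
    {f : EuclideanSpace ℝ (Fin n) → ℝ} (hf : Continuous f) (hfc : HasCompactSupport f)
    (hfs : tsupport f ⊆ e.target) :
    ‖chartLp g e hf hfc‖ ^ 2 = ∫ y, gramDensity g e.symm y * f y ^ 2 := by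
  have h1 := inner_chartLp_chartLp g he hf hfc hfs hf hfc
  rw [inner_self_eq_norm_sq_to_K] at h1
  have h2 : ‖chartLp g e hf hfc‖ ^ 2 = ∫ y, gramDensity g e.symm y * (f y * f y) := by
    apply Complex.ofReal_injective
    rw [← h1]; push_cast; rfl
  rw [h2]; simp_rw [sq]

end Chart

/-! ### Trajectories of a vector field issued from a segment -/

/-- Trajectories of a `C¹` vector field on a product, issued from the points `(p₀ + δ v, ξ₀)`: for
small `δ` they live a uniform time and their projections to the first factor never meet at the
same time. -/
theorem exists_trajectories {E G : Type*} [NormedAddCommGroup E] [NormedSpace ℝ E]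
    [CompleteSpace E] [NormedAddCommGroup G] [NormedSpace ℝ G] [CompleteSpace G]
    {F : E × G → E × G} {p₀ : E} {ξ₀ : G} (hF : ContDiffAt ℝ 1 F (p₀, ξ₀)) (v : E) (hv : v ≠ 0)
    {ε : ℝ} (hε : 0 < ε) :
    ∃ T > 0, ∃ δ₀ > 0, ∃ γ : ℝ → ℝ → E × G, ∀ δ : ℝ, |δ| ≤ δ₀ →
      γ δ 0 = (p₀ + δ • v, ξ₀) ∧
      (∀ s ∈ Ioo (-T) T, HasDerivAt (γ δ) (F (γ δ s)) s ∧ γ δ s ∈ Metric.ball (p₀, ξ₀) ε) ∧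
      ∀ δ' : ℝ, |δ'| ≤ δ₀ → δ ≠ δ' → ∀ s ∈ Ioo (-T) T, (γ δ s).1 ≠ (γ δ' s).1 := by
  obtain ⟨K, N, hN, hK⟩ := hF.exists_lipschitzOnWith
  obtain ⟨ε₁, hε₁, hball⟩ := Metric.mem_nhds_iff.1 hN
  obtain ⟨T₀, hT₀, a, r, L, K', hr, hpl⟩ := IsPicardLindelof.of_contDiffAt_one hF
  obtain ⟨α, hα, L', hL'⟩ :=
    (hpl 0).exists_forall_mem_closedBall_eq_hasDerivWithinAt_lipschitzOnWith
  simp only [zero_sub, zero_add] at hα hL'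
  set z₀ : E × G := (p₀, ξ₀)
  set ε₂ := min ε ε₁ with hε₂
  have hε₂pos : 0 < ε₂ := lt_min hε hε₁
  have hz₀ : z₀ ∈ Metric.closedBall z₀ (r : ℝ) := Metric.mem_closedBall_self r.2
  have hcont : ContinuousAt (α z₀) 0 :=
    (((hα z₀ hz₀).2 0 ⟨by linarith, hT₀.le⟩).continuousWithinAt).continuousAt
      (Icc_mem_nhds (by linarith) hT₀)
  have hc2 : ∀ᶠ s in 𝓝 (0 : ℝ), dist (α z₀ s) z₀ < ε₂ / 2 := by
    have := Metric.tendsto_nhds.1 hcont.tendsto (ε₂ / 2) (by positivity)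
    rwa [(hα z₀ hz₀).1] at this
  obtain ⟨T₁, hT₁, hT₁'⟩ := Metric.eventually_nhds_iff.1 hc2
  -- with `K` and `L'` Lipschitz constants of the field and of the flow, the difference of two
  -- trajectories cannot be cancelled over a time less than `1 / (K L')`
  set T := min (min T₀ T₁) (1 / (2 * (K * L' + 1))) with hT
  have hden : (0 : ℝ) < 2 * (K * L' + 1) := by positivity
  have hTpos : 0 < T := lt_min (lt_min hT₀ hT₁) (by positivity)
  have hTT₀ : T ≤ T₀ := (min_le_left _ _).trans (min_le_left _ _)
  have hTT₁ : T ≤ T₁ := (min_le_left _ _).trans (min_le_right _ _)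
  have hTK : T * (K * L') < 1 := by
    have h1 : T ≤ 1 / (2 * (K * L' + 1)) := min_le_right _ _
    rw [le_div_iff₀ hden] at h1
    nlinarith [hTpos, mul_nonneg K.2 L'.2, mul_nonneg hTpos.le (mul_nonneg K.2 L'.2)]
  have hvn : 0 < ‖v‖ := norm_pos_iff.2 hv
  set m := min (r : ℝ) (ε₂ / (2 * (L' + 1))) with hm
  have hmpos : 0 < m := lt_min hr (by positivity)
  let ini : ℝ → E × G := fun δ => (p₀ + δ • v, ξ₀)
  have hini : ∀ δ δ', dist (ini δ) (ini δ') = |δ - δ'| * ‖v‖ := by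
    intro δ δ'
    simp only [ini, Prod.dist_eq, dist_self, dist_add_left]
    rw [dist_eq_norm, ← sub_smul, norm_smul, Real.norm_eq_abs]
    exact max_eq_left (by positivity)
  have hini0 : ini 0 = z₀ := by simp [ini, z₀]
  have hdist : ∀ δ, |δ| ≤ m / ‖v‖ → dist (ini δ) z₀ ≤ m := by
    intro δ hδ
    rw [← hini0, hini, sub_zero]
    rwa [le_div_iff₀ hvn] at hδ
  have hmem : ∀ δ, |δ| ≤ m / ‖v‖ → ini δ ∈ Metric.closedBall z₀ (r : ℝ) := fun δ hδ =>
    (hdist δ hδ).trans (min_le_left _ _)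
  have hIcc : ∀ s ∈ Ioo (-T) T, s ∈ Icc (-T₀) T₀ := fun s hs =>
    ⟨by linarith [hs.1], by linarith [hs.2]⟩
  have hder : ∀ δ, |δ| ≤ m / ‖v‖ → ∀ s ∈ Ioo (-T) T,
      HasDerivAt (α (ini δ)) (F (α (ini δ) s)) s := fun δ hδ s hs =>
    ((hα _ (hmem δ hδ)).2 s (hIcc s hs)).hasDerivAt
      (Icc_mem_nhds (by linarith [hs.1]) (by linarith [hs.2]))
  have hstay : ∀ δ, |δ| ≤ m / ‖v‖ → ∀ s ∈ Ioo (-T) T, α (ini δ) s ∈ Metric.ball z₀ ε₂ := by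
    intro δ hδ s hs
    have h1 := (hL' s (hIcc s hs)).dist_le_mul _ (hmem δ hδ) _ hz₀
    have h2 : dist (α z₀ s) z₀ < ε₂ / 2 := hT₁' (by
      rw [Real.dist_eq, sub_zero, abs_lt]
      exact ⟨by linarith [hs.1], by linarith [hs.2]⟩)
    have h3 : (L' : ℝ) * dist (ini δ) z₀ ≤ ε₂ / 2 := by
      have h4 := (hdist δ hδ).trans (min_le_right _ _)
      rw [le_div_iff₀ (by positivity)] at h4
      nlinarith [dist_nonneg (x := ini δ) (y := z₀), L'.2]
    rw [Metric.mem_ball]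
    calc dist (α (ini δ) s) z₀ ≤ dist (α (ini δ) s) (α z₀ s) + dist (α z₀ s) z₀ :=
          dist_triangle _ _ _
      _ < ε₂ := by linarith
  refine ⟨T, hTpos, m / ‖v‖, by positivity, fun δ => α (ini δ), fun δ hδ =>
    ⟨(hα _ (hmem δ hδ)).1, fun s hs => ⟨hder δ hδ s hs,
      Metric.ball_subset_ball (min_le_left _ _) (hstay δ hδ s hs)⟩, fun δ' hδ' hne s hs heq => ?_⟩⟩
  -- the distance of the projections varies by less than its initial value
  let D : ℝ → E := fun s => (α (ini δ) s).1 - (α (ini δ') s).1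
  have hD : ∀ t ∈ Ioo (-T) T, HasDerivWithinAt D
      ((F (α (ini δ) t)).1 - (F (α (ini δ') t)).1) (Ioo (-T) T) t := fun t ht =>
    (((hasFDerivAt_fst.comp_hasDerivAt t (hder δ hδ t ht))).sub
      (hasFDerivAt_fst.comp_hasDerivAt t (hder δ' hδ' t ht))).hasDerivWithinAt
  have hbound : ∀ t ∈ Ioo (-T) T, ‖(F (α (ini δ) t)).1 - (F (α (ini δ') t)).1‖ ≤
      K * L' * (|δ - δ'| * ‖v‖) := by
    intro t ht
    have hs2 : Metric.ball z₀ ε₂ ⊆ N := (Metric.ball_subset_ball (min_le_right _ _)).trans hball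
    have h1 := hK.dist_le_mul _ (hs2 (hstay δ hδ t ht)) _ (hs2 (hstay δ' hδ' t ht))
    have h2 := (hL' t (hIcc t ht)).dist_le_mul _ (hmem δ hδ) _ (hmem δ' hδ')
    rw [hini] at h2
    rw [← Prod.fst_sub]
    refine (norm_fst_le _).trans ?_
    rw [← dist_eq_norm]
    refine h1.trans ?_
    rw [mul_assoc]
    gcongr
  have h0 : (0 : ℝ) ∈ Ioo (-T) T := ⟨by linarith, hTpos⟩
  have hmv := (convex_Ioo (-T) T).norm_image_sub_le_of_norm_hasDerivWithin_le hD hbound h0 hs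
  have hDs : D s = 0 := sub_eq_zero.2 heq
  have hD0 : ‖D 0‖ = |δ - δ'| * ‖v‖ := by
    simp only [D]
    rw [(hα _ (hmem δ hδ)).1, (hα _ (hmem δ' hδ')).1]
    simp only [ini, add_sub_add_left_eq_sub]
    rw [← sub_smul, norm_smul, Real.norm_eq_abs]
  rw [hDs, zero_sub, norm_neg, hD0, sub_zero] at hmv
  have hpos : 0 < |δ - δ'| * ‖v‖ := mul_pos (abs_pos.2 (sub_ne_zero.2 hne)) hvn
  have hsT : ‖s‖ ≤ T := by
    rw [Real.norm_eq_abs, abs_le]; exact ⟨hs.1.le, hs.2.le⟩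
  have hKL : (0 : ℝ) ≤ K * L' := by positivity
  nlinarith [mul_le_mul_of_nonneg_left hsT (mul_nonneg hKL hpos.le)]

/-! ### Functions vanishing on a slice -/

section Taylor

variable {Z W G : Type*} [NormedAddCommGroup Z] [NormedSpace ℝ Z] [NormedAddCommGroup W]
  [NormedSpace ℝ W] [NormedAddCommGroup G] [NormedSpace ℝ G]

theorem tendsto_pair_zero (z₀ : Z) :
    Tendsto (fun q : Z × W => (q.1, (0 : W))) (𝓝 (z₀, 0)) (𝓝 (z₀, 0)) := by
  have : Continuous fun q : Z × W => (q.1, (0 : W)) := by fun_prop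
  exact this.tendsto (z₀, 0)

/-- A function vanishing on the slice `w = 0` is `O(‖w‖)`, locally uniformly in the first
variable. -/
theorem exists_norm_le_mul_of_slice_eq_zero {f : Z × W → G} {z₀ : Z}
    (hf : ContDiffAt ℝ 1 f (z₀, 0)) (h0 : ∀ᶠ z in 𝓝 z₀, f (z, 0) = 0) :
    ∃ C : ℝ, 0 ≤ C ∧ ∀ᶠ q in 𝓝 (z₀, (0 : W)), ‖f q‖ ≤ C * ‖q.2‖ := by
  obtain ⟨K, N, hN, hK⟩ := hf.exists_lipschitzOnWith
  refine ⟨K, K.2, ?_⟩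
  have h1 : ∀ᶠ q : Z × W in 𝓝 (z₀, 0), f (q.1, 0) = 0 :=
    (continuous_fst.tendsto (z₀, (0 : W))).eventually h0
  filter_upwards [hN, (tendsto_pair_zero z₀).eventually hN, h1] with q hq1 hq2 hq3
  have := hK.dist_le_mul _ hq1 _ hq2
  rw [hq3, dist_zero_right] at this
  refine this.trans (le_of_eq ?_)
  congr 1
  rw [Prod.dist_eq]
  simp

/-- A function vanishing with its partial derivative on the slice `w = 0` is `O(‖w‖²)`, locally
uniformly in the first variable. -/
theorem exists_norm_le_mul_sq_of_slice_eq_zero {f : Z × W → G} {z₀ : Z}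
    (hf : ContDiffAt ℝ 2 f (z₀, 0)) (h0 : ∀ᶠ z in 𝓝 z₀, f (z, 0) = 0)
    (h1 : ∀ᶠ z in 𝓝 z₀, HasFDerivAt (fun w => f (z, w)) (0 : W →L[ℝ] G) 0) :
    ∃ C : ℝ, 0 ≤ C ∧ ∀ᶠ q in 𝓝 (z₀, (0 : W)), ‖f q‖ ≤ C * ‖q.2‖ ^ 2 := by
  let D : Z × W → (W →L[ℝ] G) := fun q => (fderiv ℝ f q).comp (ContinuousLinearMap.inr ℝ Z W)
  have hD : ContDiffAt ℝ 1 D (z₀, 0) :=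
    (hf.fderiv_right (m := 1) (by norm_num)).clm_comp contDiffAt_const
  have hdiff : ∀ᶠ q in 𝓝 (z₀, (0 : W)), DifferentiableAt ℝ f q := by
    filter_upwards [hf.eventually (by simp)] with q hq
    exact hq.differentiableAt two_ne_zero
  have hpart : ∀ q : Z × W, DifferentiableAt ℝ f q →
      HasFDerivAt (fun w => f (q.1, w)) (D q) q.2 := fun q hq =>
    hq.hasFDerivAt.comp q.2 (hasFDerivAt_prodMk_right q.1 q.2)
  have hD0 : ∀ᶠ z in 𝓝 z₀, D (z, 0) = 0 := by
    have h2 : ∀ᶠ z in 𝓝 z₀, DifferentiableAt ℝ f (z, 0) := by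
      have hc : Continuous fun z : Z => (z, (0 : W)) := by fun_prop
      exact (hc.tendsto z₀).eventually hdiff
    filter_upwards [h1, h2] with z hz1 hz2
    exact (hpart (z, 0) hz2).unique hz1
  obtain ⟨C, hC, hCD⟩ := exists_norm_le_mul_of_slice_eq_zero hD hD0
  refine ⟨C, hC, ?_⟩
  have h0' : ∀ᶠ q : Z × W in 𝓝 (z₀, 0), f (q.1, 0) = 0 :=
    (continuous_fst.tendsto (z₀, (0 : W))).eventually h0
  obtain ⟨ε, hε, hball⟩ := Metric.eventually_nhds_iff_ball.1 ((hCD.and hdiff).and h0')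
  filter_upwards [Metric.ball_mem_nhds _ hε] with q hq
  have hseg : ∀ w ∈ Metric.closedBall (0 : W) ‖q.2‖, (q.1, w) ∈ Metric.ball (z₀, (0 : W)) ε := by
    intro w hw
    rw [Metric.mem_ball, Prod.dist_eq] at hq ⊢
    refine lt_of_le_of_lt (max_le_max le_rfl ?_) hq
    simpa using hw
  have hmv := (convex_closedBall (0 : W) ‖q.2‖).norm_image_sub_le_of_norm_hasFDerivWithin_le
    (f := fun w => f (q.1, w)) (f' := fun w => D (q.1, w)) (C := C * ‖q.2‖) (x := 0) (y := q.2)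
    (fun w hw => (hpart (q.1, w) (hball _ (hseg w hw)).1.2).hasFDerivWithinAt)
    (fun w hw => ((hball _ (hseg w hw)).1.1).trans (by
      have : ‖w‖ ≤ ‖q.2‖ := by simpa using hw
      simp only
      gcongr)) (by simp) (by simp)
  rw [(hball q hq).2, sub_zero, sub_zero] at hmv
  calc ‖f q‖ ≤ C * ‖q.2‖ * ‖q.2‖ := hmv
    _ = C * ‖q.2‖ ^ 2 := by ring

end Taylor

/-! ### Second-order jets -/

section Jet

variable {E : Type*} [NormedAddCommGroup E] [NormedSpace ℝ E]

/-- `f` is twice differentiable at `y`, with first and second derivatives `ξ` and `B` there. -/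
structure HasJet (f : E → ℝ) (ξ : E →L[ℝ] ℝ) (B : E →L[ℝ] E →L[ℝ] ℝ) (y : E) : Prop where
  eventually_differentiable : ∀ᶠ x in 𝓝 y, DifferentiableAt ℝ f x
  hasFDerivAt : HasFDerivAt f ξ y
  hasFDerivAt_fderiv : HasFDerivAt (fderiv ℝ f) B y

variable {f g : E → ℝ} {ξ η : E →L[ℝ] ℝ} {B B' : E →L[ℝ] E →L[ℝ] ℝ} {y : E}

/-- The second derivative may be computed from any formula for the first derivative. -/
theorem HasJet.of_eventually {f' : E → E →L[ℝ] ℝ} (h : ∀ᶠ x in 𝓝 y, HasFDerivAt f (f' x) x)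
    (hB : HasFDerivAt f' B y) : HasJet f (f' y) B y where
  eventually_differentiable := h.mono fun _ hx => hx.differentiableAt
  hasFDerivAt := h.self_of_nhds
  hasFDerivAt_fderiv := hB.congr_of_eventuallyEq (h.mono fun _ hx => hx.fderiv)

theorem HasJet.eventually_hasFDerivAt (h : HasJet f ξ B y) :
    ∀ᶠ x in 𝓝 y, HasFDerivAt f (fderiv ℝ f x) x :=
  h.eventually_differentiable.mono fun _ hx => hx.hasFDerivAt

theorem HasJet.mul (hf : HasJet f ξ B y) (hg : HasJet g η B' y) :
    HasJet (fun x => f x * g x) (f y • η + g y • ξ)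
      (f y • B' + ξ.smulRight η + (g y • B + η.smulRight ξ)) y := by
  have h := HasJet.of_eventually (f := fun x => f x * g x)
    (f' := fun x => f x • fderiv ℝ g x + g x • fderiv ℝ f x)
    (B := f y • B' + ξ.smulRight (fderiv ℝ g y) + (g y • B + η.smulRight (fderiv ℝ f y))) ?_
    ((hf.hasFDerivAt.smul hg.hasFDerivAt_fderiv).add
      (hg.hasFDerivAt.smul hf.hasFDerivAt_fderiv))
  · rwa [hf.hasFDerivAt.fderiv, hg.hasFDerivAt.fderiv] at h
  · filter_upwards [hf.eventually_hasFDerivAt, hg.eventually_hasFDerivAt] with x h1 h2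
    exact h1.mul h2

theorem HasJet.comp {φ φ' φ'' : ℝ → ℝ} (hf : HasJet f ξ B y) (h1 : ∀ t, HasDerivAt φ (φ' t) t)
    (h2 : ∀ t, HasDerivAt φ' (φ'' t) t) :
    HasJet (fun x => φ (f x)) (φ' (f y) • ξ) (φ' (f y) • B + (φ'' (f y) • ξ).smulRight ξ) y := by
  have h := HasJet.of_eventually (f := fun x => φ (f x))
    (f' := fun x => φ' (f x) • fderiv ℝ f x)
    (B := φ' (f y) • B + (φ'' (f y) • ξ).smulRight (fderiv ℝ f y)) ?_
    (((h2 (f y)).comp_hasFDerivAt y hf.hasFDerivAt).smul hf.hasFDerivAt_fderiv)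
  · rwa [hf.hasFDerivAt.fderiv] at h
  · filter_upwards [hf.eventually_hasFDerivAt] with x hx
    exact (h1 (f x)).comp_hasFDerivAt x hx

end Jet

section Operator

variable {n : ℕ}

/-- The bilinear form `∑ Aᵢⱼ ξᵢ ηⱼ` on covectors. -/
noncomputable def cobilin (A : EuclideanSpace ℝ (Fin n) → Matrix (Fin n) (Fin n) ℝ)
    (y : EuclideanSpace ℝ (Fin n)) (ξ η : EuclideanSpace ℝ (Fin n) →L[ℝ] ℝ) : ℝ :=
  ∑ i, ∑ j, A y i j * ξ (EuclideanSpace.single i 1) * η (EuclideanSpace.single j 1)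

/-- The coefficients of first order of `divForm` in non-divergence form. -/
noncomputable def driftCoeff (ρ : EuclideanSpace ℝ (Fin n) → ℝ)
    (A : EuclideanSpace ℝ (Fin n) → Matrix (Fin n) (Fin n) ℝ) (y : EuclideanSpace ℝ (Fin n))
    (j : Fin n) : ℝ :=
  (ρ y)⁻¹ * ∑ i, fderiv ℝ (fun w => ρ w * A w i j) y (EuclideanSpace.single i 1)

/-- The value of `divForm` on a function with first and second derivatives `ξ` and `B`. -/
noncomputable def jetOp (ρ : EuclideanSpace ℝ (Fin n) → ℝ)
    (A : EuclideanSpace ℝ (Fin n) → Matrix (Fin n) (Fin n) ℝ) (y : EuclideanSpace ℝ (Fin n))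
    (ξ : EuclideanSpace ℝ (Fin n) →L[ℝ] ℝ)
    (B : EuclideanSpace ℝ (Fin n) →L[ℝ] EuclideanSpace ℝ (Fin n) →L[ℝ] ℝ) : ℝ :=
  ∑ i, ∑ j, A y i j * B (EuclideanSpace.single i 1) (EuclideanSpace.single j 1) +
    ∑ j, driftCoeff ρ A y j * ξ (EuclideanSpace.single j 1)

variable {ρ : EuclideanSpace ℝ (Fin n) → ℝ}
  {A : EuclideanSpace ℝ (Fin n) → Matrix (Fin n) (Fin n) ℝ} {y : EuclideanSpace ℝ (Fin n)}
  {ξ ξ' η : EuclideanSpace ℝ (Fin n) →L[ℝ] ℝ}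
  {B B' : EuclideanSpace ℝ (Fin n) →L[ℝ] EuclideanSpace ℝ (Fin n) →L[ℝ] ℝ}

/-- The non-divergence form of `divForm`. -/
theorem divForm_eq_jetOp {u : EuclideanSpace ℝ (Fin n) → ℝ} (hu : HasJet u ξ B y)
    (hρ : DifferentiableAt ℝ ρ y) (hρ0 : ρ y ≠ 0)
    (hA : ∀ i j, DifferentiableAt ℝ (fun w => A w i j) y) :
    divForm ρ A u y = jetOp ρ A y ξ B := by
  have h1 : ∀ i, fderiv ℝ (fun w => ρ w • ∑ j, A w i j •
      fderiv ℝ u w (EuclideanSpace.single j (1 : ℝ))) y (EuclideanSpace.single i (1 : ℝ)) =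
      ∑ j, (ρ y * A y i j * B (EuclideanSpace.single i 1) (EuclideanSpace.single j 1) +
        fderiv ℝ (fun w => ρ w * A w i j) y (EuclideanSpace.single i 1) *
          ξ (EuclideanSpace.single j 1)) := by
    intro i
    have h2 : (fun w => ρ w • ∑ j, A w i j • fderiv ℝ u w (EuclideanSpace.single j (1 : ℝ))) =
        fun w => ∑ j, (ρ w * A w i j) * fderiv ℝ u w (EuclideanSpace.single j (1 : ℝ)) := by
      ext w
      simp only [smul_eq_mul, Finset.mul_sum, mul_assoc]
    have h3 : ∀ j, HasFDerivAt
        (fun w => (ρ w * A w i j) * fderiv ℝ u w (EuclideanSpace.single j (1 : ℝ)))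
        ((ρ y * A y i j) • (B.flip (EuclideanSpace.single j (1 : ℝ))) +
          (fderiv ℝ u y (EuclideanSpace.single j (1 : ℝ))) •
            fderiv ℝ (fun w => ρ w * A w i j) y) y := by
      intro j
      have h4 : HasFDerivAt (fun w => fderiv ℝ u w (EuclideanSpace.single j (1 : ℝ)))
          (B.flip (EuclideanSpace.single j (1 : ℝ))) y := by
        have := hu.hasFDerivAt_fderiv.clm_apply
          (hasFDerivAt_const (EuclideanSpace.single j (1 : ℝ)) y)
        refine this.congr_fderiv ?_
        ext v
        simp
      exact (hρ.mul (hA i j)).hasFDerivAt.mul h4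
    rw [h2, (HasFDerivAt.fun_sum fun j _ => h3 j).fderiv, sum_apply]
    refine Finset.sum_congr rfl fun j _ => ?_
    rw [hu.hasFDerivAt.fderiv]
    simp only [add_apply, smul_apply, ContinuousLinearMap.flip_apply, smul_eq_mul]
    ring
  rw [divForm, Finset.sum_congr rfl fun i _ => h1 i, jetOp]
  simp only [Finset.sum_add_distrib, smul_eq_mul, mul_add, driftCoeff, Finset.mul_sum,
    Finset.sum_mul]
  congr 1
  · refine Finset.sum_congr rfl fun i _ => Finset.sum_congr rfl fun j _ => ?_
    field_simp
  · rw [Finset.sum_comm]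
    refine Finset.sum_congr rfl fun i _ => Finset.sum_congr rfl fun j _ => ?_
    ring

theorem jetOp_add : jetOp ρ A y (ξ + ξ') (B + B') = jetOp ρ A y ξ B + jetOp ρ A y ξ' B' := by
  simp only [jetOp, add_apply, mul_add, Finset.sum_add_distrib]
  ring

theorem jetOp_smul (c : ℝ) : jetOp ρ A y (c • ξ) (c • B) = c * jetOp ρ A y ξ B := by
  simp only [jetOp, smul_apply, smul_eq_mul, mul_add, Finset.mul_sum]
  congr 1
  · refine Finset.sum_congr rfl fun i _ => Finset.sum_congr rfl fun j _ => ?_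
    ring
  · refine Finset.sum_congr rfl fun i _ => ?_
    ring

theorem jetOp_smulRight : jetOp ρ A y 0 (ξ.smulRight η) = cobilin A y ξ η := by
  simp [jetOp, cobilin, mul_assoc]

theorem cobilin_add_left : cobilin A y (ξ + ξ') η = cobilin A y ξ η + cobilin A y ξ' η := by
  simp only [cobilin, add_apply, mul_add, add_mul, Finset.sum_add_distrib]

theorem cobilin_smul_left (c : ℝ) : cobilin A y (c • ξ) η = c * cobilin A y ξ η := by
  simp only [cobilin, smul_apply, smul_eq_mul, Finset.mul_sum]
  refine Finset.sum_congr rfl fun i _ => Finset.sum_congr rfl fun j _ => ?_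
  ring

theorem cobilin_comm (hA : ∀ i j, A y i j = A y j i) : cobilin A y ξ η = cobilin A y η ξ := by
  simp only [cobilin]
  rw [Finset.sum_comm]
  refine Finset.sum_congr rfl fun i _ => Finset.sum_congr rfl fun j _ => ?_
  rw [hA j i]; ring

theorem cobilin_smul_right (c : ℝ) : cobilin A y ξ (c • η) = c * cobilin A y ξ η := by
  simp only [cobilin, smul_apply, smul_eq_mul, Finset.mul_sum]
  refine Finset.sum_congr rfl fun i _ => Finset.sum_congr rfl fun j _ => ?_
  ring

/-- The second-order operator on a product: the jet on the left is that of `HasJet.mul`. -/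
theorem jetOp_mul (hA : ∀ i j, A y i j = A y j i) (a b : ℝ) :
    jetOp ρ A y (a • η + b • ξ) (a • B' + ξ.smulRight η + (b • B + η.smulRight ξ)) =
      a * jetOp ρ A y η B' + b * jetOp ρ A y ξ B + 2 * cobilin A y ξ η := by
  have h1 : a • η + b • ξ = (a • η + 0) + (b • ξ + 0) := by simp
  rw [h1, jetOp_add, jetOp_add, jetOp_add, jetOp_smul, jetOp_smul, jetOp_smulRight,
    jetOp_smulRight, cobilin_comm hA (ξ := η)]
  ring

/-- The second-order operator on a composition: the jet on the left is that of `HasJet.comp`. -/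
theorem jetOp_comp (a b : ℝ) :
    jetOp ρ A y (a • ξ) (a • B + (b • ξ).smulRight ξ) =
      a * jetOp ρ A y ξ B + b * cobilin A y ξ ξ := by
  have h1 : a • ξ = a • ξ + 0 := by simp
  rw [h1, jetOp_add, jetOp_smul, jetOp_smulRight, cobilin_smul_left]

theorem abs_apply_single_le (ξ : EuclideanSpace ℝ (Fin n) →L[ℝ] ℝ) (i : Fin n) :
    |ξ (EuclideanSpace.single i 1)| ≤ ‖ξ‖ := by
  simpa using ξ.le_opNorm (EuclideanSpace.single i (1 : ℝ))

theorem abs_cobilin_le {C : ℝ} (hC : ∀ i j, |A y i j| ≤ C) :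
    |cobilin A y ξ η| ≤ n ^ 2 * C * ‖ξ‖ * ‖η‖ := by
  have h1 : ∀ i j, |A y i j * ξ (EuclideanSpace.single i 1) * η (EuclideanSpace.single j 1)| ≤
      C * ‖ξ‖ * ‖η‖ := by
    intro i j
    have hC0 : 0 ≤ C := (abs_nonneg _).trans (hC i j)
    rw [abs_mul, abs_mul]
    gcongr
    · exact hC i j
    · exact abs_apply_single_le ξ i
    · exact abs_apply_single_le η j
  calc |cobilin A y ξ η| ≤ ∑ i : Fin n, ∑ j : Fin n, C * ‖ξ‖ * ‖η‖ :=
        (Finset.abs_sum_le_sum_abs _ _).trans (Finset.sum_le_sum fun i _ =>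
          (Finset.abs_sum_le_sum_abs _ _).trans (Finset.sum_le_sum fun j _ => h1 i j))
    _ = n ^ 2 * C * ‖ξ‖ * ‖η‖ := by simp; ring

theorem abs_jetOp_le {C : ℝ} (hC : ∀ i j, |A y i j| ≤ C) (hC' : ∀ j, |driftCoeff ρ A y j| ≤ C) :
    |jetOp ρ A y ξ B| ≤ n ^ 2 * C * ‖B‖ + n * C * ‖ξ‖ := by
  have h1 : ∀ i j, |A y i j * B (EuclideanSpace.single i 1) (EuclideanSpace.single j 1)| ≤
      C * ‖B‖ := by
    intro i j
    have hC0 : 0 ≤ C := (abs_nonneg _).trans (hC i j)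
    rw [abs_mul]
    gcongr
    · exact hC i j
    · have := B.le_opNorm₂ (EuclideanSpace.single i (1 : ℝ)) (EuclideanSpace.single j (1 : ℝ))
      simpa using this
  have h2 : ∀ j, |driftCoeff ρ A y j * ξ (EuclideanSpace.single j 1)| ≤ C * ‖ξ‖ := by
    intro j
    have hC0 : 0 ≤ C := (abs_nonneg _).trans (hC' j)
    rw [abs_mul]
    gcongr
    · exact hC' j
    · exact abs_apply_single_le ξ j
  refine (abs_add_le _ _).trans (add_le_add ?_ ?_)
  · calc _ ≤ ∑ i : Fin n, ∑ j : Fin n, C * ‖B‖ :=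
        (Finset.abs_sum_le_sum_abs _ _).trans (Finset.sum_le_sum fun i _ =>
          (Finset.abs_sum_le_sum_abs _ _).trans (Finset.sum_le_sum fun j _ => h1 i j))
    _ = n ^ 2 * C * ‖B‖ := by simp; ring
  · calc _ ≤ ∑ j : Fin n, C * ‖ξ‖ :=
        (Finset.abs_sum_le_sum_abs _ _).trans (Finset.sum_le_sum fun j _ => h2 j)
    _ = n * C * ‖ξ‖ := by simp; ring

end Operator

/-! ### The Hamiltonian field of the symbol -/

section Hamilton

variable {n : ℕ}

/-- Pairs of a point and a covector. -/
abbrev PhaseSpace (n : ℕ) : Type :=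
  EuclideanSpace ℝ (Fin n) × (EuclideanSpace ℝ (Fin n) →L[ℝ] ℝ)

/-- The vector `∑ Aᵢⱼ ξⱼ eᵢ` associated with a covector. -/
noncomputable def sharp (A : EuclideanSpace ℝ (Fin n) → Matrix (Fin n) (Fin n) ℝ)
    (y : EuclideanSpace ℝ (Fin n)) (ξ : EuclideanSpace ℝ (Fin n) →L[ℝ] ℝ) :
    EuclideanSpace ℝ (Fin n) :=
  ∑ i, ∑ j, (A y i j * ξ (EuclideanSpace.single j 1)) • EuclideanSpace.single i (1 : ℝ)

/-- The derivative in `y` of `cobilin A y ξ ξ`. -/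
noncomputable def symbolGrad (A : EuclideanSpace ℝ (Fin n) → Matrix (Fin n) (Fin n) ℝ)
    (y : EuclideanSpace ℝ (Fin n)) (ξ : EuclideanSpace ℝ (Fin n) →L[ℝ] ℝ) :
    EuclideanSpace ℝ (Fin n) →L[ℝ] ℝ :=
  ∑ i, ∑ j, (ξ (EuclideanSpace.single i 1) * ξ (EuclideanSpace.single j 1)) •
    fderiv ℝ (fun w => A w i j) y

/-- The Hamiltonian field of `½ ∑ Aᵢⱼ ξᵢ ξⱼ`, reparametrized so that `τ` grows at unit speed along
the projected trajectories. -/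
noncomputable def hamField (A : EuclideanSpace ℝ (Fin n) → Matrix (Fin n) (Fin n) ℝ)
    (τ : EuclideanSpace ℝ (Fin n) →L[ℝ] ℝ)
    (z : PhaseSpace n) : PhaseSpace n :=
  ((cobilin A z.1 τ z.2)⁻¹ • sharp A z.1 z.2,
    (-(1 / 2) * (cobilin A z.1 τ z.2)⁻¹) • symbolGrad A z.1 z.2)

/-- The differential, at the point `z.1 + w`, of a phase that is affine on each level set of `τ` and
whose differential along a trajectory of `hamField` is the covector of the trajectory; `z` is the
point of the trajectory at the same level of `τ`. -/
noncomputable def phaseCovector (A : EuclideanSpace ℝ (Fin n) → Matrix (Fin n) (Fin n) ℝ)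
    (τ : EuclideanSpace ℝ (Fin n) →L[ℝ] ℝ)
    (z : PhaseSpace n)
    (w : EuclideanSpace ℝ (Fin n)) : EuclideanSpace ℝ (Fin n) →L[ℝ] ℝ :=
  z.2 + (hamField A τ z).2 w • τ

variable {A : EuclideanSpace ℝ (Fin n) → Matrix (Fin n) (Fin n) ℝ}
  {τ : EuclideanSpace ℝ (Fin n) →L[ℝ] ℝ} {y : EuclideanSpace ℝ (Fin n)}
  {ξ η : EuclideanSpace ℝ (Fin n) →L[ℝ] ℝ}
  {z : PhaseSpace n}

theorem apply_sharp : η (sharp A y ξ) = cobilin A y η ξ := by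
  simp only [sharp, cobilin, map_sum, map_smul, smul_eq_mul]
  refine Finset.sum_congr rfl fun i _ => Finset.sum_congr rfl fun j _ => ?_
  ring

/-- Along the trajectories of `hamField A τ`, the coordinate `τ` is the time. -/
theorem apply_hamField_fst (hz : cobilin A z.1 τ z.2 ≠ 0) : τ (hamField A τ z).1 = 1 := by
  rw [hamField, map_smul, apply_sharp, smul_eq_mul, inv_mul_cancel₀ hz]

/-- The derivative of the symbol `A(a) b b` along a map `x ↦ (a x, b x)` to phase space. -/
theorem hasFDerivAt_cobilin {E : Type*} [NormedAddCommGroup E] [NormedSpace ℝ E]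
    {a : E → EuclideanSpace ℝ (Fin n)} {b : E → EuclideanSpace ℝ (Fin n) →L[ℝ] ℝ} {x : E}
    {a' : E →L[ℝ] EuclideanSpace ℝ (Fin n)} {b' : E →L[ℝ] EuclideanSpace ℝ (Fin n) →L[ℝ] ℝ}
    (hA : ∀ i j, DifferentiableAt ℝ (fun w => A w i j) (a x))
    (hsymm : ∀ i j, A (a x) i j = A (a x) j i)
    (ha : HasFDerivAt a a' x) (hb : HasFDerivAt b b' x) :
    HasFDerivAt (fun x => cobilin A (a x) (b x) (b x))
      ((symbolGrad A (a x) (b x)).comp a' + (2 : ℝ) • (b'.flip (sharp A (a x) (b x)))) x := by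
  have hbi : ∀ i : Fin n, HasFDerivAt (fun x => b x (EuclideanSpace.single i (1 : ℝ)))
      (b'.flip (EuclideanSpace.single i 1)) x := by
    intro i
    refine (hb.clm_apply (hasFDerivAt_const (EuclideanSpace.single i (1 : ℝ)) x)).congr_fderiv ?_
    ext v; simp
  have h := HasFDerivAt.fun_sum (u := Finset.univ) fun (i : Fin n) _ =>
    HasFDerivAt.fun_sum (u := Finset.univ) fun (j : Fin n) _ =>
      ((((hA i j).hasFDerivAt.comp x ha).mul (hbi i)).mul (hbi j))
  refine h.congr_fderiv ?_
  ext v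
  have hs : b' v (sharp A (a x) (b x)) = cobilin A (a x) (b' v) (b x) := apply_sharp
  simp only [sum_apply, add_apply, smul_apply, ContinuousLinearMap.comp_apply,
    ContinuousLinearMap.flip_apply, hs, symbolGrad, smul_eq_mul, Function.comp_apply,
    Pi.mul_apply]
  have h2 : 2 * cobilin A (a x) (b' v) (b x) =
      cobilin A (a x) (b' v) (b x) + cobilin A (a x) (b x) (b' v) := by
    rw [cobilin_comm hsymm (ξ := b x)]; ring
  rw [h2]
  simp only [cobilin, ← Finset.sum_add_distrib]
  refine Finset.sum_congr rfl fun i _ => Finset.sum_congr rfl fun j _ => ?_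
  ring

/-- The symbol is conserved by its Hamiltonian field. -/
theorem symbolGrad_hamField_add (z : PhaseSpace n) :
    symbolGrad A z.1 z.2 (hamField A τ z).1 + 2 * (hamField A τ z).2 (sharp A z.1 z.2) = 0 := by
  simp only [hamField, map_smul, smul_apply, smul_eq_mul]
  ring

variable {Ω : Set (EuclideanSpace ℝ (Fin n))}

theorem contDiffAt_cobilin {E : Type*} [NormedAddCommGroup E] [NormedSpace ℝ E]
    {a : E → EuclideanSpace ℝ (Fin n)} {b c : E → EuclideanSpace ℝ (Fin n) →L[ℝ] ℝ} {x : E}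
    {k : WithTop ℕ∞} (hA : ∀ i j, ContDiffAt ℝ k (fun w => A w i j) (a x))
    (ha : ContDiffAt ℝ k a x) (hb : ContDiffAt ℝ k b x) (hc : ContDiffAt ℝ k c x) :
    ContDiffAt ℝ k (fun x => cobilin A (a x) (b x) (c x)) x :=
  ContDiffAt.sum fun i _ => ContDiffAt.sum fun j _ =>
    (((hA i j).comp x ha).mul (hb.clm_apply contDiffAt_const)).mul (hc.clm_apply contDiffAt_const)

theorem contDiffAt_sharp {E : Type*} [NormedAddCommGroup E] [NormedSpace ℝ E]
    {a : E → EuclideanSpace ℝ (Fin n)} {b : E → EuclideanSpace ℝ (Fin n) →L[ℝ] ℝ} {x : E}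
    {k : WithTop ℕ∞} (hA : ∀ i j, ContDiffAt ℝ k (fun w => A w i j) (a x))
    (ha : ContDiffAt ℝ k a x) (hb : ContDiffAt ℝ k b x) :
    ContDiffAt ℝ k (fun x => sharp A (a x) (b x)) x :=
  ContDiffAt.sum fun i _ => ContDiffAt.sum fun j _ =>
    (((hA i j).comp x ha).mul (hb.clm_apply contDiffAt_const)).smul contDiffAt_const

theorem contDiffAt_hamField (hA : ∀ i j, ContDiffAt ℝ ∞ (fun w => A w i j) z.1)
    (hz : cobilin A z.1 τ z.2 ≠ 0) : ContDiffAt ℝ ∞ (hamField A τ) z := by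
  have hs : ContDiffAt ℝ ∞ (fun z : PhaseSpace n
      => (cobilin A z.1 τ z.2)⁻¹) z :=
    (contDiffAt_cobilin hA contDiffAt_fst contDiffAt_const contDiffAt_snd).inv hz
  refine ContDiffAt.prodMk (hs.smul (contDiffAt_sharp hA contDiffAt_fst contDiffAt_snd))
    ((contDiffAt_const.mul hs).smul ?_)
  refine ContDiffAt.sum fun i _ => ContDiffAt.sum fun j _ => ContDiffAt.smul
    ((contDiffAt_snd.clm_apply contDiffAt_const).mul (contDiffAt_snd.clm_apply contDiffAt_const)) ?_
  exact ((hA i j).fderiv_right (m := ∞) (by simp)).comp z contDiffAt_fst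

/-- Uniform control, near the point `z₀` of phase space, of all quantities that enter the
construction of approximate eigenfunctions along a trajectory. -/
structure LocalBounds (ρ : EuclideanSpace ℝ (Fin n) → ℝ)
    (A : EuclideanSpace ℝ (Fin n) → Matrix (Fin n) (Fin n) ℝ)
    (Ω : Set (EuclideanSpace ℝ (Fin n))) (τ : EuclideanSpace ℝ (Fin n) →L[ℝ] ℝ)
    (z : PhaseSpace n)
    (w : EuclideanSpace ℝ (Fin n)) (C : ℝ) : Prop where
  mem : z.1 + w ∈ Ω
  mem_base : z.1 ∈ Ω
  transversal : cobilin A z.1 τ z.2 ≠ 0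
  norm_covector : ‖z.2‖ ≤ C
  norm_field : ‖hamField A τ z‖ ≤ C
  norm_field_deriv : ‖fderiv ℝ (hamField A τ) z (hamField A τ z)‖ ≤ C
  le_symbol : C⁻¹ ≤ cobilin A z.1 z.2 z.2
  abs_coeff : ∀ i j, |A (z.1 + w) i j| ≤ C
  abs_drift : ∀ j, |driftCoeff ρ A (z.1 + w) j| ≤ C
  density_le : ρ (z.1 + w) ≤ C
  le_density : C⁻¹ ≤ ρ (z.1 + w)
  abs_eikonal : |cobilin A (z.1 + w) (phaseCovector A τ z w) (phaseCovector A τ z w) -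
    cobilin A z.1 z.2 z.2| ≤ C * ‖w‖ ^ 2
  norm_velocity : ‖sharp A (z.1 + w) (phaseCovector A τ z w) -
    τ (sharp A (z.1 + w) (phaseCovector A τ z w)) • (hamField A τ z).1‖ ≤ C * ‖w‖

theorem eventually_le_of_continuousAt {T : Type*} [TopologicalSpace T] {f : T → ℝ} {t : T}
    (hf : ContinuousAt f t) : ∀ᶠ C : ℝ in atTop, ∀ᶠ s in 𝓝 t, f s ≤ C := by
  filter_upwards [eventually_gt_atTop (f t)] with C hC
  exact (hf.eventually_lt_const hC).mono fun _ h => h.le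

theorem eventually_inv_le_of_continuousAt {T : Type*} [TopologicalSpace T] {f : T → ℝ} {t : T}
    (hf : ContinuousAt f t) (ht : 0 < f t) : ∀ᶠ C : ℝ in atTop, ∀ᶠ s in 𝓝 t, C⁻¹ ≤ f s := by
  filter_upwards [eventually_gt_atTop (f t)⁻¹] with C hC
  have h1 : C⁻¹ < f t := inv_lt_of_inv_lt₀ ht hC
  exact (hf.eventually_const_lt h1).mono fun _ h => h.le

/-- Near a base point and the covector `τ`, all constants are uniform. The essential items are the
eikonal defect, quadratic in the displacement `w` by the equations of motion, and the component of
the characteristic direction transversal to the trajectory, linear in `w`. -/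
theorem exists_localBounds {ρ : EuclideanSpace ℝ (Fin n) → ℝ} (hΩ : IsOpen Ω)
    (hρ : ContDiffOn ℝ ∞ ρ Ω) (hρ0 : ∀ y ∈ Ω, 0 < ρ y)
    (hA : ∀ i j, ContDiffOn ℝ ∞ (fun y => A y i j) Ω) (hsymm : ∀ y ∈ Ω, ∀ i j, A y i j = A y j i)
    {p₀ : EuclideanSpace ℝ (Fin n)} (hp₀ : p₀ ∈ Ω) (hτ : 0 < cobilin A p₀ τ τ) :
    ∃ C : ℝ, 1 ≤ C ∧ ∃ ε > 0, ∀ z ∈ Metric.ball (p₀, τ) ε, ∀ w ∈ Metric.ball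
    (0 : EuclideanSpace ℝ (Fin n)) ε,
      LocalBounds ρ A Ω τ z w C := by
  set z₀ : PhaseSpace n := (p₀, τ) with hz₀
  set q₀ : PhaseSpace n × EuclideanSpace ℝ (Fin n) := (z₀, 0) with hq₀
  have hAat : ∀ y ∈ Ω, ∀ i j, ContDiffAt ℝ ∞ (fun w => A w i j) y := fun y hy i j =>
    (hA i j).contDiffAt (hΩ.mem_nhds hy)
  have hfield : ContDiffAt ℝ ∞ (hamField A τ) z₀ := contDiffAt_hamField (hAat _ hp₀) hτ.ne'
  have hsum : ContDiffAt ℝ ∞ (fun q : PhaseSpace n × EuclideanSpace ℝ (Fin n) => q.1.1 + q.2) q₀ :=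
    (contDiff_fst.fst.add contDiff_snd).contDiffAt
  have hq₀Ω : q₀.1.1 + q₀.2 ∈ Ω := by simpa [hq₀, hz₀] using hp₀
  have hphase : ContDiffAt ℝ ∞ (fun q : PhaseSpace n × EuclideanSpace ℝ (Fin n) =>
      phaseCovector A τ q.1 q.2) q₀ := by
    have h1 : ContDiffAt ℝ ∞ (fun q : PhaseSpace n × EuclideanSpace ℝ (Fin n) => hamField A τ q.1)
        q₀ := hfield.comp q₀ contDiffAt_fst
    exact contDiffAt_fst.snd.add ((h1.snd.clm_apply contDiffAt_snd).smul contDiffAt_const)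
  have hmem : ∀ᶠ q in 𝓝 q₀, q.1.1 + q.2 ∈ Ω :=
    hsum.continuousAt.eventually_mem (hΩ.mem_nhds hq₀Ω)
  have hbase : ∀ᶠ z in 𝓝 z₀, z.1 ∈ Ω :=
    continuousAt_fst.eventually_mem (hΩ.mem_nhds hp₀)
  have htrans : ContinuousAt (fun z : PhaseSpace n =>
      cobilin A z.1 τ z.2) z₀ :=
    (contDiffAt_cobilin (k := ∞) (hAat _ hp₀) contDiffAt_fst contDiffAt_const
    contDiffAt_snd).continuousAt
  have hne : ∀ᶠ z in 𝓝 z₀, cobilin A z.1 τ z.2 ≠ 0 := htrans.eventually_ne hτ.ne'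
  -- the eikonal defect vanishes to second order on the trajectory
  have hphase0 : ∀ z, phaseCovector A τ z 0 = z.2 := fun z => by simp [phaseCovector]
  obtain ⟨C₁, hC₁, hE⟩ := exists_norm_le_mul_sq_of_slice_eq_zero
    (f := fun q : PhaseSpace n × EuclideanSpace ℝ (Fin n) =>
      cobilin A (q.1.1 + q.2) (phaseCovector A τ q.1 q.2) (phaseCovector A τ q.1 q.2) -
        cobilin A q.1.1 q.1.2 q.1.2) (z₀ := z₀)
    (((contDiffAt_cobilin (a := fun q : PhaseSpace n × EuclideanSpace ℝ (Fin n) =>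
        q.1.1 + q.2) (x := q₀) (hAat _ hq₀Ω) hsum hphase hphase).sub
      (contDiffAt_cobilin (a := fun q : PhaseSpace n × EuclideanSpace ℝ (Fin n) =>
        q.1.1) (x := q₀) (hAat _ hp₀) contDiffAt_fst.fst contDiffAt_fst.snd
        contDiffAt_fst.snd)).of_le (WithTop.coe_le_coe.2 le_top))
    (Eventually.of_forall fun z => by simp [hphase0])
    (by
      filter_upwards [hbase, hne] with z hz hz0
      have h1 : HasFDerivAt (fun w : EuclideanSpace ℝ (Fin n) => z.1 + w)
          (ContinuousLinearMap.id ℝ _) 0 := (hasFDerivAt_id _).const_add _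
      have h2 : HasFDerivAt (fun w : EuclideanSpace ℝ (Fin n) => phaseCovector A τ z w)
          ((hamField A τ z).2.smulRight τ) 0 :=
        (((hamField A τ z).2.hasFDerivAt.smul_const τ)).const_add _
      have hz' : z.1 + 0 ∈ Ω := by simpa using hz
      have h3 := (hasFDerivAt_cobilin (a := fun w => z.1 + w) (b := fun w => phaseCovector A τ z w)
        (fun i j => (hAat _ hz' i j).differentiableAt (by simp)) (hsymm _ hz') h1 h2).sub_const
        (cobilin A z.1 z.2 z.2)
      refine h3.congr_fderiv ?_
      ext v
      simp only [hphase0, add_zero, add_apply, ContinuousLinearMap.comp_apply, smul_apply,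
        ContinuousLinearMap.flip_apply, ContinuousLinearMap.smulRight_apply, apply_sharp,
        smul_eq_mul, zero_apply, hamField, ContinuousLinearMap.id_apply]
      field_simp
      ring)
  -- on the trajectory the characteristic direction is that of the trajectory
  obtain ⟨C₂, hC₂, hV⟩ := exists_norm_le_mul_of_slice_eq_zero
    (f := fun q : PhaseSpace n × EuclideanSpace ℝ (Fin n) =>
      sharp A (q.1.1 + q.2) (phaseCovector A τ q.1 q.2) -
        τ (sharp A (q.1.1 + q.2) (phaseCovector A τ q.1 q.2)) • (hamField A τ q.1).1) (z₀ := z₀)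
    (by
      have h1 := contDiffAt_sharp (a := fun q : PhaseSpace n × EuclideanSpace ℝ (Fin n) =>
          q.1.1 + q.2)
        (x := q₀) (hAat _ hq₀Ω) hsum hphase
      have h2 : ContDiffAt ℝ ∞ (fun q : PhaseSpace n × EuclideanSpace ℝ (Fin n) => hamField A τ q.1)
          q₀ := hfield.comp q₀ contDiffAt_fst
      exact (h1.sub ((τ.contDiff.contDiffAt.comp q₀ h1).smul h2.fst)).of_le
        (WithTop.coe_le_coe.2 le_top))
    (by
      filter_upwards [hne] with z hz
      rw [hphase0, add_zero, apply_sharp, hamField, smul_smul, mul_inv_cancel₀ hz, one_smul,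
        sub_self])
  have hfst : Tendsto (Prod.fst : PhaseSpace n × EuclideanSpace ℝ (Fin n) → _) (𝓝 q₀) (𝓝 z₀) :=
      continuous_fst.tendsto q₀
  have b1 := eventually_le_of_continuousAt
    (f := fun q : PhaseSpace n × EuclideanSpace ℝ (Fin n)
      => ‖q.1.2‖) (t := q₀) (by fun_prop)
  have b2 := eventually_le_of_continuousAt (f := fun z => ‖hamField A τ z‖) (t := z₀)
    hfield.continuousAt.norm
  have b3 := eventually_le_of_continuousAt
    (f := fun z => ‖fderiv ℝ (hamField A τ) z (hamField A τ z)‖) (t := z₀)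
    (((hfield.fderiv_right (m := ∞) (by simp)).clm_apply hfield).continuousAt.norm)
  have b4 := eventually_inv_le_of_continuousAt
    (f := fun z : PhaseSpace n =>
      cobilin A z.1 z.2 z.2) (t := z₀)
    (contDiffAt_cobilin (k := ∞) (hAat _ hp₀) contDiffAt_fst contDiffAt_snd
      contDiffAt_snd).continuousAt hτ
  have hcomp : ∀ f : EuclideanSpace ℝ (Fin n) → ℝ, ContDiffAt ℝ ∞ f (q₀.1.1 + q₀.2) →
      ContinuousAt (fun q : PhaseSpace n × EuclideanSpace ℝ (Fin n) => f (q.1.1 + q.2)) q₀ :=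
    fun f hf =>
    ContinuousAt.comp (f := fun q : PhaseSpace n × EuclideanSpace ℝ (Fin n) => q.1.1 + q.2)
      hf.continuousAt hsum.continuousAt
  have b5 : ∀ i j, ∀ᶠ C : ℝ in atTop, ∀ᶠ q in 𝓝 q₀, |A (q.1.1 + q.2) i j| ≤ C := fun i j =>
    eventually_le_of_continuousAt (hcomp _ (hAat _ hq₀Ω i j)).abs
  have b6 : ∀ j, ∀ᶠ C : ℝ in atTop, ∀ᶠ q in 𝓝 q₀, |driftCoeff ρ A (q.1.1 + q.2) j| ≤ C := by
    intro j
    have hρat : ContDiffAt ℝ ∞ ρ (q₀.1.1 + q₀.2) := hρ.contDiffAt (hΩ.mem_nhds hq₀Ω)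
    have hd : ContDiffAt ℝ ∞ (fun y => driftCoeff ρ A y j) (q₀.1.1 + q₀.2) :=
      (hρat.inv (hρ0 _ hq₀Ω).ne').mul (ContDiffAt.sum fun i _ =>
        (((hρat.mul (hAat _ hq₀Ω i j)).fderiv_right (m := ∞) (by simp)).clm_apply
          contDiffAt_const))
    exact eventually_le_of_continuousAt (hcomp _ hd).abs
  have hρc : ContinuousAt (fun q : PhaseSpace n × EuclideanSpace ℝ (Fin n) => ρ (q.1.1 + q.2)) q₀ :=
    hcomp _ (hρ.contDiffAt (hΩ.mem_nhds hq₀Ω))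
  have b7 := eventually_le_of_continuousAt hρc
  have b8 := eventually_inv_le_of_continuousAt hρc (hρ0 _ hq₀Ω)
  obtain ⟨C, ⟨⟨⟨⟨⟨⟨⟨⟨⟨⟨c1, c2⟩, c3⟩, c4⟩, c5⟩, c6⟩, c7⟩, c8⟩, c9⟩, c10⟩, c11⟩⟩ :=
    ((((((((((b1.and b2).and b3).and b4).and (eventually_all.2 fun i => eventually_all.2
    (b5 i))).and
      (eventually_all.2 b6)).and b7).and b8).and (eventually_ge_atTop C₁)).and
      (eventually_ge_atTop C₂)).and (eventually_ge_atTop 1)).exists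
  have hall : ∀ᶠ q in 𝓝 q₀, LocalBounds ρ A Ω τ q.1 q.2 C := by
    filter_upwards [hmem, hfst.eventually hbase, hfst.eventually hne, hE, hV, c1,
      hfst.eventually c2, hfst.eventually c3, hfst.eventually c4,
      eventually_all.2 fun i => eventually_all.2 (c5 i), eventually_all.2 c6, c7, c8]
      with q h1 h2 h3 h4 h5 h6 h7 h8 h9 h10 h11 h12 h13
    exact ⟨h1, h2, h3, h6, h7, h8, h9, h10, h11, h12, h13,
      h4.trans (by gcongr), h5.trans (by gcongr)⟩
  obtain ⟨ε, hε, hball⟩ := Metric.eventually_nhds_iff_ball.1 hall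
  refine ⟨C, c11, ε, hε, fun z hz w hw => hball (z, w) ?_⟩
  rw [Metric.mem_ball, Prod.dist_eq]
  exact max_lt hz hw

end Hamilton

/-! ### Tubes around a curve transversal to a linear form -/

section Tube

variable {E : Type*} [NormedAddCommGroup E] [NormedSpace ℝ E]

/-- The displacement from the point `X (τ x - t₀)` of the curve `X` to `x`.  For a curve with
`τ (X s) = t₀ + s` it lies in the kernel of `τ`. -/
def rayOffset (τ : E →L[ℝ] ℝ) (t₀ : ℝ) (X : ℝ → E) (x : E) : E := x - X (τ x - t₀)

/-- The closed tube of length `2 ℓ` and radius `r` around the curve `X`. -/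
def rayTube (τ : E →L[ℝ] ℝ) (t₀ : ℝ) (X : ℝ → E) (ℓ r : ℝ) : Set E :=
  {x | |τ x - t₀| ≤ ℓ ∧ ‖rayOffset τ t₀ X x‖ ≤ r}

/-- The function `α + Ξ(w)`, where `w` is the displacement from the curve `X` and `α` a primitive
of `Ξ(V)` along the curve; `V` stands for the velocity of `X`. -/
noncomputable def rayPhase (τ : E →L[ℝ] ℝ) (t₀ : ℝ) (X V : ℝ → E) (Ξ : ℝ → E →L[ℝ] ℝ) (x : E) : ℝ :=
  (∫ t in (0 : ℝ)..(τ x - t₀), Ξ t (V t)) + Ξ (τ x - t₀) (rayOffset τ t₀ X x)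

variable {τ : E →L[ℝ] ℝ} {t₀ ℓ r T : ℝ} {X V V₁ : ℝ → E} {Ξ P P₁ : ℝ → E →L[ℝ] ℝ} {x : E}

theorem hasFDerivAt_height (τ : E →L[ℝ] ℝ) (t₀ : ℝ) (x : E) :
    HasFDerivAt (fun x => τ x - t₀) τ x := τ.hasFDerivAt.sub_const t₀

theorem eventually_height_mem (hx : τ x - t₀ ∈ Ioo (-T) T) :
    ∀ᶠ y in 𝓝 x, τ y - t₀ ∈ Ioo (-T) T :=
  (hasFDerivAt_height τ t₀ x).continuousAt.eventually_mem (isOpen_Ioo.mem_nhds hx)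

theorem hasFDerivAt_comp_height {G : Type*} [NormedAddCommGroup G] [NormedSpace ℝ G] {f : ℝ → G}
    {f' : G} (hf : HasDerivAt f f' (τ x - t₀)) :
    HasFDerivAt (fun x => f (τ x - t₀)) (τ.smulRight f') x := by
  refine (hf.hasFDerivAt.comp x (hasFDerivAt_height τ t₀ x)).congr_fderiv ?_
  ext v; simp

theorem hasFDerivAt_rayOffset {v : E} (hX : HasDerivAt X v (τ x - t₀)) :
    HasFDerivAt (rayOffset τ t₀ X) (ContinuousLinearMap.id ℝ E - τ.smulRight v) x :=
  (hasFDerivAt_id x).sub (hasFDerivAt_comp_height hX)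

theorem apply_rayOffset (hX : τ (X (τ x - t₀)) = t₀ + (τ x - t₀)) :
    τ (rayOffset τ t₀ X x) = 0 := by
  rw [rayOffset, map_sub, hX]; ring

theorem contDiffAt_height {k : WithTop ℕ∞} : ContDiffAt ℝ k (fun x => τ x - t₀) x :=
  (τ.contDiff.sub contDiff_const).contDiffAt

theorem contDiffAt_rayOffset {k : WithTop ℕ∞} (hX : ContDiffAt ℝ k X (τ x - t₀)) :
    ContDiffAt ℝ k (rayOffset τ t₀ X) x :=
  contDiffAt_id.sub (hX.comp x contDiffAt_height)

theorem isCompact_rayTube [FiniteDimensional ℝ E] (hX : ∀ s ∈ Icc (-ℓ) ℓ, ContinuousAt X s) :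
    IsCompact (rayTube τ t₀ X ℓ r) := by
  have hc : IsCompact ((fun q : ℝ × E => X q.1 + q.2) '' (Icc (-ℓ) ℓ ×ˢ Metric.closedBall 0 r)) := by
    refine (isCompact_Icc.prod (isCompact_closedBall _ _)).image_of_continuousOn ?_
    refine ContinuousOn.add ?_ continuousOn_snd
    exact ContinuousOn.comp (t := Icc (-ℓ) ℓ) (fun s hs => (hX s hs).continuousWithinAt)
      continuousOn_fst fun q hq => hq.1
  refine hc.of_isClosed_subset ?_ ?_
  · have h1 : IsClosed {x : E | |τ x - t₀| ≤ ℓ} :=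
      isClosed_le (by fun_prop) continuous_const
    have h2 : ContinuousOn (rayOffset τ t₀ X) {x : E | |τ x - t₀| ≤ ℓ} := by
      refine continuousOn_id.sub (ContinuousOn.comp (t := Icc (-ℓ) ℓ)
        (fun s hs => (hX s hs).continuousWithinAt) (by fun_prop) fun x hx => abs_le.1 hx)
    exact h2.norm.preimage_isClosed_of_isClosed h1 isClosed_Iic
  · rintro x ⟨h1, h2⟩
    exact ⟨(τ x - t₀, rayOffset τ t₀ X x), ⟨abs_le.1 h1, by simpa using h2⟩, by
      simp [rayOffset]⟩

theorem rayTube_mem_nhds (hℓ : 0 < ℓ) (hr : 0 < r) (hX : ContinuousAt X 0) (h0 : τ (X 0) = t₀) :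
    rayTube τ t₀ X ℓ r ∈ 𝓝 (X 0) := by
  have h1 : ContinuousAt (fun x => |τ x - t₀|) (X 0) := by fun_prop
  have h2 : ContinuousAt (fun x => ‖rayOffset τ t₀ X x‖) (X 0) := by
    refine (continuousAt_id.sub (ContinuousAt.comp (g := X) ?_ (by fun_prop))).norm
    simpa [h0] using hX
  filter_upwards [h1.eventually_lt_const (u := ℓ) (by simpa [h0] using hℓ),
    h2.eventually_lt_const (u := r) (by simpa [rayOffset, h0] using hr)] with x hx1 hx2
  exact ⟨hx1.le, hx2.le⟩

/-- The volumes of a tube and of the tube of half the size are comparable, uniformly in the size: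
the dilation that maps one to the other has constant Jacobian. -/
theorem volume_rayTube_le [FiniteDimensional ℝ E] [MeasurableSpace E] [BorelSpace E]
    (μ : Measure E) [μ.IsAddHaarMeasure] (hℓ : ℓ < T)
    (hX : ∀ s ∈ Ioo (-T) T, HasDerivAt X (V s) s) (hτX : ∀ s ∈ Ioo (-T) T, τ (X s) = t₀ + s)
    (hV : ∀ s ∈ Ioo (-T) T, τ (V s) = 1) :
    μ (rayTube τ t₀ X ℓ r) ≤
      ENNReal.ofReal (2 ^ Module.finrank ℝ E) * μ (rayTube τ t₀ X (ℓ / 2) (r / 2)) := by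
  have hI : ∀ {x : E} {m : ℝ}, m ≤ ℓ → |τ x - t₀| ≤ m → τ x - t₀ ∈ Ioo (-T) T := fun hm hx =>
    ⟨by linarith [(abs_le.1 hx).1], by linarith [(abs_le.1 hx).2]⟩
  rcases lt_or_ge ℓ 0 with hℓ0 | hℓ0
  · have : rayTube τ t₀ X ℓ r = ∅ := by
      ext x; simp only [rayTube, mem_ofPred_eq, mem_empty_iff_false, iff_false, not_and]
      intro h; linarith [abs_nonneg (τ x - t₀)]
    simp [this]
  -- the dilation by `2` about the starting point, performed along the curve and transversally to it
  let S : E → E := fun x => X (2 * (τ x - t₀)) + (2 : ℝ) • rayOffset τ t₀ X x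
  have hsub : rayTube τ t₀ X ℓ r ⊆ S '' rayTube τ t₀ X (ℓ / 2) (r / 2) := by
    rintro y ⟨h1, h2⟩
    have hs := hI le_rfl h1
    have hs2 : (τ y - t₀) / 2 ∈ Ioo (-T) T := by
      have := abs_le.1 h1
      constructor <;> linarith [hs.1, hs.2]
    have hw := apply_rayOffset (hτX _ hs)
    have hheight : τ (X ((τ y - t₀) / 2) + (2⁻¹ : ℝ) • rayOffset τ t₀ X y) - t₀ =
        (τ y - t₀) / 2 := by
      rw [map_add, map_smul, hw, hτX _ hs2]; simp
    have hoff : rayOffset τ t₀ X (X ((τ y - t₀) / 2) + (2⁻¹ : ℝ) • rayOffset τ t₀ X y) =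
        (2⁻¹ : ℝ) • rayOffset τ t₀ X y := by
      rw [rayOffset, hheight, add_sub_cancel_left]
    refine ⟨X ((τ y - t₀) / 2) + (2⁻¹ : ℝ) • rayOffset τ t₀ X y, ⟨?_, ?_⟩, ?_⟩
    · rw [hheight, abs_div, abs_two]; linarith
    · rw [hoff, norm_smul]; norm_num; linarith
    · simp only [S]
      rw [hheight, hoff, smul_smul, mul_inv_cancel₀ two_ne_zero, one_smul,
        mul_div_cancel₀ _ two_ne_zero, rayOffset]
      abel
  have hD : ∀ x ∈ rayTube τ t₀ X (ℓ / 2) (r / 2), HasFDerivWithinAt S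
      ((2 : ℝ) • (ContinuousLinearMap.id ℝ E + τ.smulRight (V (2 * (τ x - t₀)) - V (τ x - t₀))))
      (rayTube τ t₀ X (ℓ / 2) (r / 2)) x := by
    rintro x ⟨h1, -⟩
    have hs := hI (by linarith) h1
    have hs2 : 2 * (τ x - t₀) ∈ Ioo (-T) T := by
      have := abs_le.1 h1
      constructor <;> linarith
    have h3 : HasFDerivAt (fun x => X (2 * (τ x - t₀))) (τ.smulRight ((2 : ℝ) • V (2 * (τ x - t₀))))
        x :=
      hasFDerivAt_comp_height (f := fun s => X (2 * s)) (by
        have := (hX _ hs2).scomp (τ x - t₀) ((hasDerivAt_id (τ x - t₀)).const_mul 2)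
        simpa [Function.comp_def] using this)
    refine ((h3.add ((hasFDerivAt_rayOffset (hX _ hs)).const_smul (2 : ℝ))).congr_fderiv
      ?_).hasFDerivWithinAt
    ext v
    simp only [add_apply, smul_apply, ContinuousLinearMap.smulRight_apply, sub_apply,
      ContinuousLinearMap.id_apply, smul_sub, smul_add, smul_smul, mul_comm (2 : ℝ)]
    abel
  have hdet : ∀ x ∈ rayTube τ t₀ X (ℓ / 2) (r / 2), ((2 : ℝ) • (ContinuousLinearMap.id ℝ E +
      τ.smulRight (V (2 * (τ x - t₀)) - V (τ x - t₀)))).det = 2 ^ Module.finrank ℝ E := by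
    rintro x ⟨h1, -⟩
    have hs := hI (by linarith) h1
    have hs2 : 2 * (τ x - t₀) ∈ Ioo (-T) T := by
      have := abs_le.1 h1
      constructor <;> linarith
    -- the difference of two velocities lies in the kernel of `τ`, which makes the map a
    -- transvection
    have h4 : LinearMap.det (LinearMap.transvection (τ : E →ₗ[ℝ] ℝ)
        (V (2 * (τ x - t₀)) - V (τ x - t₀))) = 1 := by
      rw [LinearMap.transvection.det]
      simp [hV _ hs, hV _ hs2]
    have h5 : (((2 : ℝ) • (ContinuousLinearMap.id ℝ E +
        τ.smulRight (V (2 * (τ x - t₀)) - V (τ x - t₀))) : E →L[ℝ] E) : E →ₗ[ℝ] E) =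
        (2 : ℝ) • LinearMap.transvection (τ : E →ₗ[ℝ] ℝ)
          (V (2 * (τ x - t₀)) - V (τ x - t₀)) := by
      ext v; simp [LinearMap.transvection]
    rw [ContinuousLinearMap.det, h5, LinearMap.det_smul, h4, mul_one]
  have hmeas : MeasurableSet (rayTube τ t₀ X (ℓ / 2) (r / 2)) :=
    (isCompact_rayTube fun s hs => (hX s ⟨by linarith [hs.1],
      by linarith [hs.2]⟩).continuousAt).measurableSet
  calc μ (rayTube τ t₀ X ℓ r) ≤ μ (S '' rayTube τ t₀ X (ℓ / 2) (r / 2)) := measure_mono hsub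
    _ ≤ _ := addHaar_image_le_lintegral_abs_det_fderiv μ hmeas hD
    _ = ∫⁻ _ in rayTube τ t₀ X (ℓ / 2) (r / 2), ENNReal.ofReal (2 ^ Module.finrank ℝ E) ∂μ := by
        refine setLIntegral_congr_fun hmeas fun x hx => ?_
        simp only [hdet x hx]
        rw [abs_of_pos (by positivity)]
    _ = _ := by rw [setLIntegral_const]

/-! ### Jets of the phase and of the cutoffs -/

/-- No derivative of the velocity enters: in the direction of the curve the primitive contributes
`Ξ(V)`, and the displacement contributes `-Ξ(V)`. -/
theorem hasFDerivAt_rayPhase (hX : ∀ s ∈ Ioo (-T) T, HasDerivAt X (V s) s)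
    (hV : ContinuousOn V (Ioo (-T) T)) (hΞ : ∀ s ∈ Ioo (-T) T, HasDerivAt Ξ (P s) s)
    (hx : τ x - t₀ ∈ Ioo (-T) T) :
    HasFDerivAt (rayPhase τ t₀ X V Ξ)
      (Ξ (τ x - t₀) + P (τ x - t₀) (rayOffset τ t₀ X x) • τ) x := by
  have hcont : ContinuousOn (fun t => Ξ t (V t)) (Ioo (-T) T) :=
    ContinuousOn.clm_apply (fun s hs => (hΞ s hs).continuousAt.continuousWithinAt) hV
  have hT : (0 : ℝ) ∈ Ioo (-T) T := ⟨by linarith [hx.1, hx.2], by linarith [hx.1, hx.2]⟩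
  have hsub : uIcc 0 (τ x - t₀) ⊆ Ioo (-T) T := ordConnected_Ioo.uIcc_subset hT hx
  have hα : HasDerivAt (fun s => ∫ t in (0 : ℝ)..s, Ξ t (V t))
      (Ξ (τ x - t₀) (V (τ x - t₀))) (τ x - t₀) :=
    intervalIntegral.integral_hasDerivAt_right (hcont.mono hsub).intervalIntegrable
      (hcont.stronglyMeasurableAtFilter isOpen_Ioo _ hx)
      (hcont.continuousAt (isOpen_Ioo.mem_nhds hx))
  refine ((hasFDerivAt_comp_height hα).add ((hasFDerivAt_comp_height (hΞ _ hx)).clm_apply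
    (hasFDerivAt_rayOffset (hX _ hx)))).congr_fderiv ?_
  ext v
  simp only [add_apply, ContinuousLinearMap.smulRight_apply, smul_eq_mul, map_smul, map_sub,
    ContinuousLinearMap.comp_apply, sub_apply, ContinuousLinearMap.id_apply,
    ContinuousLinearMap.flip_apply, smul_apply]
  ring

theorem hasJet_rayPhase (hX : ∀ s ∈ Ioo (-T) T, HasDerivAt X (V s) s)
    (hV : ContinuousOn V (Ioo (-T) T)) (hΞ : ∀ s ∈ Ioo (-T) T, HasDerivAt Ξ (P s) s)
    (hP : ∀ s ∈ Ioo (-T) T, HasDerivAt P (P₁ s) s) (hx : τ x - t₀ ∈ Ioo (-T) T) :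
    HasJet (rayPhase τ t₀ X V Ξ) (Ξ (τ x - t₀) + P (τ x - t₀) (rayOffset τ t₀ X x) • τ)
      (τ.smulRight (P (τ x - t₀)) + (P₁ (τ x - t₀) (rayOffset τ t₀ X x) • τ +
        (P (τ x - t₀)).comp (ContinuousLinearMap.id ℝ E - τ.smulRight (V (τ x - t₀)))).smulRight
          τ) x := by
  refine HasJet.of_eventually (f' := fun x => Ξ (τ x - t₀) +
    P (τ x - t₀) (rayOffset τ t₀ X x) • τ) ((eventually_height_mem hx).mono fun y hy =>
      hasFDerivAt_rayPhase hX hV hΞ hy) ?_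
  refine ((hasFDerivAt_comp_height (hΞ _ hx)).add
    (((hasFDerivAt_comp_height (hP _ hx)).clm_apply
      (hasFDerivAt_rayOffset (hX _ hx))).smul_const τ)).congr_fderiv ?_
  ext v u
  simp only [add_apply, ContinuousLinearMap.smulRight_apply, smul_eq_mul, map_smul, map_sub,
    ContinuousLinearMap.comp_apply, sub_apply, ContinuousLinearMap.id_apply,
    ContinuousLinearMap.flip_apply, smul_apply]
  ring

theorem norm_id_sub_smulRight_le {C : ℝ} {v : E} (hτ : ‖τ‖ ≤ 1) (hv : ‖v‖ ≤ C) :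
    ‖ContinuousLinearMap.id ℝ E - τ.smulRight v‖ ≤ 1 + C := by
  refine (norm_sub_le _ _).trans (add_le_add ContinuousLinearMap.norm_id_le ?_)
  rw [ContinuousLinearMap.norm_smulRight_apply]
  nlinarith [norm_nonneg v, norm_nonneg τ]

/-- A cutoff at distance `1 / r` from the curve. Its second derivative is of size `r²`; its first
derivative is of size `r` and annihilates the velocity of the curve. -/
theorem exists_hasJet_rayCutoff {β : E → ℝ} (hβ : ContDiff ℝ 2 β) {C Cβ : ℝ} (hC : 0 ≤ C)
    (hβ1 : ∀ x, ‖fderiv ℝ β x‖ ≤ Cβ) (hβ2 : ∀ x, ‖fderiv ℝ (fderiv ℝ β) x‖ ≤ Cβ)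
    (hτ : ‖τ‖ ≤ 1) (hX : ∀ s ∈ Ioo (-T) T, HasDerivAt X (V s) s)
    (hV : ∀ s ∈ Ioo (-T) T, HasDerivAt V (V₁ s) s) (hx : τ x - t₀ ∈ Ioo (-T) T)
    (hVC : ‖V (τ x - t₀)‖ ≤ C) (hVC₁ : ‖V₁ (τ x - t₀)‖ ≤ C) (hr : 0 ≤ r) :
    ∃ B, HasJet (fun x => β (r • rayOffset τ t₀ X x))
      (r • (fderiv ℝ β (r • rayOffset τ t₀ X x)).comp
        (ContinuousLinearMap.id ℝ E - τ.smulRight (V (τ x - t₀)))) B x ∧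
      ‖B‖ ≤ r ^ 2 * (Cβ * (1 + C) ^ 2) + r * (Cβ * C) := by
  have hCβ : 0 ≤ Cβ := (norm_nonneg _).trans (hβ1 0)
  have hoff : ∀ y, τ y - t₀ ∈ Ioo (-T) T → HasFDerivAt (fun x => r • rayOffset τ t₀ X x)
      (r • (ContinuousLinearMap.id ℝ E - τ.smulRight (V (τ y - t₀)))) y := fun y hy =>
    (hasFDerivAt_rayOffset (hX _ hy)).const_smul r
  have hd2 : HasFDerivAt (fderiv ℝ β) (fderiv ℝ (fderiv ℝ β) (r • rayOffset τ t₀ X x))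
      (r • rayOffset τ t₀ X x) :=
    ((hβ.fderiv_right (m := 1) (by norm_num)).differentiable one_ne_zero _).hasFDerivAt
  have h1 := (HasFDerivAt.clm_comp (hd2.comp x (hoff x hx))
    ((hasFDerivAt_const (ContinuousLinearMap.id ℝ E) x).sub
      (((ContinuousLinearMap.smulRightL ℝ E E τ).hasFDerivAt).comp x
        (hasFDerivAt_comp_height (hV _ hx))))).const_smul r
  refine ⟨_, HasJet.of_eventually (f' := fun y => r • (fderiv ℝ β (r • rayOffset τ t₀ X y)).comp
    (ContinuousLinearMap.id ℝ E - τ.smulRight (V (τ y - t₀)))) ?_ h1, ?_⟩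
  · filter_upwards [eventually_height_mem hx] with y hy
    refine (((hβ.differentiable two_ne_zero _).hasFDerivAt).comp y (hoff y hy)).congr_fderiv ?_
    ext v; simp
  · have hproj := norm_id_sub_smulRight_le hτ hVC
    refine ContinuousLinearMap.opNorm_le_bound _ (by positivity) fun v => ?_
    refine ContinuousLinearMap.opNorm_le_bound _ (by positivity) fun u => ?_
    have ha : ‖fderiv ℝ (fderiv ℝ β) (r • rayOffset τ t₀ X x)
        ((ContinuousLinearMap.id ℝ E - τ.smulRight (V (τ x - t₀))) v)
        ((ContinuousLinearMap.id ℝ E - τ.smulRight (V (τ x - t₀))) u)‖ ≤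
        Cβ * ((1 + C) * ‖v‖) * ((1 + C) * ‖u‖) :=
      (ContinuousLinearMap.le_opNorm₂ _ _ _).trans (by
        gcongr
        · exact hβ2 _
        · exact (ContinuousLinearMap.le_opNorm _ _).trans (by gcongr)
        · exact (ContinuousLinearMap.le_opNorm _ _).trans (by gcongr))
    have hτv : ∀ v, ‖τ v‖ ≤ ‖v‖ := fun v =>
      (τ.le_opNorm v).trans (by nlinarith [norm_nonneg v])
    have hb : ‖τ v * (τ u * fderiv ℝ β (r • rayOffset τ t₀ X x) (V₁ (τ x - t₀)))‖ ≤
        ‖v‖ * (‖u‖ * (Cβ * C)) := by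
      rw [norm_mul, norm_mul]
      gcongr
      · exact hτv v
      · exact hτv u
      · exact (ContinuousLinearMap.le_opNorm _ _).trans (by gcongr; exact hβ1 _)
    have heq : ∀ B : E →L[ℝ] E →L[ℝ] ℝ, B v u = r ^ 2 *
        (fderiv ℝ (fderiv ℝ β) (r • rayOffset τ t₀ X x)
        ((ContinuousLinearMap.id ℝ E - τ.smulRight (V (τ x - t₀))) v)
        ((ContinuousLinearMap.id ℝ E - τ.smulRight (V (τ x - t₀))) u)) -
        r * (τ v * (τ u * fderiv ℝ β (r • rayOffset τ t₀ X x) (V₁ (τ x - t₀)))) →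
        ‖B v u‖ ≤ (r ^ 2 * (Cβ * (1 + C) ^ 2) + r * (Cβ * C)) * ‖v‖ * ‖u‖ := by
      intro B hB
      rw [hB]
      refine (norm_sub_le _ _).trans ?_
      rw [norm_mul, norm_mul, norm_pow, Real.norm_of_nonneg hr]
      calc _ ≤ r ^ 2 * (Cβ * ((1 + C) * ‖v‖) * ((1 + C) * ‖u‖)) + r * (‖v‖ * (‖u‖ * (Cβ * C))) := by
            gcongr
        _ = _ := by ring
    refine heq _ ?_
    have hL : ∀ w u : E, ContinuousLinearMap.smulRightL ℝ E E τ w u = τ u • w := fun _ _ => rfl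
    have hneg : ∀ w : E, fderiv ℝ β (r • rayOffset τ t₀ X x) (-w) =
        -fderiv ℝ β (r • rayOffset τ t₀ X x) w := map_neg _
    have hsmul : ∀ (c : ℝ) (w : E), fderiv ℝ β (r • rayOffset τ t₀ X x) (c • w) =
        c * fderiv ℝ β (r • rayOffset τ t₀ X x) w := fun c w => map_smul _ c w
    have hsmul2 : ∀ (c : ℝ) (w : E), fderiv ℝ (fderiv ℝ β) (r • rayOffset τ t₀ X x) (c • w) =
        c • fderiv ℝ (fderiv ℝ β) (r • rayOffset τ t₀ X x) w := fun c w => map_smul _ c w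
    have hLs : ∀ (c : ℝ) (w : E), ContinuousLinearMap.smulRightL ℝ E E τ (c • w) =
        c • ContinuousLinearMap.smulRightL ℝ E E τ w := fun c w => map_smul _ c w
    simp only [smul_apply, add_apply, sub_apply, zero_sub, neg_apply,
      ContinuousLinearMap.comp_apply,
      ContinuousLinearMap.compL_apply, ContinuousLinearMap.flip_apply, Pi.sub_apply,
      Function.comp_apply, hL, hLs, hneg, hsmul, hsmul2,
      ContinuousLinearMap.smulRight_apply, smul_eq_mul, ContinuousLinearMap.id_apply]
    ring

end Tube

/-! ### Oscillating functions with a slowly varying amplitude -/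

section Oscillation

variable {n : ℕ} {ρ : EuclideanSpace ℝ (Fin n) → ℝ}
  {A : EuclideanSpace ℝ (Fin n) → Matrix (Fin n) (Fin n) ℝ} {y : EuclideanSpace ℝ (Fin n)}

/-- If the phase `ψ` solves the eikonal equation up to `O(λ⁻¹)` and the amplitude `f g` varies at
scale `λ^(-1/2)`, but only at scale `1` along the characteristics of `ψ`, then `f g cos (K ψ + θ)`
solves the Helmholtz equation up to `O(λ)`. -/
theorem abs_divForm_mul_cos_add_le {f g ψ : EuclideanSpace ℝ (Fin n) → ℝ}
    {ξf ξg ξ : EuclideanSpace ℝ (Fin n) →L[ℝ] ℝ}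
    {Bf Bg B : EuclideanSpace ℝ (Fin n) →L[ℝ] EuclideanSpace ℝ (Fin n) →L[ℝ] ℝ}
    {a lam K H : ℝ} (θ : ℝ) (hf : HasJet f ξf Bf y) (hg : HasJet g ξg Bg y) (hψ : HasJet ψ ξ B y)
    (hρ : DifferentiableAt ℝ ρ y) (hρ0 : ρ y ≠ 0)
    (hA : ∀ i j, DifferentiableAt ℝ (fun w => A w i j) y) (hsymm : ∀ i j, A y i j = A y j i)
    (hf1 : |f y| ≤ 1) (hg1 : |g y| ≤ 1) (ha : 0 ≤ a) (hlam : 0 < lam)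
    (hLf : |jetOp ρ A y ξf Bf| ≤ a * lam) (hLg : |jetOp ρ A y ξg Bg| ≤ a * lam)
    (hfg : |cobilin A y ξf ξg| ≤ a * lam) (hLψ : |jetOp ρ A y ξ B| ≤ a)
    (hfψ : |cobilin A y ξf ξ| ≤ a) (hgψ : |cobilin A y ξg ξ| ≤ a)
    (hH : |cobilin A y ξ ξ - H| ≤ a / lam) (hKH : K ^ 2 * H = lam ^ 2) (hK0 : 0 ≤ K)
    (hK : K ≤ a * lam) (hK2 : K ^ 2 ≤ a * lam ^ 2) :
    |divForm ρ A (fun x => f x * g x * Real.cos (K * ψ x + θ)) y +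
      lam ^ 2 * (f y * g y * Real.cos (K * ψ y + θ))| ≤ (4 * a + 6 * a ^ 2) * lam := by
  have h1 : ∀ t, HasDerivAt (fun t => Real.cos (K * t + θ)) (-(K * Real.sin (K * t + θ))) t := by
    intro t
    have := ((hasDerivAt_id t).const_mul K).add_const θ |>.cos
    refine this.congr_deriv ?_
    simp only [id]; ring
  have h2 : ∀ t, HasDerivAt (fun t => -(K * Real.sin (K * t + θ)))
      (-(K ^ 2 * Real.cos (K * t + θ))) t := by
    intro t
    have := (((hasDerivAt_id t).const_mul K).add_const θ |>.sin).const_mul K |>.neg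
    refine this.congr_deriv ?_
    simp only [id]; ring
  rw [divForm_eq_jetOp ((hf.mul hg).mul (hψ.comp h1 h2)) hρ hρ0 hA, jetOp_mul hsymm, jetOp_comp,
    jetOp_mul hsymm, cobilin_smul_right, cobilin_add_left, cobilin_smul_left, cobilin_smul_left]
  set s := Real.sin (K * ψ y + θ)
  set c := Real.cos (K * ψ y + θ)
  have hs : |s| ≤ 1 := Real.abs_sin_le_one _
  have hc : |c| ≤ 1 := Real.abs_cos_le_one _
  have key : f y * g y * (-(K * s) * jetOp ρ A y ξ B + -(K ^ 2 * c) * cobilin A y ξ ξ) +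
      c * (f y * jetOp ρ A y ξg Bg + g y * jetOp ρ A y ξf Bf + 2 * cobilin A y ξf ξg) +
      2 * (-(K * s) * (f y * cobilin A y ξg ξ + g y * cobilin A y ξf ξ)) +
      lam ^ 2 * (f y * g y * c) =
      -(K * (f y * (g y * (s * jetOp ρ A y ξ B)))) -
      K ^ 2 * (f y * (g y * (c * (cobilin A y ξ ξ - H)))) +
      (f y * (c * jetOp ρ A y ξg Bg) + g y * (c * jetOp ρ A y ξf Bf) +
        2 * (c * cobilin A y ξf ξg)) -
      2 * (K * (f y * (s * cobilin A y ξg ξ)) + K * (g y * (s * cobilin A y ξf ξ))) := by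
    rw [← hKH]; ring
  rw [key]
  have mul_le : ∀ {p q b : ℝ}, |p| ≤ 1 → |q| ≤ b → |p * q| ≤ b := by
    intro p q b hp hq
    rw [abs_mul]
    calc |p| * |q| ≤ 1 * b := mul_le_mul hp hq (abs_nonneg _) zero_le_one
      _ = b := one_mul b
  have hKm : ∀ {q : ℝ}, |q| ≤ a → |K * q| ≤ a ^ 2 * lam := by
    intro q hq
    rw [abs_mul, abs_of_nonneg hK0]
    calc K * |q| ≤ a * lam * a := mul_le_mul hK hq (abs_nonneg _) (by positivity)
      _ = a ^ 2 * lam := by ring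
  have e1 := hKm (mul_le hf1 (mul_le hg1 (mul_le hs hLψ)))
  have e2 : |K ^ 2 * (f y * (g y * (c * (cobilin A y ξ ξ - H))))| ≤ a ^ 2 * lam := by
    rw [abs_mul, abs_of_nonneg (sq_nonneg K)]
    calc _ ≤ a * lam ^ 2 * (a / lam) := mul_le_mul hK2 (mul_le hf1 (mul_le hg1 (mul_le hc hH)))
          (abs_nonneg _) (by positivity)
      _ = a ^ 2 * lam := by field_simp
  have e3 := mul_le hf1 (mul_le hc hLg)
  have e4 := mul_le hg1 (mul_le hc hLf)
  have e5 := mul_le hc hfg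
  have e6 := hKm (mul_le hf1 (mul_le hs hgψ))
  have e7 := hKm (mul_le hg1 (mul_le hs hfψ))
  rw [abs_le] at e1 e2 e3 e4 e5 e6 e7 ⊢
  constructor <;> linarith [e1.1, e1.2, e2.1, e2.2, e3.1, e3.2, e4.1, e4.2, e5.1, e5.2, e6.1, e6.2,
    e7.1, e7.2]

end Oscillation

/-! ### Cutoff functions -/

/-- A smooth function equal to `1` for `‖x‖ ≤ r / 2` and to `0` for `‖x‖ ≥ r`, with values in
`[0, 1]` and with first two derivatives bounded by `C`. -/
structure IsCutoff {E : Type*} [NormedAddCommGroup E] [NormedSpace ℝ E] (β : E → ℝ) (r C : ℝ) :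
    Prop where
  contDiff : ContDiff ℝ 2 β
  nonneg : ∀ x, 0 ≤ β x
  le_one : ∀ x, β x ≤ 1
  eq_one : ∀ x, ‖x‖ ≤ r / 2 → β x = 1
  eq_zero : ∀ x, r ≤ ‖x‖ → β x = 0
  norm_fderiv : ∀ x, ‖fderiv ℝ β x‖ ≤ C
  norm_fderiv_fderiv : ∀ x, ‖fderiv ℝ (fderiv ℝ β) x‖ ≤ C

theorem exists_bound_fderiv {E : Type*} [NormedAddCommGroup E] [NormedSpace ℝ E] {f : E → ℝ}
    (hf : ContDiff ℝ 2 f) (hc : HasCompactSupport f) :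
    ∃ C, ∀ x, ‖fderiv ℝ f x‖ ≤ C ∧ ‖fderiv ℝ (fderiv ℝ f) x‖ ≤ C := by
  have hf1 : ContDiff ℝ 1 (fderiv ℝ f) := hf.fderiv_right (by norm_num)
  have hf2 : Continuous fun x => ‖fderiv ℝ f x‖ := hf1.continuous.norm
  have hf3 : Continuous fun x => ‖fderiv ℝ (fderiv ℝ f) x‖ :=
    (hf1.continuous_fderiv one_ne_zero).norm
  obtain ⟨C₁, hC₁⟩ := hc.isCompact.exists_bound_of_continuousOn hf2.continuousOn
  obtain ⟨C₂, hC₂⟩ := hc.isCompact.exists_bound_of_continuousOn hf3.continuousOn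
  refine ⟨max 0 (max C₁ C₂), fun x => ?_⟩
  by_cases hx : x ∈ tsupport f
  · have h1 := (le_abs_self _).trans (hC₁ x hx)
    have h2 := (le_abs_self _).trans (hC₂ x hx)
    exact ⟨h1.trans ((le_max_left _ _).trans (le_max_right _ _)),
      h2.trans ((le_max_right _ _).trans (le_max_right _ _))⟩
  · have h1 : f =ᶠ[𝓝 x] fun _ => 0 := notMem_tsupport_iff_eventuallyEq.1 hx
    have h2 : fderiv ℝ f =ᶠ[𝓝 x] fun _ => 0 := by
      refine h1.fderiv.trans (Eventually.of_forall fun y => ?_)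
      simp
    have h3 : ‖fderiv ℝ f x‖ = 0 := by rw [h2.self_of_nhds, norm_zero]
    have h4 : ‖fderiv ℝ (fderiv ℝ f) x‖ = 0 := by
      rw [h2.fderiv_eq, fderiv_fun_const]
      exact norm_zero (E := E →L[ℝ] E →L[ℝ] ℝ)
    rw [h3, h4]
    exact ⟨le_max_left _ _, le_max_left _ _⟩

/-- All constants from some point on are admissible, so that several cutoffs may share one. -/
theorem exists_isCutoff (E : Type*) [NormedAddCommGroup E] [InnerProductSpace ℝ E]
    [FiniteDimensional ℝ E] {r : ℝ} (hr : 0 < r) :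
    ∃ (β : E → ℝ) (C : ℝ), ∀ C', C ≤ C' → IsCutoff β r C' := by
  obtain ⟨b, hin, hout⟩ : ∃ b : ContDiffBump (0 : E), b.rIn = r / 2 ∧ b.rOut = r :=
    ⟨⟨r / 2, r, by positivity, by linarith⟩, rfl, rfl⟩
  have hb : ContDiff ℝ 2 b := b.contDiff
  obtain ⟨C, hC⟩ := exists_bound_fderiv hb b.hasCompactSupport
  have h1 : ∀ x, ‖x‖ ≤ r / 2 → b x = 1 := fun x hx =>
    b.one_of_mem_closedBall (by simpa [hin] using hx)
  have h0 : ∀ x, r ≤ ‖x‖ → b x = 0 := fun x hx => b.zero_of_le_dist (by simpa [hout] using hx)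
  exact ⟨b, C, fun C' hC' => ⟨hb, fun x => b.nonneg, fun x => b.le_one, h1, h0,
    fun x => (hC x).1.trans hC', fun x => (hC x).2.trans hC'⟩⟩

/-- A cutoff in the coordinate `τ` varies at the scale `1`. -/
theorem exists_hasJet_heightCutoff {E : Type*} [NormedAddCommGroup E] [NormedSpace ℝ E]
    {τ : E →L[ℝ] ℝ} {η : ℝ → ℝ} {r C : ℝ} (hη : IsCutoff η r C) (hτ : ‖τ‖ ≤ 1) (t₀ : ℝ) (x : E) :
    ∃ ξ B, HasJet (fun x => η (τ x - t₀)) ξ B x ∧ ‖ξ‖ ≤ C ∧ ‖B‖ ≤ C := by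
  have hC : 0 ≤ C := (norm_nonneg _).trans (hη.norm_fderiv 0)
  have h1 : ∀ t, HasDerivAt η (fderiv ℝ η t 1) t := fun t =>
    (hη.contDiff.differentiable two_ne_zero t).hasFDerivAt.hasDerivAt
  have h2 : ∀ t, HasDerivAt (fun t => fderiv ℝ η t 1) (fderiv ℝ (fderiv ℝ η) t 1 1) t := by
    intro t
    have h3 := (((hη.contDiff.fderiv_right (m := 1) (by norm_num)).differentiable one_ne_zero
      t).hasFDerivAt.hasDerivAt).clm_apply (hasDerivAt_const t (1 : ℝ))
    simpa using h3
  refine ⟨_, _, HasJet.of_eventually (f' := fun x => τ.smulRight (fderiv ℝ η (τ x - t₀) 1))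
    (Eventually.of_forall fun y => hasFDerivAt_comp_height (h1 _))
    (((ContinuousLinearMap.smulRightL ℝ E ℝ τ).hasFDerivAt).comp x
      (hasFDerivAt_comp_height (h2 _))), ?_, ?_⟩
  · rw [ContinuousLinearMap.norm_smulRight_apply]
    have h4 : ‖fderiv ℝ η (τ x - t₀) 1‖ ≤ C := by
      refine ((fderiv ℝ η (τ x - t₀)).le_opNorm 1).trans ?_
      simpa using hη.norm_fderiv (τ x - t₀)
    calc _ ≤ 1 * C := by gcongr
      _ = C := one_mul C
  · have h4 : ‖fderiv ℝ (fderiv ℝ η) (τ x - t₀) 1 1‖ ≤ C := by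
      refine ((fderiv ℝ (fderiv ℝ η) (τ x - t₀)).le_opNorm₂ 1 1).trans ?_
      simpa using hη.norm_fderiv_fderiv (τ x - t₀)
    refine ContinuousLinearMap.opNorm_le_bound _ hC fun v => ?_
    refine ContinuousLinearMap.opNorm_le_bound _ (by positivity) fun u => ?_
    have hτv : ∀ v, ‖τ v‖ ≤ ‖v‖ := fun v =>
      (τ.le_opNorm v).trans (by nlinarith [norm_nonneg v])
    change ‖τ u • (τ v • fderiv ℝ (fderiv ℝ η) (τ x - t₀) 1 1)‖ ≤ _
    rw [norm_smul, norm_smul]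
    calc _ ≤ ‖u‖ * (‖v‖ * C) := by
          gcongr
          · exact hτv u
          · exact hτv v
      _ = C * ‖v‖ * ‖u‖ := by ring

/-! ### Approximate eigenfunctions along a trajectory -/

section Ray

variable {n : ℕ}

/-- A trajectory `γ` of `hamField A τ` on `(-T, T)`, issued from a point of height `t₀`, with
uniform control of the coefficients along it. -/
structure IsRay (ρ : EuclideanSpace ℝ (Fin n) → ℝ)
    (A : EuclideanSpace ℝ (Fin n) → Matrix (Fin n) (Fin n) ℝ)
    (Ω : Set (EuclideanSpace ℝ (Fin n))) (τ : EuclideanSpace ℝ (Fin n) →L[ℝ] ℝ) (t₀ T ε C : ℝ)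
    (γ : ℝ → PhaseSpace n) : Prop where
  hasDerivAt : ∀ s ∈ Ioo (-T) T, HasDerivAt γ (hamField A τ (γ s)) s
  bounds : ∀ s ∈ Ioo (-T) T, ∀ w ∈ Metric.ball (0 : EuclideanSpace ℝ (Fin n)) ε,
    LocalBounds ρ A Ω τ (γ s) w C
  start : τ (γ 0).1 = t₀

/-- The projection of a trajectory to the base. -/
abbrev rayCurve (γ : ℝ → PhaseSpace n) : ℝ → EuclideanSpace ℝ (Fin n) := fun s => (γ s).1

/-- The wave `cos (K ψ + θ)`, with `ψ` the phase attached to the trajectory `γ`, cut off to a tube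
of radius `lam^(-1/2)` around the trajectory. -/
noncomputable def rayMode (A : EuclideanSpace ℝ (Fin n) → Matrix (Fin n) (Fin n) ℝ)
    (τ : EuclideanSpace ℝ (Fin n) →L[ℝ] ℝ) (t₀ : ℝ)
    (γ : ℝ → PhaseSpace n) (η : ℝ → ℝ)
    (β : EuclideanSpace ℝ (Fin n) → ℝ) (lam K θ : ℝ) (x : EuclideanSpace ℝ (Fin n)) : ℝ :=
  η (τ x - t₀) * β (√lam • rayOffset τ t₀ (rayCurve γ) x) *
    Real.cos (K * rayPhase τ t₀ (rayCurve γ) (fun s => (hamField A τ (γ s)).1)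
      (fun s => (γ s).2) x + θ)

variable {ρ : EuclideanSpace ℝ (Fin n) → ℝ}
  {A : EuclideanSpace ℝ (Fin n) → Matrix (Fin n) (Fin n) ℝ} {Ω : Set (EuclideanSpace ℝ (Fin n))}
  {τ : EuclideanSpace ℝ (Fin n) →L[ℝ] ℝ} {t₀ T ε C s : ℝ}
  {γ : ℝ → PhaseSpace n}

namespace IsRay

theorem bounds_zero (h : IsRay ρ A Ω τ t₀ T ε C γ) (hε : 0 < ε) (hs : s ∈ Ioo (-T) T) :
    LocalBounds ρ A Ω τ (γ s) 0 C := h.bounds s hs 0 (Metric.mem_ball_self hε)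

theorem hasDerivAt_fst (h : IsRay ρ A Ω τ t₀ T ε C γ) (hs : s ∈ Ioo (-T) T) :
    HasDerivAt (rayCurve γ) (hamField A τ (γ s)).1 s :=
  (ContinuousLinearMap.fst ℝ (EuclideanSpace ℝ (Fin n))
    (EuclideanSpace ℝ (Fin n) →L[ℝ] ℝ)).hasFDerivAt.comp_hasDerivAt s (h.hasDerivAt s hs)

theorem hasDerivAt_snd (h : IsRay ρ A Ω τ t₀ T ε C γ) (hs : s ∈ Ioo (-T) T) :
    HasDerivAt (fun s => (γ s).2) (hamField A τ (γ s)).2 s :=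
  (ContinuousLinearMap.snd ℝ (EuclideanSpace ℝ (Fin n))
    (EuclideanSpace ℝ (Fin n) →L[ℝ] ℝ)).hasFDerivAt.comp_hasDerivAt s (h.hasDerivAt s hs)

theorem contDiffAt_hamField (h : IsRay ρ A Ω τ t₀ T ε C γ) (hΩ : IsOpen Ω)
    (hA : ∀ i j, ContDiffOn ℝ ∞ (fun y => A y i j) Ω) (hε : 0 < ε) (hs : s ∈ Ioo (-T) T) :
    ContDiffAt ℝ ∞ (hamField A τ) (γ s) :=
  EigenPeriod.contDiffAt_hamField
    (fun i j => (hA i j).contDiffAt (hΩ.mem_nhds (h.bounds_zero hε hs).mem_base))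
    (h.bounds_zero hε hs).transversal

theorem hasDerivAt_field (h : IsRay ρ A Ω τ t₀ T ε C γ) (hΩ : IsOpen Ω)
    (hA : ∀ i j, ContDiffOn ℝ ∞ (fun y => A y i j) Ω) (hε : 0 < ε) (hs : s ∈ Ioo (-T) T) :
    HasDerivAt (fun s => hamField A τ (γ s))
      (fderiv ℝ (hamField A τ) (γ s) (hamField A τ (γ s))) s :=
  ((h.contDiffAt_hamField hΩ hA hε hs).differentiableAt (by simp)).hasFDerivAt.comp_hasDerivAt s
    (h.hasDerivAt s hs)

theorem hasDerivAt_field_fst (h : IsRay ρ A Ω τ t₀ T ε C γ) (hΩ : IsOpen Ω)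
    (hA : ∀ i j, ContDiffOn ℝ ∞ (fun y => A y i j) Ω) (hε : 0 < ε) (hs : s ∈ Ioo (-T) T) :
    HasDerivAt (fun s => (hamField A τ (γ s)).1)
      (fderiv ℝ (hamField A τ) (γ s) (hamField A τ (γ s))).1 s :=
  (ContinuousLinearMap.fst ℝ (EuclideanSpace ℝ (Fin n))
    (EuclideanSpace ℝ (Fin n) →L[ℝ] ℝ)).hasFDerivAt.comp_hasDerivAt s
    (h.hasDerivAt_field hΩ hA hε hs)

theorem hasDerivAt_field_snd (h : IsRay ρ A Ω τ t₀ T ε C γ) (hΩ : IsOpen Ω)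
    (hA : ∀ i j, ContDiffOn ℝ ∞ (fun y => A y i j) Ω) (hε : 0 < ε) (hs : s ∈ Ioo (-T) T) :
    HasDerivAt (fun s => (hamField A τ (γ s)).2)
      (fderiv ℝ (hamField A τ) (γ s) (hamField A τ (γ s))).2 s :=
  (ContinuousLinearMap.snd ℝ (EuclideanSpace ℝ (Fin n))
    (EuclideanSpace ℝ (Fin n) →L[ℝ] ℝ)).hasFDerivAt.comp_hasDerivAt s
    (h.hasDerivAt_field hΩ hA hε hs)

theorem contDiffOn (h : IsRay ρ A Ω τ t₀ T ε C γ) (hΩ : IsOpen Ω)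
    (hA : ∀ i j, ContDiffOn ℝ ∞ (fun y => A y i j) Ω) (hε : 0 < ε) :
    ContDiffOn ℝ 1 (fun s => hamField A τ (γ s)) (Ioo (-T) T) ∧
      ContDiffOn ℝ 2 γ (Ioo (-T) T) := by
  have hd : DifferentiableOn ℝ γ (Ioo (-T) T) := fun s hs =>
    (h.hasDerivAt s hs).differentiableAt.differentiableWithinAt
  have hderiv : ∀ s ∈ Ioo (-T) T, deriv γ s = hamField A τ (γ s) := fun s hs =>
    (h.hasDerivAt s hs).deriv
  have step : ∀ k : ℕ, ContDiffOn ℝ k γ (Ioo (-T) T) →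
      ContDiffOn ℝ k (fun s => hamField A τ (γ s)) (Ioo (-T) T) := fun k hk s hs =>
    (((h.contDiffAt_hamField hΩ hA hε hs).of_le (WithTop.coe_le_coe.2 le_top)).comp s
      (hk.contDiffAt (isOpen_Ioo.mem_nhds hs))).contDiffWithinAt
  have step2 : ∀ k : ℕ, ContDiffOn ℝ k γ (Ioo (-T) T) → ContDiffOn ℝ (k + 1) γ (Ioo (-T) T) :=
    fun k hk => (contDiffOn_succ_iff_deriv_of_isOpen isOpen_Ioo).2 ⟨hd, by simp,
      (step k hk).congr hderiv⟩
  have h0 : ContDiffOn ℝ (0 : ℕ) γ (Ioo (-T) T) := by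
    exact contDiffOn_zero.2 hd.continuousOn
  have h1 : ContDiffOn ℝ (1 : ℕ) γ (Ioo (-T) T) := by simpa using step2 0 h0
  refine ⟨by simpa using step 1 h1, ?_⟩
  have h2 := step2 1 h1
  rwa [show ((1 : ℕ) : WithTop ℕ∞) + 1 = 2 by norm_num] at h2

theorem continuousOn_velocity (h : IsRay ρ A Ω τ t₀ T ε C γ) (hΩ : IsOpen Ω)
    (hA : ∀ i j, ContDiffOn ℝ ∞ (fun y => A y i j) Ω) (hε : 0 < ε) :
    ContinuousOn (fun s => (hamField A τ (γ s)).1) (Ioo (-T) T) :=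
  continuous_fst.comp_continuousOn (h.contDiffOn hΩ hA hε).1.continuousOn

/-- A trajectory is parametrized by its height above the starting level. -/
theorem apply_fst (h : IsRay ρ A Ω τ t₀ T ε C γ) (hε : 0 < ε) (hs : s ∈ Ioo (-T) T) :
    τ (rayCurve γ s) = t₀ + s := by
  have h0 : (0 : ℝ) ∈ Ioo (-T) T := ⟨by linarith [hs.1, hs.2], by linarith [hs.1, hs.2]⟩
  have hd : ∀ s ∈ Ioo (-T) T, HasDerivWithinAt (fun s => τ (rayCurve γ s) - s) 0 (Ioo (-T) T) s := by
    intro s hs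
    have h1 := (τ.hasFDerivAt.comp_hasDerivAt s (h.hasDerivAt_fst hs)).sub (hasDerivAt_id s)
    rw [apply_hamField_fst (h.bounds_zero hε hs).transversal, sub_self] at h1
    exact h1.hasDerivWithinAt
  have h2 := (convex_Ioo (-T) T).norm_image_sub_le_of_norm_hasDerivWithin_le (C := 0) hd
    (by simp) h0 hs
  simp only [zero_mul, norm_le_zero_iff, sub_zero] at h2
  have h3 := h.start
  simp only [rayCurve] at h2 ⊢
  linarith

/-- The symbol is constant along a ray. -/
theorem symbol_eq (h : IsRay ρ A Ω τ t₀ T ε C γ) (hΩ : IsOpen Ω)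
    (hA : ∀ i j, ContDiffOn ℝ ∞ (fun y => A y i j) Ω) (hsymm : ∀ y ∈ Ω, ∀ i j, A y i j = A y j i)
    (hε : 0 < ε) (hs : s ∈ Ioo (-T) T) :
    cobilin A (γ s).1 (γ s).2 (γ s).2 = cobilin A (γ 0).1 (γ 0).2 (γ 0).2 := by
  have h0 : (0 : ℝ) ∈ Ioo (-T) T := ⟨by linarith [hs.1, hs.2], by linarith [hs.1, hs.2]⟩
  have hd : ∀ s ∈ Ioo (-T) T,
      HasDerivWithinAt (fun s => cobilin A (γ s).1 (γ s).2 (γ s).2) 0 (Ioo (-T) T) s := by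
    intro s hs
    have hmem := (h.bounds_zero hε hs).mem_base
    have h1 := (hasFDerivAt_cobilin (a := fun s => (γ s).1) (b := fun s => (γ s).2)
      (fun i j => ((hA i j).contDiffAt (hΩ.mem_nhds hmem)).differentiableAt (by simp))
      (hsymm _ hmem) (h.hasDerivAt_fst hs).hasFDerivAt (h.hasDerivAt_snd hs).hasFDerivAt).hasDerivAt
    refine (h1.congr_deriv ?_).hasDerivWithinAt
    simpa using symbolGrad_hamField_add (A := A) (τ := τ) (γ s)
  have h2 := (convex_Ioo (-T) T).norm_image_sub_le_of_norm_hasDerivWithin_le (C := 0) hd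
    (by simp) h0 hs
  rw [zero_mul, norm_le_zero_iff] at h2
  exact sub_eq_zero.1 h2

end IsRay

/-- A bound for the second derivative of the phase found in `hasJet_rayPhase`. -/
theorem norm_phaseHessian_le {E : Type*} [NormedAddCommGroup E] [NormedSpace ℝ E]
    {τ p : E →L[ℝ] ℝ} {v : E} {q C : ℝ} (hC : 0 ≤ C) (hτ : ‖τ‖ ≤ 1) (hp : ‖p‖ ≤ C) (hv : ‖v‖ ≤ C)
    (hq : |q| ≤ C) :
    ‖τ.smulRight p + (q • τ + p.comp (ContinuousLinearMap.id ℝ E - τ.smulRight v)).smulRight τ‖ ≤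
      C ^ 2 + 3 * C := by
  have hτv : ∀ u, |τ u| ≤ ‖u‖ := fun u =>
    (τ.le_opNorm u).trans (by nlinarith [norm_nonneg u])
  have hpu : ∀ u, |p u| ≤ C * ‖u‖ := fun u => (p.le_opNorm u).trans (by gcongr)
  refine ContinuousLinearMap.opNorm_le_bound _ (by positivity) fun u => ?_
  refine ContinuousLinearMap.opNorm_le_bound _ (by positivity) fun u' => ?_
  have h1 : |p (u - τ u • v)| ≤ C * ((1 + C) * ‖u‖) := by
    have h2 : ‖u - τ u • v‖ ≤ (1 + C) * ‖u‖ := by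
      refine (norm_sub_le _ _).trans ?_
      rw [norm_smul]
      have : ‖τ u‖ * ‖v‖ ≤ ‖u‖ * C := mul_le_mul (hτv u) hv (norm_nonneg _) (norm_nonneg _)
      linarith
    exact (hpu _).trans (by gcongr)
  change |τ u * p u' + (q * τ u + p (u - τ u • v)) * τ u'| ≤ _
  calc _ ≤ |τ u * p u'| + |(q * τ u + p (u - τ u • v)) * τ u'| := abs_add_le _ _
    _ ≤ ‖u‖ * (C * ‖u'‖) + (C * ‖u‖ + C * ((1 + C) * ‖u‖)) * ‖u'‖ := by
        rw [abs_mul, abs_mul]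
        gcongr
        · exact hτv u
        · exact hpu u'
        · refine (abs_add_le _ _).trans (add_le_add ?_ h1)
          rw [abs_mul]
          gcongr
          exact hτv u
        · exact hτv u'
    _ = (C ^ 2 + 3 * C) * ‖u‖ * ‖u'‖ := by ring

variable {η : ℝ → ℝ} {β : EuclideanSpace ℝ (Fin n) → ℝ} {ℓ Cb a lam K : ℝ}
  {x : EuclideanSpace ℝ (Fin n)}

set_option maxHeartbeats 1000000 in
/-- In the tube of radius `lam^(-1/2)`, the wave attached to a trajectory solves the Helmholtz
equation up to `O(lam)`. The constant depends on the bounds `C` and `Cb` only, and not on the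
trajectory. -/
theorem abs_divForm_rayMode_add_le (h : IsRay ρ A Ω τ t₀ T ε C γ) (hΩ : IsOpen Ω)
    (hρ : ContDiffOn ℝ ∞ ρ Ω) (hρ0 : ∀ y ∈ Ω, 0 < ρ y)
    (hA : ∀ i j, ContDiffOn ℝ ∞ (fun y => A y i j) Ω) (hsymm : ∀ y ∈ Ω, ∀ i j, A y i j = A y j i)
    (hτ : ‖τ‖ ≤ 1) (hε : 0 < ε) (hC : 1 ≤ C) (hℓT : ℓ < T) (hη : IsCutoff η ℓ Cb)
    (hβ : IsCutoff β 1 Cb) (hCb : 1 ≤ Cb) (ha : 5 * (n ^ 2 + n + 1) * (C ^ 3 * Cb ^ 2) ≤ a)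
    (hlam : 1 ≤ lam) (hlamε : 1 < √lam * ε) (hK0 : 0 ≤ K)
    (hKH : K ^ 2 * cobilin A (γ 0).1 (γ 0).2 (γ 0).2 = lam ^ 2) (θ : ℝ)
    (hx : x ∈ rayTube τ t₀ (rayCurve γ) ℓ (√lam)⁻¹) :
    |divForm ρ A (rayMode A τ t₀ γ η β lam K θ) x + lam ^ 2 * rayMode A τ t₀ γ η β lam K θ x| ≤
      (4 * a + 6 * a ^ 2) * lam := by
  obtain ⟨hx1, hx2⟩ := hx
  have hlam0 : 0 < lam := by linarith
  have hr0 : 0 < √lam := Real.sqrt_pos.2 hlam0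
  have hr2 : √lam ^ 2 = lam := Real.sq_sqrt hlam0.le
  have hr1 : 1 ≤ √lam := Real.one_le_sqrt.2 hlam
  have hrl : √lam ≤ lam := by nlinarith
  have hs : τ x - t₀ ∈ Ioo (-T) T :=
    ⟨by linarith [(abs_le.1 hx1).1], by linarith [(abs_le.1 hx1).2]⟩
  set s := τ x - t₀ with hs_def
  set w := rayOffset τ t₀ (rayCurve γ) x with hw_def
  -- displacements in the tube are at most `lam^(-1/2)`
  have hwr : √lam * ‖w‖ ≤ 1 := by
    calc √lam * ‖w‖ ≤ √lam * (√lam)⁻¹ := by gcongr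
      _ = 1 := mul_inv_cancel₀ hr0.ne'
  have hw1 : ‖w‖ ≤ 1 := hx2.trans (inv_le_one_of_one_le₀ hr1)
  have hwε : w ∈ Metric.ball (0 : EuclideanSpace ℝ (Fin n)) ε := by
    rw [mem_ball_zero_iff]
    by_contra hcon
    push Not at hcon
    nlinarith
  have hxw : (γ s).1 + w = x := by simp [hw_def, rayOffset, hs_def]
  have hb := h.bounds s hs w hwε
  have hb0 := h.bounds_zero hε hs
  have hxΩ : x ∈ Ω := hxw ▸ hb.mem
  have hcoef : ∀ i j, |A x i j| ≤ C := fun i j => by simpa only [hxw] using hb.abs_coeff i j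
  have hdrift : ∀ j, |driftCoeff ρ A x j| ≤ C := fun j => by simpa only [hxw] using hb.abs_drift j
  have hF1 : ‖(hamField A τ (γ s)).1‖ ≤ C := (norm_fst_le _).trans hb.norm_field
  have hF2 : ‖(hamField A τ (γ s)).2‖ ≤ C := (norm_snd_le _).trans hb.norm_field
  have hG1 := (norm_fst_le _).trans hb.norm_field_deriv
  have hG2 := (norm_snd_le _).trans hb.norm_field_deriv
  -- the jets of the three factors
  obtain ⟨ξf, Bf, hf, hξf, hBf⟩ := exists_hasJet_heightCutoff hη hτ t₀ x
  obtain ⟨Bg, hg, hBg⟩ := exists_hasJet_rayCutoff (β := β) hβ.contDiff (by linarith : 0 ≤ C)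
    hβ.norm_fderiv hβ.norm_fderiv_fderiv hτ (fun s hs => h.hasDerivAt_fst hs)
    (fun s hs => h.hasDerivAt_field_fst hΩ hA hε hs) hs hF1 hG1 hr0.le
  have hψ := hasJet_rayPhase (fun s hs => h.hasDerivAt_fst hs) (h.continuousOn_velocity hΩ hA hε)
    (fun s hs => h.hasDerivAt_snd hs) (fun s hs => h.hasDerivAt_field_snd hΩ hA hε hs) hs
  rw [← hs_def, ← hw_def] at hψ hg
  set ξ := (γ s).2 + (hamField A τ (γ s)).2 w • τ with hξ_def
  have hphase : phaseCovector A τ (γ s) w = ξ := rfl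
  set ξg := √lam • (fderiv ℝ β (√lam • w)).comp (ContinuousLinearMap.id ℝ _ -
    τ.smulRight (hamField A τ (γ s)).1) with hξg_def
  have hproj := norm_id_sub_smulRight_le hτ hF1
  have hξg : ‖ξg‖ ≤ √lam * (Cb * (1 + C)) := by
    rw [hξg_def, norm_smul, Real.norm_of_nonneg hr0.le]
    gcongr
    exact (ContinuousLinearMap.opNorm_comp_le _ _).trans
      (mul_le_mul (hβ.norm_fderiv _) hproj (norm_nonneg _) (by linarith))
  have hPw : ∀ L : EuclideanSpace ℝ (Fin n) →L[ℝ] ℝ, ‖L‖ ≤ C → ‖L w • τ‖ ≤ C := by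
    intro L hL
    rw [norm_smul]
    calc ‖L w‖ * ‖τ‖ ≤ (C * 1) * 1 := by
          gcongr
          exact (L.le_opNorm w).trans (by gcongr)
      _ = C := by ring
  have hξ : ‖ξ‖ ≤ 2 * C := by
    refine (norm_add_le _ _).trans ?_
    linarith [hb.norm_covector, hPw _ hF2]
  -- `q` dominates all monomials in `C` and `Cb` that arise below
  have hn : (0 : ℝ) ≤ n := Nat.cast_nonneg n
  set q := C ^ 3 * Cb ^ 2 with hq
  have hC0 : 0 ≤ C := by linarith
  have hCb0 : 0 ≤ Cb := by linarith
  have hCsq : C ≤ C ^ 2 := le_self_pow₀ hC two_ne_zero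
  have hC23 : C ^ 2 ≤ C ^ 3 := pow_le_pow_right₀ hC (by norm_num)
  have hCbsq : Cb ≤ Cb ^ 2 := le_self_pow₀ hCb two_ne_zero
  have hCb1 : 1 ≤ Cb ^ 2 := one_le_pow₀ hCb
  have m0 : C ^ 3 ≤ q := le_mul_of_one_le_right (by positivity) hCb1
  have m1 : C ^ 3 * Cb ≤ q := mul_le_mul_of_nonneg_left hCbsq (by positivity)
  have m2 : C ^ 2 * Cb ≤ q := (mul_le_mul_of_nonneg_right hC23 hCb0).trans m1
  have m3 : C * Cb ≤ q := (mul_le_mul_of_nonneg_right hCsq hCb0).trans m2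
  have m4 : C ^ 2 * Cb ^ 2 ≤ q := mul_le_mul_of_nonneg_right hC23 (by positivity)
  have m5 : C ^ 2 ≤ q := hC23.trans m0
  have m6 : C ≤ q := hCsq.trans m5
  have hq0 : 0 ≤ q := by positivity
  have hnq : 0 ≤ n * q := by positivity
  have hn2q : 0 ≤ n ^ 2 * q := by positivity
  have ha' : 5 * (n ^ 2 * q) + 5 * (n * q) + 5 * q ≤ a := by linarith
  have ha0 : 0 ≤ a := by linarith
  have hal : (5 * (n ^ 2 * q) + 5 * (n * q) + 5 * q) * lam ≤ a * lam := by gcongr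
  have h1a : a ≤ a * lam := le_mul_of_one_le_right ha0 hlam
  have hKC : K ^ 2 ≤ C * lam ^ 2 := by
    have hHC : C⁻¹ ≤ cobilin A (γ 0).1 (γ 0).2 (γ 0).2 := by
      rw [← h.symbol_eq hΩ hA hsymm hε hs]; exact hb.le_symbol
    have h1 : K ^ 2 * C⁻¹ ≤ lam ^ 2 := by
      rw [← hKH]; gcongr
    calc K ^ 2 = C * (K ^ 2 * C⁻¹) := by field_simp
      _ ≤ C * lam ^ 2 := by gcongr
  have hfun : rayMode A τ t₀ γ η β lam K θ = fun x => η (τ x - t₀) *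
    β (√lam • rayOffset τ t₀ (rayCurve γ) x) *
    Real.cos (K * rayPhase τ t₀ (rayCurve γ) (fun s => (hamField A τ (γ s)).1)
      (fun s => (γ s).2) x + θ) := rfl
  rw [hfun]
  refine abs_divForm_mul_cos_add_le (H := cobilin A (γ 0).1 (γ 0).2 (γ 0).2) θ hf hg hψ
    ((hρ.contDiffAt (hΩ.mem_nhds hxΩ)).differentiableAt (by simp)) (hρ0 x hxΩ).ne'
    (fun i j => ((hA i j).contDiffAt (hΩ.mem_nhds hxΩ)).differentiableAt (by simp)) (hsymm x hxΩ)
    ?_ ?_ ha0 hlam0 ?_ ?_ ?_ ?_ ?_ ?_ ?_ hKH hK0 ?_ ?_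
  · rw [abs_of_nonneg (hη.nonneg _)]; exact hη.le_one _
  · rw [abs_of_nonneg (hβ.nonneg _)]; exact hβ.le_one _
  · calc _ ≤ n ^ 2 * C * ‖Bf‖ + n * C * ‖ξf‖ := abs_jetOp_le hcoef hdrift
      _ ≤ n ^ 2 * C * Cb + n * C * Cb := by gcongr
      _ = n ^ 2 * (C * Cb) + n * (C * Cb) := by ring
      _ ≤ n ^ 2 * q + n * q := by gcongr
      _ ≤ a * lam := by linarith
  · have hBg' : ‖Bg‖ ≤ 5 * (C ^ 2 * Cb) * lam := by
      calc ‖Bg‖ ≤ √lam ^ 2 * (Cb * (1 + C) ^ 2) + √lam * (Cb * C) := hBg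
        _ ≤ lam * (Cb * (C + C) ^ 2) + lam * (Cb * C ^ 2) := by
            rw [hr2]; gcongr
        _ = _ := by ring
    have hξg' : ‖ξg‖ ≤ 2 * (C * Cb) * lam := by
      calc ‖ξg‖ ≤ √lam * (Cb * (1 + C)) := hξg
        _ ≤ lam * (Cb * (C + C)) := by gcongr
        _ = _ := by ring
    calc _ ≤ n ^ 2 * C * ‖Bg‖ + n * C * ‖ξg‖ := abs_jetOp_le hcoef hdrift
      _ ≤ n ^ 2 * C * (5 * (C ^ 2 * Cb) * lam) + n * C * (2 * (C * Cb) * lam) := by gcongr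
      _ = (5 * (n ^ 2 * (C ^ 3 * Cb)) + 2 * (n * (C ^ 2 * Cb))) * lam := by ring
      _ ≤ (5 * (n ^ 2 * q) + 2 * (n * q)) * lam := by gcongr
      _ ≤ (5 * (n ^ 2 * q) + 5 * (n * q) + 5 * q) * lam := by gcongr ?_ * lam; linarith
      _ ≤ a * lam := hal
  · calc _ ≤ n ^ 2 * C * ‖ξf‖ * ‖ξg‖ := abs_cobilin_le hcoef
      _ ≤ n ^ 2 * C * Cb * (lam * (Cb * (C + C))) := by
          gcongr
          exact hξg.trans (by gcongr)
      _ = 2 * (n ^ 2 * (C ^ 2 * Cb ^ 2)) * lam := by ring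
      _ ≤ 2 * (n ^ 2 * q) * lam := by gcongr
      _ ≤ (5 * (n ^ 2 * q) + 5 * (n * q) + 5 * q) * lam := by gcongr ?_ * lam; linarith
      _ ≤ a * lam := hal
  · have hG2w : |(fderiv ℝ (hamField A τ) (γ s) (hamField A τ (γ s))).2 w| ≤ C :=
      (ContinuousLinearMap.le_opNorm _ w).trans
        ((mul_le_mul hG2 hw1 (norm_nonneg _) hC0).trans (mul_one C).le)
    have hB : ‖τ.smulRight (hamField A τ (γ s)).2 +
        ((fderiv ℝ (hamField A τ) (γ s) (hamField A τ (γ s))).2 w • τ +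
          (hamField A τ (γ s)).2.comp (ContinuousLinearMap.id ℝ _ -
            τ.smulRight (hamField A τ (γ s)).1)).smulRight τ‖ ≤ C ^ 2 + 3 * C :=
      norm_phaseHessian_le hC0 hτ hF2 hF1 hG2w
    calc _ ≤ n ^ 2 * C * (C ^ 2 + 3 * C) + n * C * (2 * C) :=
          (abs_jetOp_le hcoef hdrift).trans (by gcongr)
      _ = n ^ 2 * (3 * C ^ 2 + C ^ 3) + n * (2 * C ^ 2) := by ring
      _ ≤ n ^ 2 * (3 * q + q) + n * (2 * q) := by gcongr
      _ ≤ a := by linarith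
  · calc _ ≤ n ^ 2 * C * ‖ξf‖ * ‖ξ‖ := abs_cobilin_le hcoef
      _ ≤ n ^ 2 * C * Cb * (2 * C) := by gcongr
      _ = 2 * (n ^ 2 * (C ^ 2 * Cb)) := by ring
      _ ≤ 2 * (n ^ 2 * q) := by gcongr
      _ ≤ a := by linarith
  · -- the cutoff varies slowly along the ray
    have hvel := hb.norm_velocity
    rw [hxw, hphase] at hvel
    rw [← apply_sharp, hξg_def]
    have h7 : (√lam • (fderiv ℝ β (√lam • w)).comp (ContinuousLinearMap.id ℝ _ -
        τ.smulRight (hamField A τ (γ s)).1)) (sharp A x ξ) = √lam * fderiv ℝ β (√lam • w)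
          (sharp A x ξ - τ (sharp A x ξ) • (hamField A τ (γ s)).1) := rfl
    rw [h7, abs_mul, abs_of_pos hr0]
    have h8 : |fderiv ℝ β (√lam • w) (sharp A x ξ - τ (sharp A x ξ) • (hamField A τ (γ s)).1)| ≤
        Cb * (C * ‖w‖) :=
      (ContinuousLinearMap.le_opNorm _ _).trans
        (mul_le_mul (hβ.norm_fderiv _) hvel (norm_nonneg _) hCb0)
    calc _ ≤ √lam * (Cb * (C * ‖w‖)) := by gcongr
      _ = C * Cb * (√lam * ‖w‖) := by ring
      _ ≤ C * Cb * 1 := by gcongr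
      _ ≤ a := by linarith
  · -- the eikonal defect is `O(‖w‖²)`, hence `O(lam⁻¹)`
    have heik := hb.abs_eikonal
    rw [hxw, hphase, h.symbol_eq hΩ hA hsymm hε hs] at heik
    refine heik.trans ?_
    rw [le_div_iff₀ hlam0]
    calc C * ‖w‖ ^ 2 * lam = C * (√lam * ‖w‖) ^ 2 := by rw [mul_pow, hr2]; ring
      _ ≤ C * 1 ^ 2 := by gcongr
      _ ≤ a := by linarith
  · refine le_of_sq_le_sq (hKC.trans ?_) (by positivity)
    rw [mul_pow]
    gcongr
    nlinarith
  · exact hKC.trans (by gcongr; linarith)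

end Ray

/-! ### Norms of the approximate eigenfunctions -/

section RayNorm

variable {n : ℕ} {ρ : EuclideanSpace ℝ (Fin n) → ℝ}
  {A : EuclideanSpace ℝ (Fin n) → Matrix (Fin n) (Fin n) ℝ} {Ω : Set (EuclideanSpace ℝ (Fin n))}
  {τ : EuclideanSpace ℝ (Fin n) →L[ℝ] ℝ} {t₀ T ε C s : ℝ}
  {γ : ℝ → PhaseSpace n}
  {η : ℝ → ℝ} {β : EuclideanSpace ℝ (Fin n) → ℝ} {ℓ Cb a lam K θ : ℝ}
  {x : EuclideanSpace ℝ (Fin n)}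

theorem IsRay.height_mem (hℓT : ℓ < T) {r : ℝ} (hx : x ∈ rayTube τ t₀ (rayCurve γ) ℓ r) :
    τ x - t₀ ∈ Ioo (-T) T :=
  ⟨by linarith [(abs_le.1 hx.1).1], by linarith [(abs_le.1 hx.1).2]⟩

theorem IsRay.localBounds (h : IsRay ρ A Ω τ t₀ T ε C γ) (hℓT : ℓ < T) {r : ℝ} (hr : r < ε)
    (hx : x ∈ rayTube τ t₀ (rayCurve γ) ℓ r) :
    x ∈ Ω ∧ ρ x ≤ C ∧ C⁻¹ ≤ ρ x := by
  have hb := h.bounds _ (IsRay.height_mem hℓT hx) (rayOffset τ t₀ (rayCurve γ) x)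
    (by rw [mem_ball_zero_iff]; exact hx.2.trans_lt hr)
  have hxw : (γ (τ x - t₀)).1 + rayOffset τ t₀ (rayCurve γ) x = x := by simp [rayOffset]
  have h1 := hb.mem
  have h2 := hb.density_le
  have h3 := hb.le_density
  rw [hxw] at h1 h2 h3
  exact ⟨h1, h2, h3⟩

theorem IsRay.isCompact_tube (h : IsRay ρ A Ω τ t₀ T ε C γ) (hℓT : ℓ < T) (r : ℝ) :
    IsCompact (rayTube τ t₀ (rayCurve γ) ℓ r) :=
  isCompact_rayTube fun _ hs =>
    (h.hasDerivAt_fst ⟨by linarith [hs.1], by linarith [hs.2]⟩).continuousAt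

theorem support_rayMode_subset (hη : IsCutoff η ℓ Cb) (hβ : IsCutoff β 1 Cb) (hlam : 0 < lam) :
    Function.support (rayMode A τ t₀ γ η β lam K θ) ⊆ rayTube τ t₀ (rayCurve γ) ℓ (√lam)⁻¹ := by
  intro x hx
  have hr0 : 0 < √lam := Real.sqrt_pos.2 hlam
  rw [Function.mem_support, rayMode] at hx
  refine ⟨?_, ?_⟩
  · by_contra hcon
    push Not at hcon
    exact hx (by rw [hη.eq_zero _ hcon.le]; ring)
  · by_contra hcon
    push Not at hcon
    refine hx ?_
    rw [hβ.eq_zero]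
    · ring
    · rw [norm_smul, Real.norm_of_nonneg hr0.le]
      calc (1 : ℝ) = √lam * (√lam)⁻¹ := (mul_inv_cancel₀ hr0.ne').symm
        _ ≤ _ := by gcongr

theorem contDiffAt_rayPhase {E : Type*} [NormedAddCommGroup E] [NormedSpace ℝ E]
    {τ : E →L[ℝ] ℝ} {t₀ T : ℝ} {X V : ℝ → E} {Ξ P : ℝ → E →L[ℝ] ℝ} {x : E}
    (hX : ∀ s ∈ Ioo (-T) T, HasDerivAt X (V s) s)
    (hV : ContinuousOn V (Ioo (-T) T)) (hΞ : ∀ s ∈ Ioo (-T) T, HasDerivAt Ξ (P s) s)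
    (hx : τ x - t₀ ∈ Ioo (-T) T) (hX1 : ContDiffAt ℝ 1 X (τ x - t₀))
    (hΞ1 : ContDiffAt ℝ 1 Ξ (τ x - t₀)) (hP1 : ContDiffAt ℝ 1 P (τ x - t₀)) :
    ContDiffAt ℝ 2 (rayPhase τ t₀ X V Ξ) x := by
  have h2 : (2 : WithTop ℕ∞) = ((1 : ℕ) : WithTop ℕ∞) + 1 := by norm_num
  have hσ : ContDiffAt ℝ 1 (fun x : E => τ x - t₀) x := contDiffAt_height
  have h3 : ContDiffAt ℝ 1 (fun x : E => Ξ (τ x - t₀)) x := hΞ1.comp x hσ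
  have h4 : ContDiffAt ℝ 1 (fun x : E => P (τ x - t₀)) x := hP1.comp x hσ
  have h5 : ContDiffAt ℝ 1 (fun x : E => P (τ x - t₀) (rayOffset τ t₀ X x)) x :=
    h4.clm_apply (contDiffAt_rayOffset hX1)
  have h6 : ContDiffAt ℝ 1 (fun x : E => P (τ x - t₀) (rayOffset τ t₀ X x) • τ) x :=
    h5.smul contDiffAt_const
  rw [h2, contDiffAt_succ_iff_hasFDerivAt]
  exact ⟨_, ⟨_, eventually_height_mem hx, fun y hy => hasFDerivAt_rayPhase hX hV hΞ hy⟩, h3.add h6⟩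

theorem IsRay.contDiffAt_rayPhase (h : IsRay ρ A Ω τ t₀ T ε C γ) (hΩ : IsOpen Ω)
    (hA : ∀ i j, ContDiffOn ℝ ∞ (fun y => A y i j) Ω) (hε : 0 < ε)
    (hx : τ x - t₀ ∈ Ioo (-T) T) :
    ContDiffAt ℝ 2 (rayPhase τ t₀ (rayCurve γ) (fun s => (hamField A τ (γ s)).1)
      (fun s => (γ s).2)) x := by
  have hγ : ContDiffAt ℝ 1 γ (τ x - t₀) :=
    ((h.contDiffOn hΩ hA hε).2.contDiffAt (isOpen_Ioo.mem_nhds hx)).of_le (by norm_num)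
  have hF := (h.contDiffOn hΩ hA hε).1.contDiffAt (isOpen_Ioo.mem_nhds hx)
  exact EigenPeriod.contDiffAt_rayPhase (fun s hs => h.hasDerivAt_fst hs)
    (h.continuousOn_velocity hΩ hA hε) (fun s hs => h.hasDerivAt_snd hs) hx hγ.fst hγ.snd hF.snd

/-- A real function compactly supported in `Ω` that solves the equation
`divForm ρ A u + lam² u = 0` up to an error of size `κ`, in mean square for the measure `ρ dy`. -/
structure IsQuasimode (ρ : EuclideanSpace ℝ (Fin n) → ℝ)
    (A : EuclideanSpace ℝ (Fin n) → Matrix (Fin n) (Fin n) ℝ)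
    (Ω : Set (EuclideanSpace ℝ (Fin n))) (lam κ : ℝ) (u : EuclideanSpace ℝ (Fin n) → ℝ) :
    Prop where
  contDiff : ContDiff ℝ 2 u
  hasCompactSupport : HasCompactSupport u
  tsupport_subset : tsupport u ⊆ Ω
  integral_pos : 0 < ∫ y, ρ y * u y ^ 2
  integral_le : ∫ y, ρ y * (divForm ρ A u y + lam ^ 2 * u y) ^ 2 ≤ κ ^ 2 * ∫ y, ρ y * u y ^ 2

theorem IsRay.contDiff_rayMode (h : IsRay ρ A Ω τ t₀ T ε C γ) (hΩ : IsOpen Ω)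
    (hA : ∀ i j, ContDiffOn ℝ ∞ (fun y => A y i j) Ω) (hε : 0 < ε) (hℓT : ℓ < T)
    (hη : IsCutoff η ℓ Cb) (hβ : IsCutoff β 1 Cb)
    (hsupp : tsupport (rayMode A τ t₀ γ η β lam K θ) ⊆ rayTube τ t₀ (rayCurve γ) ℓ (√lam)⁻¹) :
    ContDiff ℝ 2 (rayMode A τ t₀ γ η β lam K θ) := by
  refine contDiff_of_contDiffAt_tsupport fun x hx => ?_
  have hs := IsRay.height_mem hℓT (hsupp hx)
  have hγ := (h.contDiffOn hΩ hA hε).2.contDiffAt (isOpen_Ioo.mem_nhds hs)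
  refine ((hη.contDiff.contDiffAt.comp x contDiffAt_height).mul
    (hβ.contDiff.contDiffAt.comp x ?_)).mul (Real.contDiff_cos.contDiffAt.comp x ?_)
  · exact (contDiffAt_rayOffset hγ.fst).const_smul √lam
  · exact (contDiffAt_const.mul (h.contDiffAt_rayPhase hΩ hA hε hs)).add contDiffAt_const

set_option maxHeartbeats 1000000 in
/-- One of the two phase shifts `0` and `π / 2` gives an approximate eigenfunction whose norm is
not small compared with that of its amplitude. -/
theorem IsRay.exists_isQuasimode (h : IsRay ρ A Ω τ t₀ T ε C γ) (hΩ : IsOpen Ω)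
    (hρ : ContDiffOn ℝ ∞ ρ Ω) (hρ0 : ∀ y ∈ Ω, 0 < ρ y)
    (hA : ∀ i j, ContDiffOn ℝ ∞ (fun y => A y i j) Ω) (hsymm : ∀ y ∈ Ω, ∀ i j, A y i j = A y j i)
    (hτ : ‖τ‖ ≤ 1) (hε : 0 < ε) (hC : 1 ≤ C) (hℓ : 0 < ℓ) (hℓT : ℓ < T) (hη : IsCutoff η ℓ Cb)
    (hβ : IsCutoff β 1 Cb) (hCb : 1 ≤ Cb) (ha : 5 * (n ^ 2 + n + 1) * (C ^ 3 * Cb ^ 2) ≤ a)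
    (hlam : 1 ≤ lam) (hlamε : 1 < √lam * ε) :
    ∃ u, IsQuasimode ρ A Ω lam (2 ^ (n + 1) * C * (4 * a + 6 * a ^ 2) * lam) u ∧
      tsupport u ⊆ rayTube τ t₀ (rayCurve γ) ℓ (√lam)⁻¹ := by
  have hlam0 : 0 < lam := by linarith
  have hr0 : 0 < √lam := Real.sqrt_pos.2 hlam0
  have hC0 : 0 < C := by linarith
  have hT : (0 : ℝ) ∈ Ioo (-T) T := ⟨by linarith, by linarith⟩
  have hrε : (√lam)⁻¹ < ε := by rwa [inv_lt_iff_one_lt_mul₀' hr0]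
  set W := rayTube τ t₀ (rayCurve γ) ℓ (√lam)⁻¹ with hW
  set V := rayTube τ t₀ (rayCurve γ) (ℓ / 2) ((√lam)⁻¹ / 2) with hV
  have hWc : IsCompact W := h.isCompact_tube hℓT _
  have hVc : IsCompact V := h.isCompact_tube (by linarith) _
  have hVW : V ⊆ W := fun x hx => ⟨by linarith [hx.1], by
    have : 0 < (√lam)⁻¹ := by positivity
    linarith [hx.2]⟩
  have hWΩ : W ⊆ Ω := fun x hx => (h.localBounds hℓT hrε hx).1
  have hWm := hWc.measurableSet
  -- the frequency in the phase normalizes the constant value of the symbol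
  set H := cobilin A (γ 0).1 (γ 0).2 (γ 0).2 with hH
  have hHpos : 0 < H := lt_of_lt_of_le (by positivity) (h.bounds_zero hε hT).le_symbol
  set K := lam / √H with hK
  have hK0 : 0 ≤ K := by positivity
  have hKH : K ^ 2 * H = lam ^ 2 := by
    rw [hK, div_pow, Real.sq_sqrt hHpos.le]
    field_simp
  set u : ℝ → EuclideanSpace ℝ (Fin n) → ℝ := fun θ => rayMode A τ t₀ γ η β lam K θ with hu
  have hsub : ∀ θ, tsupport (u θ) ⊆ W := fun θ =>
    closure_minimal (support_rayMode_subset hη hβ hlam0) hWc.isClosed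
  have huC : ∀ θ, ContDiff ℝ 2 (u θ) := fun θ => h.contDiff_rayMode hΩ hA hε hℓT hη hβ (hsub θ)
  have hu0 : ∀ θ, ∀ x ∉ W, u θ x = 0 := fun θ x hx =>
    image_eq_zero_of_notMem_tsupport fun hx' => hx (hsub θ hx')
  set b := (4 * a + 6 * a ^ 2) * lam with hb
  have hint : ∀ θ, IntegrableOn (fun x => ρ x * u θ x ^ 2) W := fun θ =>
    ((hρ.continuousOn.mono hWΩ).mul ((huC θ).continuous.continuousOn.pow 2)).integrableOn_compact
    hWc
  -- the error
  have hupper : ∀ θ, ∫ y, ρ y * (divForm ρ A (u θ) y + lam ^ 2 * u θ y) ^ 2 ≤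
      C * b ^ 2 * volume.real W := by
    intro θ
    have hz : ∀ y ∉ W, ρ y * (divForm ρ A (u θ) y + lam ^ 2 * u θ y) ^ 2 = 0 := fun y hy => by
      rw [divForm_eq_zero_of_notMem_tsupport fun h' => hy (hsub θ h'), hu0 θ y hy]
      ring
    rw [← setIntegral_eq_integral_of_forall_compl_eq_zero hz]
    refine (Real.le_norm_self _).trans (norm_setIntegral_le_of_norm_le_const hWc.measure_lt_top
      fun x hx => ?_)
    have h1 := abs_divForm_rayMode_add_le h hΩ hρ hρ0 hA hsymm hτ hε hC hℓT hη hβ hCb ha hlam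
      hlamε hK0 hKH θ hx
    have h2 := (h.localBounds hℓT hrε hx).2.1
    have h3 := hρ0 x (hWΩ hx)
    rw [norm_mul, norm_pow, Real.norm_eq_abs, Real.norm_eq_abs, abs_of_pos h3]
    exact mul_le_mul h2 (pow_le_pow_left₀ (abs_nonneg _) h1 2) (by positivity) hC0.le
  -- the squares of the two waves add up to the square of the amplitude
  have hset : ∀ θ, ∫ y, ρ y * u θ y ^ 2 = ∫ y in W, ρ y * u θ y ^ 2 := fun θ =>
    (setIntegral_eq_integral_of_forall_compl_eq_zero fun y hy => by rw [hu0 θ y hy]; ring).symm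
  have hlower : C⁻¹ * volume.real V ≤
      (∫ y, ρ y * u 0 y ^ 2) + ∫ y, ρ y * u (Real.pi / 2) y ^ 2 := by
    rw [hset, hset, ← integral_add (hint _) (hint _)]
    have h1 : ∀ x ∈ V, C⁻¹ ≤ ρ x * u 0 x ^ 2 + ρ x * u (Real.pi / 2) x ^ 2 := by
      intro x hx
      have h2 : η (τ x - t₀) = 1 := hη.eq_one _ hx.1
      have h3 : β (√lam • rayOffset τ t₀ (rayCurve γ) x) = 1 := by
        refine hβ.eq_one _ ?_
        rw [norm_smul, Real.norm_of_nonneg hr0.le]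
        calc √lam * _ ≤ √lam * ((√lam)⁻¹ / 2) := by gcongr; exact hx.2
          _ = 1 / 2 := by field_simp
      have h4 := (h.localBounds hℓT hrε (hVW hx)).2.2
      refine h4.trans (le_of_eq ?_)
      simp only [hu, rayMode, h2, h3, Real.cos_add_pi_div_two, add_zero, one_mul, neg_sq]
      rw [← mul_add, add_comm (Real.cos _ ^ 2), Real.sin_sq_add_cos_sq, mul_one]
    have h5 : IntegrableOn (fun x => ρ x * u 0 x ^ 2 + ρ x * u (Real.pi / 2) x ^ 2) W :=
      (hint _).add (hint _)
    calc C⁻¹ * volume.real V = ∫ _ in V, C⁻¹ := by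
          rw [setIntegral_const, smul_eq_mul, mul_comm]
      _ ≤ ∫ x in V, ρ x * u 0 x ^ 2 + ρ x * u (Real.pi / 2) x ^ 2 :=
          setIntegral_mono_on (integrableOn_const hVc.measure_lt_top.ne) (h5.mono_set hVW)
            hVc.measurableSet h1
      _ ≤ ∫ x in W, ρ x * u 0 x ^ 2 + ρ x * u (Real.pi / 2) x ^ 2 := by
          refine setIntegral_mono_set h5 ?_ hVW.eventuallyLE
          filter_upwards [ae_restrict_mem hWm] with x hx
          have := hρ0 x (hWΩ hx)
          simp only [Pi.zero_apply]
          positivity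
  have hvol : volume.real W ≤ 2 ^ n * volume.real V := by
    have h1 := volume_rayTube_le (τ := τ) (t₀ := t₀) (ℓ := ℓ) (r := (√lam)⁻¹) volume hℓT
      (fun s hs => h.hasDerivAt_fst hs) (fun s hs => h.apply_fst hε hs)
      (fun s hs => apply_hamField_fst (h.bounds_zero hε hs).transversal)
    rw [finrank_euclideanSpace_fin] at h1
    have h2 := ENNReal.toReal_mono
      (ENNReal.mul_ne_top ENNReal.ofReal_ne_top hVc.measure_lt_top.ne) h1
    rwa [ENNReal.toReal_mul, ENNReal.toReal_ofReal (by positivity)] at h2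
  have hVpos : 0 < volume.real V := by
    refine ENNReal.toReal_pos (Measure.measure_pos_of_mem_nhds volume
        (rayTube_mem_nhds (by positivity)
      (by positivity) (h.hasDerivAt_fst hT).continuousAt h.start)).ne' hVc.measure_lt_top.ne
  -- the sum of the two norms is not small, so one of them is not
  obtain ⟨θ, hθ⟩ : ∃ θ, C⁻¹ * volume.real V / 2 ≤ ∫ y, ρ y * u θ y ^ 2 := by
    by_contra! hcon
    linarith [hcon 0, hcon (Real.pi / 2)]
  refine ⟨u θ, ⟨huC θ, hWc.of_isClosed_subset (isClosed_tsupport _) (hsub θ), (hsub θ).trans hWΩ,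
    lt_of_lt_of_le (by positivity) hθ, (hupper θ).trans ?_⟩, hsub θ⟩
  have h6 : volume.real V ≤ 2 * C * ∫ y, ρ y * u θ y ^ 2 := by
    calc volume.real V = 2 * C * (C⁻¹ * volume.real V / 2) := by field_simp
      _ ≤ _ := by gcongr
  have hI : 0 ≤ ∫ y, ρ y * u θ y ^ 2 := le_trans (by positivity) hθ
  calc C * b ^ 2 * volume.real W ≤ C * b ^ 2 * (2 ^ n * (2 * C * ∫ y, ρ y * u θ y ^ 2)) := by
        gcongr
        exact hvol.trans (by gcongr)
    _ = 2 ^ (n + 1) * (C ^ 2 * b ^ 2 * ∫ y, ρ y * u θ y ^ 2) := by ring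
    _ ≤ (2 ^ (n + 1)) ^ 2 * (C ^ 2 * b ^ 2 * ∫ y, ρ y * u θ y ^ 2) := by
        gcongr
        exact le_self_pow₀ (one_le_pow₀ one_le_two) two_ne_zero
    _ = _ := by rw [hb]; ring

end RayNorm

/-! ### Disjoint approximate eigenfunctions -/

/-- Two curves that never meet at the same height have, by compactness, disjoint thin tubes. -/
theorem eventually_disjoint_rayTube {E : Type*} [NormedAddCommGroup E] [NormedSpace ℝ E]
    {τ : E →L[ℝ] ℝ} {t₀ ℓ : ℝ} {X Y : ℝ → E} (hℓ : 0 < ℓ)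
    (hX : ∀ s ∈ Icc (-ℓ) ℓ, ContinuousAt X s) (hY : ∀ s ∈ Icc (-ℓ) ℓ, ContinuousAt Y s)
    (hne : ∀ s ∈ Icc (-ℓ) ℓ, X s ≠ Y s) :
    ∀ᶠ r : ℝ in 𝓝 0, Disjoint (rayTube τ t₀ X ℓ r) (rayTube τ t₀ Y ℓ r) := by
  have hc : ContinuousOn (fun s => ‖X s - Y s‖) (Icc (-ℓ) ℓ) := fun s hs =>
    ((hX s hs).sub (hY s hs)).norm.continuousWithinAt
  obtain ⟨s₀, hs₀, hmin⟩ := isCompact_Icc.exists_isMinOn (nonempty_Icc.2 (by linarith)) hc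
  have hpos : 0 < ‖X s₀ - Y s₀‖ := norm_pos_iff.2 (sub_ne_zero.2 (hne s₀ hs₀))
  filter_upwards [gt_mem_nhds (half_pos hpos)] with r hr
  refine Set.disjoint_left.2 fun x hx hy => ?_
  have h1 : ‖X s₀ - Y s₀‖ ≤ ‖X (τ x - t₀) - Y (τ x - t₀)‖ := hmin (abs_le.1 hx.1)
  have h2 : X (τ x - t₀) - Y (τ x - t₀) = rayOffset τ t₀ Y x - rayOffset τ t₀ X x := by
    simp [rayOffset]
  rw [h2] at h1
  linarith [norm_sub_le (rayOffset τ t₀ Y x) (rayOffset τ t₀ X x), hx.2, hy.2]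

/-- An elliptic operator in dimension at least two has, at every sufficiently large frequency
`lam`, any prescribed number of approximate eigenfunctions with disjoint supports and with error
`O(lam)`, uniformly in their number. -/
theorem exists_isQuasimode_disjoint {n : ℕ} (hn : 2 ≤ n) {ρ : EuclideanSpace ℝ (Fin n) → ℝ}
    {A : EuclideanSpace ℝ (Fin n) → Matrix (Fin n) (Fin n) ℝ} {Ω : Set (EuclideanSpace ℝ (Fin n))}
    (hΩ : IsOpen Ω) (hρ : ContDiffOn ℝ ∞ ρ Ω) (hρ0 : ∀ y ∈ Ω, 0 < ρ y)
    (hA : ∀ i j, ContDiffOn ℝ ∞ (fun y => A y i j) Ω) (hsymm : ∀ y ∈ Ω, ∀ i j, A y i j = A y j i)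
    {p₀ : EuclideanSpace ℝ (Fin n)} (hp₀ : p₀ ∈ Ω) (hpos : ∀ i, 0 < A p₀ i i) :
    ∃ κ : ℝ, 0 ≤ κ ∧ ∀ N : ℕ, ∀ᶠ lam : ℝ in atTop, ∃ u : Fin N → EuclideanSpace ℝ (Fin n) → ℝ,
      (∀ j, IsQuasimode ρ A Ω lam (κ * lam) (u j)) ∧
        Pairwise fun i j => Disjoint (tsupport (u i)) (tsupport (u j)) := by
  let i₀ : Fin n := ⟨0, by omega⟩
  let i₁ : Fin n := ⟨1, by omega⟩
  have hi : i₀ ≠ i₁ := by simp [i₀, i₁]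
  set τ : EuclideanSpace ℝ (Fin n) →L[ℝ] ℝ := EuclideanSpace.proj i₀ with hτ_def
  have hτ : ‖τ‖ ≤ 1 := ContinuousLinearMap.opNorm_le_bound _ zero_le_one fun x => by
    rw [one_mul]; exact PiLp.norm_apply_le x i₀
  have hττ : 0 < cobilin A p₀ τ τ := by
    have : cobilin A p₀ τ τ = A p₀ i₀ i₀ := by
      simp [cobilin, hτ_def, PiLp.single_apply]
    rw [this]; exact hpos i₀
  obtain ⟨C, hC, ε, hε, hbounds⟩ := exists_localBounds hΩ hρ hρ0 hA hsymm hp₀ hττ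
  have hF : ContDiffAt ℝ 1 (hamField A τ) (p₀, τ) :=
    (contDiffAt_hamField (z := (p₀, τ)) (fun i j => (hA i j).contDiffAt (hΩ.mem_nhds hp₀))
      hττ.ne').of_le (WithTop.coe_le_coe.2 le_top)
  set v : EuclideanSpace ℝ (Fin n) := EuclideanSpace.single i₁ 1 with hv_def
  have hv : v ≠ 0 := by simp [hv_def]
  have hτv : τ v = 0 := by simp [hτ_def, hv_def, hi]
  obtain ⟨T, hT, δ₀, hδ₀, γ, hγ⟩ := exists_trajectories hF v hv hε
  have hray : ∀ δ : ℝ, |δ| ≤ δ₀ → IsRay ρ A Ω τ (τ p₀) T ε C (γ δ) := fun δ hδ =>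
    ⟨fun s hs => ((hγ δ hδ).2.1 s hs).1, fun s hs w hw => hbounds _ ((hγ δ hδ).2.1 s hs).2 w hw, by
      rw [(hγ δ hδ).1]; simp [hτv]⟩
  have hℓ : 0 < T / 2 := by positivity
  have hℓT : T / 2 < T := by linarith
  obtain ⟨η, C₁, hη⟩ := exists_isCutoff ℝ hℓ
  obtain ⟨β, C₂, hβ⟩ := exists_isCutoff (EuclideanSpace ℝ (Fin n)) one_pos
  set Cb := max 1 (max C₁ C₂) with hCb
  have hη' := hη Cb ((le_max_left _ _).trans (le_max_right _ _))
  have hβ' := hβ Cb ((le_max_right _ _).trans (le_max_right _ _))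
  have hCb1 : 1 ≤ Cb := le_max_left _ _
  set a : ℝ := 5 * (n ^ 2 + n + 1) * (C ^ 3 * Cb ^ 2) with ha
  refine ⟨2 ^ (n + 1) * C * (4 * a + 6 * a ^ 2), by positivity, fun N => ?_⟩
  let δ : Fin N → ℝ := fun j => δ₀ / (j + 1)
  have hδ : ∀ j, |δ j| ≤ δ₀ := fun j => by
    have h1 : (1 : ℝ) ≤ (j : ℝ) + 1 := by linarith [Nat.cast_nonneg (α := ℝ) (j : ℕ)]
    rw [abs_of_pos (by positivity)]
    exact div_le_self hδ₀.le h1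
  have hδne : ∀ i j, i ≠ j → δ i ≠ δ j := fun i j hij heq => by
    have h1 : ((i : ℕ) : ℝ) + 1 = ((j : ℕ) : ℝ) + 1 := by
      have h2 : δ₀ / ((i : ℕ) + 1 : ℝ) = δ₀ / ((j : ℕ) + 1 : ℝ) := heq
      field_simp at h2
      linarith
    exact hij (Fin.ext (by exact_mod_cast add_right_cancel h1))
  have hcont : ∀ j, ∀ s ∈ Icc (-(T / 2)) (T / 2), ContinuousAt (rayCurve (γ (δ j))) s :=
    fun j s hs => ((hray _ (hδ j)).hasDerivAt_fst
      ⟨by linarith [hs.1], by linarith [hs.2]⟩).continuousAt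
  have hsqrt : Tendsto (fun lam : ℝ => √lam) atTop atTop := Real.tendsto_sqrt_atTop
  have hdisj : ∀ᶠ lam : ℝ in atTop, ∀ i j, i ≠ j →
      Disjoint (rayTube τ (τ p₀) (rayCurve (γ (δ i))) (T / 2) (√lam)⁻¹)
        (rayTube τ (τ p₀) (rayCurve (γ (δ j))) (T / 2) (√lam)⁻¹) := by
    refine eventually_all.2 fun i => eventually_all.2 fun j => ?_
    by_cases hij : i = j
    · exact Eventually.of_forall fun _ h => absurd hij h
    · have h1 := eventually_disjoint_rayTube (τ := τ) (t₀ := τ p₀) hℓ (hcont i) (hcont j)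
        fun s hs => (hγ _ (hδ i)).2.2 _ (hδ j) (hδne i j hij) s
          ⟨by linarith [hs.1], by linarith [hs.2]⟩
      exact ((tendsto_inv_atTop_zero.comp hsqrt).eventually h1).mono fun _ h _ => h
  filter_upwards [hdisj, eventually_ge_atTop 1, hsqrt.eventually_gt_atTop ε⁻¹]
    with lam h1 h2 h3
  have h4 : 1 < √lam * ε := by rwa [inv_lt_iff_one_lt_mul₀ hε] at h3
  choose u hu husupp using fun j : Fin N => (hray _ (hδ j)).exists_isQuasimode hΩ hρ hρ0 hA hsymm hτ
    hε hC hℓ hℓT hη' hβ' hCb1 ha.symm.le h2 h4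
  exact ⟨u, hu, fun i j hij => (h1 i j hij).mono (husupp i) (husupp j)⟩

/-! ### The number of frequencies in a window of fixed length -/

theorem integrable_mul_smul_of_tsupport_subset {E F : Type*} [NormedAddCommGroup E]
    [NormedSpace ℝ E] [MeasurableSpace E] [BorelSpace E] {μ : Measure E}
    [IsFiniteMeasureOnCompacts μ] [NormedAddCommGroup F] [NormedSpace ℝ F] {Ω : Set E}
    {ρ w : E → ℝ} {v : E → F} (hρ : ContinuousOn ρ Ω) (hw : Continuous w)
    (hwc : HasCompactSupport w) (hws : tsupport w ⊆ Ω) (hv : ContinuousOn v Ω) :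
    Integrable (fun y => (ρ y * w y) • v y) μ := by
  have h1 : IntegrableOn (fun y => (ρ y * w y) • v y) (tsupport w) μ :=
    (((hρ.mono hws).mul hw.continuousOn).smul (hv.mono hws)).integrableOn_compact hwc
  refine (integrableOn_iff_integrable_of_support_subset fun y hy => ?_).1 h1
  by_contra hcon
  exact hy (by simp [image_eq_zero_of_notMem_tsupport hcon])

section Count

variable {n : ℕ} {M : Type*} [TopologicalSpace M] [T2Space M] [CompactSpace M]
  [ChartedSpace (EuclideanSpace ℝ (Fin n)) M] [IsManifold (𝓡 n) ∞ M] [MeasurableSpace M]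
  [BorelSpace M] {g : Metric n M}

/-- The Laplace operator, applied in a chart to a function with support in this chart, acts on the
coefficients in an eigenbasis as it should. -/
theorem LaplaceEigenbasis.inner_chartLp_helmholtz (Φ : LaplaceEigenbasis g)
    {e : OpenPartialHomeomorph M (EuclideanSpace ℝ (Fin n))}
    (he : e ∈ IsManifold.maximalAtlas (𝓡 n) ∞ M) {u : EuclideanSpace ℝ (Fin n) → ℝ}
    (hu : ContDiff ℝ 2 u) (huc : HasCompactSupport u) (hus : tsupport u ⊆ e.target) (lam : ℝ)
    {w : EuclideanSpace ℝ (Fin n) → ℝ}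
    (hw : w = fun y => divForm (gramDensity g e.symm) (fun z => (gram g e.symm z)⁻¹) u y +
      lam ^ 2 * u y) (hwc : Continuous w) (hwk : HasCompactSupport w)
    (hws : tsupport w ⊆ e.target) (k : ℕ) :
    inner ℂ (Φ.basis k) (chartLp g e hwc hwk) =
      ((lam ^ 2 - Φ.freq k ^ 2 : ℝ) : ℂ) * inner ℂ (Φ.basis k) (chartLp g e hu.continuous huc) := by
  set ρ := gramDensity g e.symm
  set A : EuclideanSpace ℝ (Fin n) → Matrix (Fin n) (Fin n) ℝ := fun z => (gram g e.symm z)⁻¹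
  have hρ := contDiffOn_gramDensity g he
  have hρ0 : ∀ y ∈ e.target, ρ y ≠ 0 := fun y hy => (gramDensity_pos g he hy).ne'
  have hA := contDiffOn_gram_inv g he
  have hsymm : ∀ y ∈ e.target, ∀ i j, A y i j = A y j i := fun y hy i j => by
    have h1 := (posDef_gram g he hy).inv.isHermitian.apply j i
    simpa using h1
  have h1le : (1 : WithTop ℕ∞) ≤ ∞ := WithTop.coe_le_coe.2 le_top
  have hA1 : ∀ i j, ContDiffOn ℝ 1 (fun y => A y i j) e.target := fun i j => (hA i j).of_le h1le
  have hρ1 : ContDiffOn ℝ 1 ρ e.target := hρ.of_le h1le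
  obtain ⟨hsmooth, heig⟩ := Φ.isEigenfunction k
  have hv : ContDiffOn ℝ 2 (Φ.fn k ∘ e.symm) e.target := by
    have h1 : ContMDiffOn (𝓡 n) 𝓘(ℝ, ℂ) ∞ (Φ.fn k ∘ e.symm) e.target :=
      hsmooth.comp_contMDiffOn (contMDiffOn_symm_of_mem_maximalAtlas he)
    exact (contMDiffOn_iff_contDiffOn.1 h1).of_le (WithTop.coe_le_coe.2 le_top)
  have hF : ContinuousOn (Φ.fn k) e.source := hsmooth.continuous.continuousOn
  have hdivc : Continuous (divForm ρ A u) :=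
    continuous_divForm e.open_target hρ1 hρ0 hA1 hu hus
  have hdivs : tsupport (divForm ρ A u) ⊆ tsupport u :=
    closure_minimal (fun y hy => by
      by_contra hcon
      exact hy (divForm_eq_zero_of_notMem_tsupport hcon)) (isClosed_tsupport u)
  have hdivk : HasCompactSupport (divForm ρ A u) :=
    huc.of_isClosed_subset (isClosed_tsupport _) hdivs
  have key : inner ℂ (chartLp g e hwc hwk) (Φ.basis k) =
      ((lam ^ 2 - Φ.freq k ^ 2 : ℝ) : ℂ) * inner ℂ (chartLp g e hu.continuous huc) (Φ.basis k) := by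
    rw [inner_chartLp g he hwc hwk hws (Φ.basis_ae_eq k) hF,
      inner_chartLp g he hu.continuous huc hus (Φ.basis_ae_eq k) hF]
    have i1 : Integrable (fun y => (ρ y * divForm ρ A u y) • (Φ.fn k ∘ e.symm) y) :=
      integrable_mul_smul_of_tsupport_subset hρ.continuousOn hdivc hdivk (hdivs.trans hus)
        hv.continuousOn
    have i2 : Integrable (fun y => (ρ y * u y) • (Φ.fn k ∘ e.symm) y) :=
      integrable_mul_smul_of_tsupport_subset hρ.continuousOn hu.continuous huc hus hv.continuousOn
    have h2 : ∀ y, (ρ y * w y) • Φ.fn k (e.symm y) =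
        (ρ y * divForm ρ A u y) • (Φ.fn k ∘ e.symm) y +
          ((lam ^ 2 : ℝ) : ℂ) * ((ρ y * u y) • (Φ.fn k ∘ e.symm) y) := by
      intro y
      rw [hw]
      simp only [Function.comp_apply, Complex.real_smul]
      push_cast
      ring
    have h3 : ∀ y, (ρ y * u y) • divForm ρ A (Φ.fn k ∘ e.symm) y =
        ((-Φ.freq k ^ 2 : ℝ) : ℂ) * ((ρ y * u y) • (Φ.fn k ∘ e.symm) y) := by
      intro y
      by_cases hy : y ∈ e.target
      · have h4 := heig e he y hy
        rw [laplaceInChart_eq_divForm, neg_eq_iff_eq_neg] at h4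
        rw [h4]
        simp only [Function.comp_apply, Complex.real_smul]
        push_cast
        ring
      · simp [image_eq_zero_of_notMem_tsupport fun h => hy (hus h)]
    rw [integral_congr_ae (Eventually.of_forall h2)]
    rw [integral_add i1 (i2.const_mul _),
      integral_divForm_smul e.open_target hρ1 hρ0 hA1 hsymm hu huc hus hv]
    rw [integral_congr_ae (Eventually.of_forall h3)]
    rw [integral_const_mul, integral_const_mul, ← add_mul]
    congr 1
    push_cast
    ring
  rw [← inner_conj_symm, key, map_mul, inner_conj_symm, Complex.conj_ofReal]

/-- On the empty manifold `L²` is trivial and has no Hilbert basis indexed by `ℕ`. -/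
theorem LaplaceEigenbasis.isEmpty_of_isEmpty [IsEmpty M] : IsEmpty (LaplaceEigenbasis g) := by
  refine ⟨fun Φ => Φ.basis.orthonormal.ne_zero 0 ?_⟩
  exact Lp.ext (Eventually.of_forall fun x => isEmptyElim x)

/-- Quasimodes with disjoint supports force eigenvalues: every window `|μ² - lam²| ≤ κ lam` holds
an arbitrarily large number of frequencies `μ` once `lam` is large. -/
theorem exists_eventually_le_ncard (hn : 2 ≤ n) [Nonempty M] (g : Metric n M) :
    ∃ κ : ℝ, 0 < κ ∧ ∀ (Φ : LaplaceEigenbasis g) (N : ℕ), ∀ᶠ lam : ℝ in atTop,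
      N ≤ {k | |lam ^ 2 - Φ.freq k ^ 2| ≤ κ * lam}.ncard := by
  obtain ⟨x₀⟩ := ‹Nonempty M›
  set e := chartAt (EuclideanSpace ℝ (Fin n)) x₀ with he_def
  have he : e ∈ IsManifold.maximalAtlas (𝓡 n) ∞ M := IsManifold.chart_mem_maximalAtlas x₀
  have hp₀ : e x₀ ∈ e.target := mem_chart_target _ x₀
  set ρ := gramDensity g e.symm with hρ_def
  set A : EuclideanSpace ℝ (Fin n) → Matrix (Fin n) (Fin n) ℝ :=
    fun z => (gram g e.symm z)⁻¹ with hA_def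
  have hρ := contDiffOn_gramDensity g he
  have hρ0 : ∀ y ∈ e.target, 0 < ρ y := fun y hy => gramDensity_pos g he hy
  have hA := contDiffOn_gram_inv g he
  have hsymm : ∀ y ∈ e.target, ∀ i j, A y i j = A y j i := fun y hy i j => by
    have h1 := (posDef_gram g he hy).inv.isHermitian.apply j i
    simpa using h1
  obtain ⟨κ, hκ, hmodes⟩ := exists_isQuasimode_disjoint hn e.open_target hρ hρ0 hA hsymm hp₀
    fun i => (posDef_gram g he hp₀).inv.diag_pos
  have h1le : (1 : WithTop ℕ∞) ≤ ∞ := WithTop.coe_le_coe.2 le_top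
  refine ⟨κ + 1, by linarith, fun Φ N => ?_⟩
  filter_upwards [hmodes N, eventually_gt_atTop 0] with lam ⟨u, hu, hdisj⟩ hlam
  set w : Fin N → EuclideanSpace ℝ (Fin n) → ℝ := fun j y =>
    divForm ρ A (u j) y + lam ^ 2 * u j y with hw_def
  have hw0 : ∀ j, ∀ y ∉ tsupport (u j), w j y = 0 := fun j y hy => by
    simp only [hw_def]
    rw [divForm_eq_zero_of_notMem_tsupport hy, image_eq_zero_of_notMem_tsupport hy]
    ring
  have hwc : ∀ j, Continuous (w j) := fun j =>
    (continuous_divForm e.open_target (hρ.of_le h1le) (fun y hy => (hρ0 y hy).ne')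
      (fun i j => (hA i j).of_le h1le) (hu j).contDiff (hu j).tsupport_subset).add
      (continuous_const.mul (hu j).contDiff.continuous)
  have hwt : ∀ j, tsupport (w j) ⊆ tsupport (u j) := fun j =>
    closure_minimal (fun y hy => by
      by_contra hcon
      exact hy (hw0 j y hcon)) (isClosed_tsupport _)
  have hwk : ∀ j, HasCompactSupport (w j) := fun j =>
    (hu j).hasCompactSupport.of_isClosed_subset (isClosed_tsupport _) (hwt j)
  have hws : ∀ j, tsupport (w j) ⊆ e.target := fun j => (hwt j).trans (hu j).tsupport_subset
  refine card_le_ncard_of_approximate_kernel Φ.basis (fun k => lam ^ 2 - Φ.freq k ^ 2)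
    (fun j => chartLp g e (hu j).contDiff.continuous (hu j).hasCompactSupport)
    (fun j => chartLp g e (hwc j) (hwk j)) (fun j h0 => ?_) (fun i j hij => ?_) (fun i j hij => ?_)
    (C := κ * lam) (by positivity) (by linarith) (fun j => ?_) (fun k j => ?_) ?_
  · have h1 := norm_sq_chartLp g he (hu j).contDiff.continuous (hu j).hasCompactSupport
      (hu j).tsupport_subset
    rw [h0, norm_zero] at h1
    have h2 := (hu j).integral_pos
    rw [← h1] at h2
    norm_num at h2
  · refine (inner_chartLp_chartLp g he (hu i).contDiff.continuous (hu i).hasCompactSupport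
      (hu i).tsupport_subset (hu j).contDiff.continuous (hu j).hasCompactSupport).trans ?_
    have h1 : ∀ y, u i y * u j y = 0 := fun y => by
      by_cases hy : y ∈ tsupport (u i)
      · rw [image_eq_zero_of_notMem_tsupport (Set.disjoint_left.1 (hdisj hij) hy), mul_zero]
      · rw [image_eq_zero_of_notMem_tsupport hy, zero_mul]
    simp [h1]
  · refine (inner_chartLp_chartLp g he (hwc i) (hwk i) (hws i) (hwc j) (hwk j)).trans ?_
    have h1 : ∀ y, w i y * w j y = 0 := fun y => by
      by_cases hy : y ∈ tsupport (u i)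
      · rw [hw0 j y (Set.disjoint_left.1 (hdisj hij) hy), mul_zero]
      · rw [hw0 i y hy, zero_mul]
    simp [h1]
  · have h1 := (hu j).integral_le
    rw [← norm_sq_chartLp g he (hu j).contDiff.continuous (hu j).hasCompactSupport
      (hu j).tsupport_subset, ← norm_sq_chartLp g he (hwc j) (hwk j) (hws j), ← mul_pow] at h1
    exact le_of_sq_le_sq h1 (by positivity)
  · exact Φ.inner_chartLp_helmholtz he (hu j).contDiff (hu j).hasCompactSupport
      (hu j).tsupport_subset lam rfl (hwc j) (hwk j) (hws j) k
  · refine (Φ.finite_freq_le √(lam ^ 2 + (κ + 1) * lam)).subset fun k hk => ?_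
    have h1 := (abs_le.1 (show |lam ^ 2 - Φ.freq k ^ 2| ≤ (κ + 1) * lam from hk)).1
    exact Real.le_sqrt_of_sq_le (by linarith)

/-- Windows of a fixed length far out in the spectrum hold arbitrarily many frequencies. -/
theorem exists_eventually_le_ncard_Ioc (hn : 2 ≤ n) (g : Metric n M) :
    ∃ D : ℝ, 0 < D ∧ ∀ (Φ : LaplaceEigenbasis g) (N : ℕ), ∀ᶠ L : ℝ in atTop,
      N ≤ {k | Φ.freq k ∈ Ioc L (L + D)}.ncard := by
  rcases isEmpty_or_nonempty M with hM | hM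
  · exact ⟨1, one_pos, fun Φ => (LaplaceEigenbasis.isEmpty_of_isEmpty.false Φ).elim⟩
  obtain ⟨κ, hκ, hcount⟩ := exists_eventually_le_ncard hn g
  refine ⟨2 * κ + 1, by positivity, fun Φ N => ?_⟩
  have hshift : Tendsto (fun L : ℝ => L + (κ + 1 / 2)) atTop atTop :=
    tendsto_atTop_add_const_right _ _ tendsto_id
  filter_upwards [hshift.eventually (hcount Φ N), eventually_gt_atTop 0] with L hL hL0
  refine hL.trans (ncard_le_ncard (fun k hk => ?_)
    ((Φ.finite_freq_le (L + (2 * κ + 1))).subset fun k hk => hk.2))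
  -- the frequencies within `κ` of the midpoint of `(L, L + 2 κ + 1]`
  set lam := L + (κ + 1 / 2) with hlam
  have hlam0 : 0 < lam := by positivity
  have hk' : |lam ^ 2 - Φ.freq k ^ 2| ≤ κ * lam := hk
  have h0 := Φ.freq_nonneg k
  have h1 : |lam - Φ.freq k| ≤ κ := by
    have h2 : |lam ^ 2 - Φ.freq k ^ 2| = |lam - Φ.freq k| * (lam + Φ.freq k) := by
      rw [show lam ^ 2 - Φ.freq k ^ 2 = (lam - Φ.freq k) * (lam + Φ.freq k) by ring, abs_mul,
        abs_of_nonneg (show 0 ≤ lam + Φ.freq k by positivity)]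
    have h3 : |lam - Φ.freq k| * lam ≤ κ * lam := by
      rw [h2] at hk'
      nlinarith [abs_nonneg (lam - Φ.freq k)]
    exact le_of_mul_le_mul_right h3 hlam0
  rw [abs_le] at h1
  constructor <;> linarith [h1.1, h1.2]

/-- If the limits of the window differ, its length after rescaling tends to infinity; if they agree,
the window contains `(a_h / h, a_h / h + D]`, whose position tends to infinity as `a₀ > 0`. -/
theorem LaplaceEigenbasis.tendsto_clusterDim (Φ : LaplaceEigenbasis g) {D : ℝ}
    (hD : ∀ N : ℕ, ∀ᶠ L : ℝ in atTop, N ≤ {k | Φ.freq k ∈ Ioc L (L + D)}.ncard) {a b : ℝ → ℝ}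
    (hab : IsWindow D a b) :
    Tendsto (fun h => Φ.clusterDim (a h) (b h) h) (𝓝[>] 0) atTop := by
  have hinv : Tendsto (fun h : ℝ => h⁻¹) (𝓝[>] 0) atTop := tendsto_inv_nhdsGT_zero
  have hIoc : ∀ᶠ h : ℝ in 𝓝[>] 0, h ∈ Ioc (0 : ℝ) 1 := Ioc_mem_nhdsGT one_pos
  -- the window holds an interval of length `D` whose position tends to infinity
  obtain ⟨L, hL, hLab⟩ : ∃ L : ℝ → ℝ, Tendsto L (𝓝[>] 0) atTop ∧
      ∀ᶠ h in 𝓝[>] 0, a h / h ≤ L h ∧ L h + D ≤ b h / h := by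
    obtain ⟨-, a₀, b₀, ha, hb, ha₀, hab₀, heq⟩ := hab
    rcases hab₀.eq_or_lt with h | h
    · obtain ⟨hpos, hDab⟩ := heq h
      refine ⟨fun h => a h / h, ha.pos_mul_atTop hpos hinv, ?_⟩
      filter_upwards [hIoc] with h hh
      refine ⟨le_rfl, ?_⟩
      rw [div_add' _ _ _ hh.1.ne']
      have := hDab h hh
      gcongr
      · exact hh.1.le
      · linarith
    · refine ⟨fun h => (a₀ + b₀) / 2 * h⁻¹, hinv.const_mul_atTop (by linarith), ?_⟩
      have h1 : Tendsto (fun h : ℝ => D * h) (𝓝[>] 0) (𝓝 0) := by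
        have : Tendsto (fun h : ℝ => D * h) (𝓝 0) (𝓝 (D * 0)) := tendsto_id.const_mul D
        rw [mul_zero] at this
        exact this.mono_left nhdsWithin_le_nhds
      filter_upwards [hIoc, ha.eventually_lt_const (u := (a₀ + b₀) / 2) (by linarith),
        hb.eventually_const_lt (u := (a₀ + 3 * b₀) / 4) (by linarith),
        h1.eventually_lt_const (u := (b₀ - a₀) / 4) (by linarith)] with t ht ht1 ht2 ht3
      have ht0 : 0 < t := ht.1
      rw [← div_eq_mul_inv]
      refine ⟨by gcongr, ?_⟩
      rw [div_add' _ _ _ ht0.ne']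
      gcongr
      linarith
  refine tendsto_atTop.2 fun N => ?_
  filter_upwards [hL.eventually (hD N), hLab] with h h1 h2
  rw [Φ.clusterDim_eq_card, ← ncard_coe_finset]
  refine h1.trans (ncard_le_ncard (fun k hk => ?_) (Finset.finite_toSet _))
  rw [Finset.mem_coe, Φ.mem_index]
  exact ⟨h2.1.trans_lt hk.1, hk.2.trans h2.2⟩

end Count

end EigenPeriod

theorem mainTheorem3 (n : ℕ) (hn : 2 ≤ n) (M : Type*) [TopologicalSpace M] [T2Space M]
    [CompactSpace M] [ChartedSpace (EuclideanSpace ℝ (Fin n)) M] [IsManifold (𝓡 n) ∞ M]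
    [MeasurableSpace M] [BorelSpace M] (g : EigenPeriod.Metric n M) :
    ∃ D : ℝ, 0 < D ∧
      ∀ (Φ : EigenPeriod.LaplaceEigenbasis g)
        (d : ℕ) (X : Type*) [TopologicalSpace X] [CompactSpace X]
        [ChartedSpace (EuclideanSpace ℝ (Fin d)) X] [IsManifold (𝓡 d) ∞ X]
        [MeasurableSpace X] [BorelSpace X]
        (ι : X → M) (_ : Manifold.IsSmoothEmbedding (𝓡 d) (𝓡 n) ∞ ι)
        (p : ℝ) (_ : 0 < p),
        (∀ a b h : ℝ, 0 < h → a < b →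
          Φ.clusterPeriodSum (d := d) ι a b h = ‖Φ.periodVector (d := d) ι a b h‖ ^ 2 ∧
          (0 < Φ.clusterDim a b h →
            Φ.periodMoment (d := d) ι p a b h =
              p / 2 * Φ.clusterPeriodSum (d := d) ι a b h ^ (p / 2) *
                ProbabilityTheory.beta (p / 2) (Φ.clusterDim a b h))) ∧
        (∀ a b : ℝ → ℝ, EigenPeriod.IsWindow D a b →
          Tendsto (fun h => Φ.clusterDim (a h) (b h) h) (𝓝[>] 0) atTop ∧
          ∃ ε : ℝ → ℝ, Tendsto ε (𝓝[>] 0) (𝓝 0) ∧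
            ∀ᶠ h in 𝓝[>] 0,
              Φ.periodMoment (d := d) ι p (a h) (b h) h =
                Real.Gamma (p / 2 + 1) *
                  (Φ.clusterPeriodSum (d := d) ι (a h) (b h) h / Φ.clusterDim (a h) (b h) h) ^ (p / 2) *
                  (1 + ε h)) := by
  obtain ⟨D, hD, hcount⟩ := EigenPeriod.exists_eventually_le_ncard_Ioc hn g
  refine ⟨D, hD, fun Φ d X _ _ _ _ _ _ ι hι p hp => ⟨fun a b h hh hab =>
    ⟨Φ.clusterPeriodSum_eq ι hh hab, Φ.periodMoment_eq hι.contMDiff hp hh hab⟩,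
    fun a b hab => ?_⟩⟩
  have hN := Φ.tendsto_clusterDim (hcount Φ) hab
  exact ⟨hN, Φ.exists_periodMoment_asymptotic hι.contMDiff hp hab.1 hN⟩
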